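/- Let $n\ge 3$ and $m>n/2+1$ be integers, and let $\tau>0$, $b,c,k\in\mathbb R$. Let $g$ be a memory kernel on $\mathbb R^+=(0,\infty)$ such that - $g\in W^{1,1}(\mathbb R^+)$ is differentiable and $g'$ is locally absolutely continuous on $\mathbb R^+$; - $g\ge 0$ and $0<\int_0^\infty g(s)\,ds<c^2$; - there is $\zeta>0$ with $g'(s)\le-\zeta g(s)$ for all $s>0$; - $g''\ge 0$ almost everywhere. Put $c_g^2=c^2-\int_0^\infty g(s)\,ds$ and assume $b>\tau c^2>\tau c_g^2$. For functions $\eta$ of $s>0$ and $x\in\mathbb R^n$ write $\|\eta\|^2_{L^2,-g'}=\int_0^\infty(-g'(s))\|\eta(s)\|^2_{L^2(\mathbb R^n)}\,ds$. Let $T\ge0$ and let $\Psi=(\psi,v,w,\eta)$ be a solution on $[0,T]$ of $$\psi_t=v,\qquad v_t=w,\qquad \tau w_t=-w+c_g^2\Delta\psi+b\Delta v+\int_0^\infty g(s)\Delta\eta(s)\,ds+2(kvw+\nabla\psi\cdot\nabla v),\qquad \eta_t=v-\eta_s,$$ with $\eta|_{s=0}=0$ and $\eta|_{t=0}=\psi(0)$,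 such that $$\nabla\psi\in C([0,T];H^{m-1}(\mathbb R^n)),\qquad v\in C([0,T];H^m(\mathbb R^n)),\qquad w\in C([0,T];H^{m-1}(\mathbb R^n)).$$ Here the first equation means $\psi(t)=\psi(0)+\int_0^t v(r)\,dr$, the second and third hold at every $t\in[0,T]$ with time derivatives in $L^2(\mathbb R^n)$, and the fourth is understood along characteristics: $\eta(t,s)=\psi(t)-\psi(t-s)$ for $0<s\le t$ and $\eta(t,s)=\psi(t)$ for $s>t$. Write $\Psi_0=\Psi(0)$. For $\kappa\ge 0$ define $$\begin{aligned}\mathcal E^{(\kappa)}[\Psi]={}&\|\nabla^{\kappa+1}(\psi+\tau v)\|_{L^2}^2+\|\nabla^\kappa(v+\tau w)\|_{L^2}^2+\|\nabla^{\kappa+1}v\|_{L^2}^2+\|\nabla^{\kappa+1}\eta\|_{L^2,-g'}^2+\|\nabla^\kappa w\|_{L^2}^2\\&+\|\Delta\nabla^\kappa(\psi+\tau v)\|_{L^2}^2+\|\nabla^{\kappa+1}(v+\tau w)\|_{L^2}^2+\|\Delta\nabla^\kappa v\|_{L^2}^2+\|\Delta\nabla^\kappa\eta\|_{L^2,-g'}^2,\\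 \mathcal D^{(\kappa)}[\Psi]={}&\|\nabla^{\kappa+1}v\|_{L^2}^2+\|\nabla^{\kappa+1}\eta\|_{L^2,-g'}^2+\|\Delta\nabla^\kappa(\psi+\tau v)\|_{L^2}^2+\|\nabla^{\kappa+1}(v+\tau w)\|_{L^2}^2\\&+\|\Delta\nabla^\kappa v\|_{L^2}^2+\|\Delta\nabla^\kappa\eta\|_{L^2,-g'}^2+\|\nabla^\kappa w\|_{L^2}^2,\end{aligned}$$ and, for $p\geq 1$, $$\|\Psi\|^2_{\mathcal E_p(t)}=\sup_{0\le\sigma\le t}\sum_{\kappa=0}^p\mathcal E^{(\kappa)}[\Psi](\sigma),\qquad \|\Psi\|^2_{\mathcal D_p(t)}=\int_0^t\sum_{\kappa=0}^p\mathcal D^{(\kappa)}[\Psi](\sigma)\,d\sigma .$$ Then there is a constant $C>0$, depending only on $n,m,\tau,b,c,k,g$ (in particular not on $t$, $T$ or the solution), such that for every such $T$ and $\Psi$ and every $t\in[0,T]$ both norms $\|\Psi\|_{\mathcal E_{m-2}(t)}$ and $\|\Psi\|_{\mathcal D_{m-2}(t)}$ are finite and $$\|\Psi\|^2_{\mathcal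 E_{m-2}(t)}+\|\Psi\|^2_{\mathcal D_{m-2}(t)}\le C\Big(\|\Psi_0\|^2_{\mathcal E_{m-2}(0)}+\|\Psi\|_{\mathcal E_{m-2}(t)}\,\|\Psi\|^2_{\mathcal D_{m-2}(t)}\Big).$$ -/

import Mathlib

open MeasureTheory Set
open scoped NNReal ENNReal

noncomputable section

namespace JMGT

/-- The space `ℝⁿ` with its Euclidean norm. -/
abbrev Rn (n : ℕ) : Type := EuclideanSpace ℝ (Fin n)

/-- The space `L²(ℝⁿ)` of real-valued functions. -/
abbrev L2 (n : ℕ) : Type := Lp ℝ 2 (volume : Measure (Rn n))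

/-- `g ∈ L²(ℝⁿ)` is the weak derivative `∂_{α 0} ⋯ ∂_{α (κ-1)} f` of order `κ` of the locally
integrable function `f`. -/
def HasWeakDeriv {n κ : ℕ} (α : Fin κ → Fin n) (f : Rn n → ℝ) (g : L2 n) : Prop :=
  LocallyIntegrable f volume ∧
    ∀ φ : Rn n → ℝ, ContDiff ℝ ((⊤ : ℕ∞) : WithTop ℕ∞) φ → HasCompactSupport φ →
      ∫ x, f x * iteratedFDeriv ℝ κ φ x (fun j => EuclideanSpace.single (α j) (1 : ℝ)) =
        (-1 : ℝ) ^ κ * ∫ x, g x * φ x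

open Classical in
/-- The weak derivative `∂_{α 0} ⋯ ∂_{α (κ-1)} f ∈ L²(ℝⁿ)`. It is unique where it exists; the
value is `0` where there is none in `L²`, which does not occur for the functions considered. -/
def weakDeriv {n κ : ℕ} (α : Fin κ → Fin n) (f : Rn n → ℝ) : L2 n :=
  if h : ∃ g : L2 n, HasWeakDeriv α f g then h.choose else 0

/-- The weak derivative `Δ ∂_{α 0} ⋯ ∂_{α (κ-1)} f ∈ L²(ℝⁿ)`. -/
def lapDeriv {n κ : ℕ} (α : Fin κ → Fin n) (f : Rn n → ℝ) : L2 n :=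
  ∑ j : Fin n, weakDeriv (Fin.cons j (Fin.cons j α) : Fin (κ + 2) → Fin n) f

/-- The weak partial derivative `∂_j f`. -/
def weakPartial {n : ℕ} (j : Fin n) (f : Rn n → ℝ) : L2 n :=
  weakDeriv (fun _ : Fin 1 => j) f

/-- The weak Laplacian `Δ f`. -/
def lap {n : ℕ} (f : Rn n → ℝ) : L2 n :=
  lapDeriv (Fin.elim0 : Fin 0 → Fin n) f

/-- `‖∇^κ f‖²_{L²}`. -/
def gradSq {n : ℕ} (κ : ℕ) (f : Rn n → ℝ) : ℝ≥0∞ :=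
  ∑ α : Fin κ → Fin n, ‖weakDeriv α f‖ₑ ^ 2

/-- `‖Δ ∇^κ f‖²_{L²}`. -/
def lapGradSq {n : ℕ} (κ : ℕ) (f : Rn n → ℝ) : ℝ≥0∞ :=
  ∑ α : Fin κ → Fin n, ‖lapDeriv α f‖ₑ ^ 2

/-- All weak derivatives of `f` of the orders `p, …, q` exist and are in `L²(ℝⁿ)`. For `p = 0` this
is the Sobolev space `H^q(ℝⁿ)`, for `p = 1` it is `{f : ∇f, …, ∇^q f ∈ L²(ℝⁿ)}`. -/
def MemDerivs {n : ℕ} (p q : ℕ) (f : Rn n → ℝ) : Prop :=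
  ∀ κ : ℕ, p ≤ κ → κ ≤ q → ∀ α : Fin κ → Fin n, ∃ g : L2 n, HasWeakDeriv α f g

/-- `u ∈ C([0,T]; X)`, where `X` is the space of functions whose weak derivatives of the orders
`p, …, q` are in `L²(ℝⁿ)`, with the corresponding (semi)norm. -/
def ContDerivs {n : ℕ} (T : ℝ) (p q : ℕ) (u : ℝ → Rn n → ℝ) : Prop :=
  (∀ t ∈ Icc 0 T, MemDerivs p q (u t)) ∧
    ∀ κ : ℕ, p ≤ κ → κ ≤ q → ∀ α : Fin κ → Fin n,
      ContinuousOn (fun t => weakDeriv α (u t)) (Icc 0 T)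

/-- The assumptions on the memory kernel `g` on `(0, ∞)`, for a given speed of sound `c`. -/
structure IsMemoryKernel (c : ℝ) (g : ℝ → ℝ) : Prop where
  differentiable : ∀ s ∈ Ioi (0 : ℝ), DifferentiableAt ℝ g s
  integrable : IntegrableOn g (Ioi 0)
  integrable_deriv : IntegrableOn (deriv g) (Ioi 0)
  deriv_locally_ac : ∀ s₁ s₂ : ℝ, 0 < s₁ → s₁ < s₂ →
    AbsolutelyContinuousOnInterval (deriv g) s₁ s₂
  nonneg : ∀ s ∈ Ioi (0 : ℝ), 0 ≤ g s
  integral_pos : 0 < ∫ s in Ioi (0 : ℝ), g s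
  integral_lt : ∫ s in Ioi (0 : ℝ), g s < c ^ 2
  decay : ∃ ζ : ℝ, 0 < ζ ∧ ∀ s ∈ Ioi (0 : ℝ), deriv g s ≤ -ζ * g s
  convex : ∀ᵐ s ∂(volume.restrict (Ioi (0 : ℝ))), 0 ≤ deriv (deriv g) s

/-- The modified squared speed `c_g² = c² - ∫₀^∞ g(s) ds`. -/
def cgSq (c : ℝ) (g : ℝ → ℝ) : ℝ :=
  c ^ 2 - ∫ s in Ioi (0 : ℝ), g s

/-- A value `Ψ = (ψ, v, w, η)`, where `η` depends on `s > 0` and `x ∈ ℝⁿ`. -/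
structure State (n : ℕ) where
  psi : Rn n → ℝ
  v : L2 n
  w : L2 n
  eta : ℝ → Rn n → ℝ

/-- `Ψ = (ψ, v, w, η)` solves on `[0,T]` the first-order system of the equation
`τ ψ_ttt + ψ_tt - c² Δψ - b Δψ_t + ∫₀ᵗ g(s) Δψ(t-s) ds = (k ψ_t² + |∇ψ|²)_t`
in the class `C([0,T]; ℋ^{m-1})`,
`ℋ^{m-1} = {ψ : ∇ψ, …, ∇^m ψ ∈ L²} × H^m × H^{m-1} × {η : ∇η, …, ∇^m η ∈ L²_{-g'}}`. -/
structure IsSolution {n : ℕ} (m : ℕ) (τ b c k : ℝ) (g : ℝ → ℝ) (T : ℝ)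
    (Ψ : ℝ → State n) : Prop where
  cont_psi : ContDerivs T 1 m (fun t => (Ψ t).psi)
  cont_v : ContDerivs T 0 m (fun t => (Ψ t).v)
  cont_w : ContDerivs T 0 (m - 1) (fun t => (Ψ t).w)
  /-- `ψ_t = v`, integrated in time since `ψ` itself need not be in `L²`. -/
  eq_psi : ∀ t ∈ Icc 0 T,
    ∀ᵐ x : Rn n, (Ψ t).psi x = (Ψ 0).psi x + (∫ r in (0 : ℝ)..t, (Ψ r).v : L2 n) x
  /-- `v_t = w`. -/
  eq_v : ∀ t ∈ Icc 0 T, HasDerivWithinAt (fun r => (Ψ r).v) (Ψ t).w (Icc 0 T) t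
  /-- `τ w_t = - w + c_g² Δψ + b Δv + ∫₀^∞ g(s) Δη(s) ds + 2 (k v w + ∇ψ · ∇v)`, with the time
  derivative and the integral over `s` taken in `L²(ℝⁿ)`. -/
  eq_w : ∀ t ∈ Icc 0 T, ∃ wt : L2 n,
    HasDerivWithinAt (fun r => (Ψ r).w) wt (Icc 0 T) t ∧
    ∀ᵐ x : Rn n, τ * wt x =
      - (Ψ t).w x + cgSq c g * lap (Ψ t).psi x + b * lap (Ψ t).v x
        + (∫ s in Ioi (0 : ℝ), g s • lap ((Ψ t).eta s) : L2 n) x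
        + 2 * (k * (Ψ t).v x * (Ψ t).w x
          + ∑ j : Fin n, weakPartial j (Ψ t).psi x * weakPartial j (Ψ t).v x)
  /-- `η` is the past-history variable of `ψ`. This is the solution along characteristics of
  `η_t = v - η_s` with `η = 0` at `s = 0` and `η = ψ(0)` at `t = 0`. -/
  eq_eta : ∀ t ∈ Icc 0 T, ∀ᵐ s ∂(volume.restrict (Ioi (0 : ℝ))), ∀ᵐ x : Rn n,
    (Ψ t).eta s x =
      if s ≤ t then (Ψ t).psi x - (Ψ (t - s)).psi x else (Ψ t).psi x

/-- `‖∇^κ η‖²_{L², -g'} = ∫₀^∞ (-g'(s)) ‖∇^κ η(s)‖²_{L²} ds`. -/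
def histGradSq {n : ℕ} (g : ℝ → ℝ) (κ : ℕ) (η : ℝ → Rn n → ℝ) : ℝ≥0∞ :=
  ∫⁻ s in Ioi (0 : ℝ), ENNReal.ofReal (-deriv g s) * gradSq κ (η s)

/-- `‖Δ ∇^κ η‖²_{L², -g'} = ∫₀^∞ (-g'(s)) ‖Δ ∇^κ η(s)‖²_{L²} ds`. -/
def histLapGradSq {n : ℕ} (g : ℝ → ℝ) (κ : ℕ) (η : ℝ → Rn n → ℝ) : ℝ≥0∞ :=
  ∫⁻ s in Ioi (0 : ℝ), ENNReal.ofReal (-deriv g s) * lapGradSq κ (η s)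

/-- The function `ψ + τ v`. -/
def State.psiV {n : ℕ} (τ : ℝ) (Ψ : State n) : Rn n → ℝ :=
  fun x => Ψ.psi x + τ * Ψ.v x

/-- The function `v + τ w`. -/
def State.vW {n : ℕ} (τ : ℝ) (Ψ : State n) : Rn n → ℝ :=
  fun x => Ψ.v x + τ * Ψ.w x

/-- The energy `ℰ^{(κ)}[Ψ]`. -/
def energy {n : ℕ} (τ : ℝ) (g : ℝ → ℝ) (κ : ℕ) (Ψ : State n) : ℝ≥0∞ :=
  gradSq (κ + 1) (Ψ.psiV τ) + gradSq κ (Ψ.vW τ) + gradSq (κ + 1) Ψ.v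
    + histGradSq g (κ + 1) Ψ.eta + gradSq κ Ψ.w
    + lapGradSq κ (Ψ.psiV τ) + gradSq (κ + 1) (Ψ.vW τ)
    + lapGradSq κ Ψ.v + histLapGradSq g κ Ψ.eta

/-- The dissipation `𝒟^{(κ)}[Ψ]`. -/
def dissipation {n : ℕ} (τ : ℝ) (g : ℝ → ℝ) (κ : ℕ) (Ψ : State n) : ℝ≥0∞ :=
  gradSq (κ + 1) Ψ.v + histGradSq g (κ + 1) Ψ.eta
    + lapGradSq κ (Ψ.psiV τ) + gradSq (κ + 1) (Ψ.vW τ)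
    + lapGradSq κ Ψ.v + histLapGradSq g κ Ψ.eta + gradSq κ Ψ.w

/-- `‖Ψ‖²_{ℰ_p(t)} = sup_{0 ≤ σ ≤ t} ∑_{κ=0}^p ℰ^{(κ)}[Ψ](σ)`. -/
def energyNormSq {n : ℕ} (τ : ℝ) (g : ℝ → ℝ) (p : ℕ) (Ψ : ℝ → State n) (t : ℝ) : ℝ≥0∞ :=
  ⨆ σ ∈ Icc 0 t, ∑ κ ∈ Finset.range (p + 1), energy τ g κ (Ψ σ)

/-- `‖Ψ‖_{ℰ_p(t)}`. -/
def energyNorm {n : ℕ} (τ : ℝ) (g : ℝ → ℝ) (p : ℕ) (Ψ : ℝ → State n) (t : ℝ) : ℝ≥0∞ :=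
  energyNormSq τ g p Ψ t ^ (1 / 2 : ℝ)

/-- `‖Ψ‖²_{𝒟_p(t)} = ∫₀ᵗ ∑_{κ=0}^p 𝒟^{(κ)}[Ψ](σ) dσ`. -/
def dissNormSq {n : ℕ} (τ : ℝ) (g : ℝ → ℝ) (p : ℕ) (Ψ : ℝ → State n) (t : ℝ) : ℝ≥0∞ :=
  ∫⁻ σ in Icc 0 t, ∑ κ ∈ Finset.range (p + 1), dissipation τ g κ (Ψ σ)

end JMGT

end

open MeasureTheory Set
open scoped NNReal ENNReal
set_option linter.unusedSectionVars false

noncomputable section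

/-! The estimate is proved on the Fourier side. Let A be multiplication by 2π|ξ|, i.e. (-Δ)^{1/2}.
The function ψ need not be in L² and enters only through p = Aψ, an L² curve built from ∇ψ with
Riesz transforms (`gradFt`). The system becomes p' = Av, v' = w, τw' = -w - aAp - (β + τM + τa)A²v -
AG + N. Here a = c_g² > 0, M = ∫g, β = b - τc² > 0, G is the g-weighted integral of the history η of
p, and N is the nonlinearity.

Linear part. Put y = v + τw, z = p + τAv and h = -g'. Half the sum of |y|², a|z|², τ(β + τM)|Av|²,
∫g|η|², 2τ(G, Av) and τ∫h|η|² should have derivative at most -β|Av|² - ½∫h|η|² + (N, y). Since h is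
merely decreasing, ∫h|η|² admits only an upper bound on its growth (`histSq_le_primitive`). It is
therefore replaced by its initial value plus the integral of that bound. The new functional is
differentiable, its derivative is exact (`IsLinearSolution.hasDerivWithinAt_lyapunov`), and it still
dominates the energy. The same functional for A(p, v, w), together with a small cross term
(`IsLinearSolution.hasDerivWithinAt_crossTerm`), supplies the dissipation of Az, Ay and w.
Integration in time gives `exists_energy_inequality`. Its constants do not depend on the operator A,
which is assumed bounded there.

Truncation. The bounded A is 2π|ξ| cut off at |ξ| ≤ N, and the unknowns are multiplied by the square
root of ∑_{κ ≤ m-2} (2π|ξ|)^{2κ}, cut off in the same way. All orders κ are thus treated at once,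
every differentiation in time is legitimate in L², and N → ∞ follows by monotone convergence
(`exists_freqEnergy_estimate`).

Nonlinear part. The transform of N is bounded by convolutions of absolute values
(`enorm_ft_le_sum`), and the task is to bound N against the test element by energy^{1/2} times
dissipation (`FreqBounds.lintegral_nonlinear_le`). The obstacle is low frequencies: the dissipation
contains Av and Ay, but neither v nor y. Weighted Cauchy-Schwarz inequalities for convolutions work
with the homogeneous weight |ξ|, because |ξ|^{-2} is locally integrable for n ≥ 3 and (1 +
|ξ|)^{-2(m-1)} is integrable for m - 1 > n/2. Since N is bounded as a whole in H^{m-1}, no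
commutators appear.

It remains to identify the sums of energies and dissipations of a solution with their Fourier
counterparts (`IsSolution.sum_energy_eq`, `IsSolution.sum_dissipation_eq`), to check finiteness, and
to show that the truncated curves solve the linear system (`IsSolution.isLinearSolution_cut`). -/

namespace JMGT

/-! ### Volterra convolutions with an integrable kernel -/

section Volterra

variable {F : Type*} [NormedAddCommGroup F] [NormedSpace ℝ F] [CompleteSpace F]

/-- The primitive of a continuous function on `[0, T]` is differentiable within `[0, T]`. -/
theorem hasDerivWithinAt_primitive {f : ℝ → F} {T t : ℝ}
    (hf : ContinuousOn f (Icc 0 T)) (ht : t ∈ Icc 0 T) :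
    HasDerivWithinAt (fun x => ∫ r in (0 : ℝ)..x, f r) (f t) (Icc 0 T) t := by
  have hT : (0 : ℝ) ≤ T := ht.1.trans ht.2
  have hc : Continuous (IccExtend hT ((Icc 0 T).domRestrict f)) :=
    (continuousOn_iff_continuous_domRestrict.1 hf).Icc_extend'
  have h1 := (intervalIntegral.integral_hasDerivAt_right (hc.intervalIntegrable 0 t)
    (hc.stronglyMeasurableAtFilter _ _) hc.continuousAt).hasDerivWithinAt (s := Icc 0 T)
  have hE : ∀ x ∈ Icc 0 T, IccExtend hT ((Icc 0 T).domRestrict f) x = f x := fun x hx => by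
    rw [IccExtend_of_mem hT _ hx]; rfl
  rw [hE t ht] at h1
  refine h1.congr (fun x hx => ?_) ?_
  · refine intervalIntegral.integral_congr (fun r hr => ?_)
    rw [uIcc_of_le hx.1] at hr
    exact (hE r ⟨hr.1, hr.2.trans hx.2⟩).symm
  · refine intervalIntegral.integral_congr (fun r hr => ?_)
    rw [uIcc_of_le ht.1] at hr
    exact (hE r ⟨hr.1, hr.2.trans ht.2⟩).symm

/-- The Volterra convolution `∫₀ᵗ k(s) q(t - s) ds`. -/
def volterra (k : ℝ → ℝ) (q : ℝ → F) (t : ℝ) : F :=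
  ∫ s in Ioc 0 t, k s • q (t - s)

theorem integrableOn_volterra {k : ℝ → ℝ} {q : ℝ → F} (hk : IntegrableOn k (Ioi 0))
    (hq : Continuous q) (t : ℝ) : IntegrableOn (fun s => k s • q (t - s)) (Ioc 0 t) := by
  have h1 : IntegrableOn k (Icc 0 t) := by
    rw [integrableOn_Icc_iff_integrableOn_Ioc]
    exact hk.mono_set Ioc_subset_Ioi_self
  have h2 : ContinuousOn (fun s => q (t - s)) (Icc 0 t) := by fun_prop
  exact (h1.smul_continuousOn h2 isCompact_Icc).mono_set Ioc_subset_Icc_self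

theorem continuousOn_volterra {k : ℝ → ℝ} {q : ℝ → F} (hk : IntegrableOn k (Ioi 0))
    (hq : Continuous q) (T : ℝ) : ContinuousOn (volterra k q) (Icc 0 T) := by
  -- Subtracting `q 0` and freezing negative arguments makes the integrand vanish beyond `t`. The
  -- domain of integration then no longer depends on `t` and dominated convergence applies; the
  -- subtracted constant only contributes a primitive of `k`.
  set q0 : ℝ → F := fun r => q (max r 0) - q 0 with hq0
  have hq0c : Continuous q0 := by fun_prop
  have hneg : ∀ r ≤ 0, q0 r = 0 := fun r hr => by simp [hq0, max_eq_right hr]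
  obtain ⟨B, hB⟩ := (isCompact_Icc (a := (0 : ℝ)) (b := T)).exists_bound_of_continuousOn
    hq0c.continuousOn
  have hB' : ∀ r ≤ T, ‖q0 r‖ ≤ max B 0 := fun r hr => by
    rcases le_total r 0 with h | h
    · rw [hneg r h]; simp
    · exact (hB r ⟨h, hr⟩).trans (le_max_left _ _)
  have h1 : ContinuousOn (fun t => ∫ s in Ioi (0 : ℝ), k s • q0 (t - s)) (Icc 0 T) := by
    refine continuousOn_of_dominated (bound := fun s => ‖k s‖ * max B 0) ?_ ?_ ?_ ?_
    · intro t _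
      exact hk.aestronglyMeasurable.smul
        (by fun_prop : Continuous fun s => q0 (t - s)).aestronglyMeasurable
    · intro t ht
      refine (ae_restrict_iff' measurableSet_Ioi).2 (Filter.Eventually.of_forall fun s hs => ?_)
      rw [norm_smul]
      refine mul_le_mul_of_nonneg_left (hB' _ ?_) (norm_nonneg _)
      have := hs.out; linarith [ht.2]
    · exact hk.norm.mul_const _
    · exact Filter.Eventually.of_forall fun s => by fun_prop
  have h2 : ContinuousOn (fun t => (∫ s in Ioc 0 t, k s) • q 0) (Icc 0 T) := by
    refine ContinuousOn.smul ?_ continuousOn_const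
    refine intervalIntegral.continuousOn_primitive ?_
    rw [integrableOn_Icc_iff_integrableOn_Ioc]
    exact hk.mono_set Ioc_subset_Ioi_self
  refine (h1.add h2).congr fun t ht => ?_
  have e1 : ∫ s in Ioi (0 : ℝ), k s • q0 (t - s) = ∫ s in Ioc 0 t, k s • q0 (t - s) := by
    refine (setIntegral_eq_of_subset_of_forall_sdiff_eq_zero measurableSet_Ioi
      Ioc_subset_Ioi_self fun s hs => ?_)
    rw [hneg, smul_zero]
    have := hs.1.out
    by_contra hc
    exact hs.2 ⟨this, by linarith⟩
  simp only [Pi.add_apply, volterra]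
  rw [e1, ← integral_smul_const, ← integral_add (integrableOn_volterra hk hq0c t)]
  · refine setIntegral_congr_fun measurableSet_Ioc fun s hs => ?_
    simp [hq0, max_eq_left (sub_nonneg.2 hs.2), smul_sub]
  · exact (hk.mono_set Ioc_subset_Ioi_self).smul_const _

/-- Fubini on the triangle 0 < s ≤ ρ ≤ t. Extending `h` and `q` by zero turns the triangle into a
product domain, where the convolution integrand of two integrable functions is integrable. -/
theorem integral_volterra {h : ℝ → ℝ} {q : ℝ → F} (hh : IntegrableOn h (Ioi 0))
    (hq : Continuous q) {t : ℝ} (ht : 0 ≤ t) :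
    ∫ ρ in (0 : ℝ)..t, volterra h q ρ = ∫ r in (0 : ℝ)..t, (∫ s in (0 : ℝ)..(t - r), h s) • q r := by
  set h' : ℝ → ℝ := (Ioi 0).indicator h with hh'
  set q' : ℝ → F := (Icc 0 t).indicator q with hq'
  have ih : Integrable h' := (integrable_indicator_iff measurableSet_Ioi).2 hh
  have iq : Integrable q' := (integrable_indicator_iff measurableSet_Icc).2
    hq.continuousOn.integrableOn_Icc
  have key := Integrable.convolution_integrand (μ := volume) (ν := volume)
    (ContinuousLinearMap.lsmul ℝ ℝ).flip iq ih
  have key2 : Integrable (fun p : ℝ × ℝ => h' (p.1 - p.2) • q' p.2)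
      ((volume.restrict (Ioc 0 t)).prod volume) := by
    have := key.mono_measure (μ := (volume.restrict (Ioc 0 t)).prod volume)
      (Measure.prod_mono Measure.restrict_le_self le_rfl)
    exact this
  have hswap := integral_integral_swap (f := fun ρ r => h' (ρ - r) • q' r) key2
  rw [intervalIntegral.integral_of_le ht, intervalIntegral.integral_of_le ht]
  have e1 : ∀ ρ ∈ Ioc 0 t, volterra h q ρ = ∫ r, h' (ρ - r) • q' r := by
    intro ρ hρ
    rw [← integral_sub_left_eq_self _ volume ρ, volterra, ← integral_indicator measurableSet_Ioc]
    congr 1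
    ext s
    simp only [sub_sub_cancel, hh', hq', indicator]
    by_cases h0 : 0 < s
    · by_cases h1 : s ≤ ρ
      · have : ρ - s ∈ Icc 0 t := ⟨by linarith, by linarith [hρ.2]⟩
        simp [h0, h1, this.2]
      · have : ρ - s < 0 := by linarith
        simp [h0, h1]
    · simp [h0]
  rw [setIntegral_congr_fun measurableSet_Ioc e1, hswap, ← integral_Icc_eq_integral_Ioc,
    ← integral_indicator measurableSet_Icc]
  congr 1
  ext r
  by_cases hr : r ∈ Icc 0 t
  · simp only [hq', indicator_of_mem hr]
    rw [integral_smul_const]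
    congr 1
    rw [← intervalIntegral.integral_of_le ht, intervalIntegral.integral_comp_sub_right (fun x => h' x),
      ← intervalIntegral.integral_add_adjacent_intervals (b := 0) ih.intervalIntegrable
        ih.intervalIntegrable]
    have z1 : ∫ x in (0 - r)..0, h' x = 0 := by
      rw [intervalIntegral.integral_of_le (by linarith [hr.1])]
      refine setIntegral_eq_zero_of_forall_eq_zero fun x hx => ?_
      simp [hh', hx.2]
    rw [z1, zero_add, intervalIntegral.integral_of_le (by linarith [hr.2]),
      intervalIntegral.integral_of_le (by linarith [hr.2])]
    refine setIntegral_congr_fun measurableSet_Ioc fun x hx => ?_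
    simp [hh', hx.1]
  · simp [hq', hr]

/-- Since `g` is the tail integral of `h`, g(t - r) is the full integral of `h` minus its integral
over (0, t - r), and `integral_volterra` recognises the second part. The derivative falls on the
kernel, so `q` need only be continuous. -/
theorem volterra_eq_primitive {g h : ℝ → ℝ} {q : ℝ → F}
    (hh : IntegrableOn h (Ioi 0))
    (hgh : ∀ s, 0 < s → g s = ∫ r in Ioi s, h r)
    (hq : Continuous q) {T t : ℝ} (ht : t ∈ Icc 0 T) :
    volterra g q t = ∫ ρ in (0 : ℝ)..t, ((∫ r in Ioi (0 : ℝ), h r) • q ρ - volterra h q ρ) := by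
  have hvi : IntervalIntegrable (volterra h q) volume 0 t :=
    (continuousOn_volterra hh hq t |>.mono (by rw [uIcc_of_le ht.1])).intervalIntegrable
  have hqi : IntervalIntegrable (fun ρ => (∫ r in Ioi (0 : ℝ), h r) • q ρ) volume 0 t :=
    (by fun_prop : Continuous fun ρ => (∫ r in Ioi (0 : ℝ), h r) • q ρ).intervalIntegrable _ _
  have hcont : ContinuousOn (fun r => (∫ s in (0 : ℝ)..(t - r), h s) • q r) (uIcc 0 t) := by
    refine ContinuousOn.smul ?_ hq.continuousOn
    have h3 : ContinuousOn (fun x => ∫ s in (0 : ℝ)..x, h s) (Icc 0 t) := by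
      have : IntegrableOn h (uIcc 0 t) := by
        rw [uIcc_of_le ht.1, integrableOn_Icc_iff_integrableOn_Ioc]
        exact hh.mono_set Ioc_subset_Ioi_self
      have := intervalIntegral.continuousOn_primitive_interval (a := 0) (b := t) this
      rwa [uIcc_of_le ht.1] at this
    rw [uIcc_of_le ht.1]
    exact h3.comp (by fun_prop) fun r hr => ⟨by linarith [hr.2], by linarith [hr.1]⟩
  rw [intervalIntegral.integral_sub hqi hvi, integral_volterra hh hq ht.1,
    ← intervalIntegral.integral_sub hqi hcont.intervalIntegrable, volterra,
    ← intervalIntegral.integral_of_le ht.1]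
  have := intervalIntegral.integral_comp_sub_left (a := 0) (b := t)
    (fun r => g (t - r) • q r) t
  simp only [sub_sub_cancel, sub_zero, sub_self] at this
  rw [this]
  refine intervalIntegral.integral_congr_ae ?_
  -- The tail formula for `g` is available only at positive arguments, so the endpoint r = t is
  -- discarded.
  have hne : ∀ᵐ r : ℝ, r ≠ t := by simp [ae_iff]
  filter_upwards [hne] with r hr hrm
  rw [uIoc_of_le ht.1] at hrm
  have hlt : 0 < t - r := sub_pos.2 (lt_of_le_of_ne hrm.2 hr)
  rw [← sub_smul]
  congr 1
  rw [hgh _ hlt, eq_sub_iff_add_eq, add_comm]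
  exact intervalIntegral.integral_interval_add_Ioi hh (hh.mono_set (Ioi_subset_Ioi hlt.le))

theorem hasDerivWithinAt_volterra {g h : ℝ → ℝ} {q : ℝ → F}
    (hh : IntegrableOn h (Ioi 0))
    (hgh : ∀ s, 0 < s → g s = ∫ r in Ioi s, h r)
    (hq : Continuous q) {T t : ℝ} (ht : t ∈ Icc 0 T) :
    HasDerivWithinAt (volterra g q) ((∫ r in Ioi (0 : ℝ), h r) • q t - volterra h q t)
      (Icc 0 T) t := by
  have hc : ContinuousOn (fun ρ => (∫ r in Ioi (0 : ℝ), h r) • q ρ - volterra h q ρ) (Icc 0 T) :=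
    ContinuousOn.sub (by fun_prop) (continuousOn_volterra hh hq T)
  exact (hasDerivWithinAt_primitive hc ht).congr
    (fun x hx => volterra_eq_primitive hh hgh hq hx) (volterra_eq_primitive hh hgh hq ht)

end Volterra

/-! ### Weighted histories of a curve -/

theorem integral_Ioi_shift {F : Type*} [NormedAddCommGroup F] [NormedSpace ℝ F]
    (f : ℝ → F) (ε : ℝ) : ∫ s in Ioi ε, f s = ∫ s in Ioi (0 : ℝ), f (s + ε) := by
  rw [← integral_indicator measurableSet_Ioi, ← integral_indicator measurableSet_Ioi,
    ← integral_add_right_eq_self _ ε]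
  congr 1
  ext s
  simp [indicator]

section History

variable {H : Type*} [NormedAddCommGroup H]

/-- The history `p(t) - p(t - s)` of a curve that vanishes for negative times. -/
def hist (p : ℝ → H) (t s : ℝ) : H :=
  if s ≤ t then p t - p (t - s) else p t

theorem stronglyMeasurable_hist {p : ℝ → H} (hp : Continuous p) (t : ℝ) :
    StronglyMeasurable (hist p t) := by
  refine StronglyMeasurable.ite measurableSet_Iic ?_ ?_
  · exact (by fun_prop : Continuous fun s => p t - p (t - s)).stronglyMeasurable
  · exact stronglyMeasurable_const

theorem exists_norm_hist_le {p : ℝ → H} (hp : Continuous p) (T : ℝ) :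
    ∃ B, 0 ≤ B ∧ ∀ t ∈ Icc 0 T, ∀ s > 0, ‖hist p t s‖ ≤ B := by
  obtain ⟨B, hB⟩ := (isCompact_Icc (a := (0 : ℝ)) (b := T)).exists_bound_of_continuousOn
    hp.continuousOn
  refine ⟨2 * max B 0, by positivity, fun t ht s hs => ?_⟩
  have h1 := (hB t ht).trans (le_max_left B 0)
  unfold hist
  split_ifs with h
  · have h2 := (hB (t - s) ⟨by linarith, by linarith [ht.2]⟩).trans (le_max_left B 0)
    linarith [norm_sub_le (p t) (p (t - s))]
  · linarith [le_max_right B 0]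

variable [InnerProductSpace ℝ H]

/-- The history integrated against a kernel. -/
def histInt (k : ℝ → ℝ) (p : ℝ → H) (t : ℝ) : H :=
  ∫ s in Ioi (0 : ℝ), k s • hist p t s

/-- The squared norm of the history integrated against a kernel. -/
def histSq (k : ℝ → ℝ) (p : ℝ → H) (t : ℝ) : ℝ :=
  ∫ s in Ioi (0 : ℝ), k s * ‖hist p t s‖ ^ 2

variable {k : ℝ → ℝ} {p : ℝ → H}

theorem integrableOn_smul_hist (hk : IntegrableOn k (Ioi 0)) (hp : Continuous p) {t : ℝ}
    (ht : 0 ≤ t) : IntegrableOn (fun s => k s • hist p t s) (Ioi 0) := by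
  obtain ⟨B, hB0, hB⟩ := exists_norm_hist_le hp t
  refine (hk.norm.mul_const B).mono'
    (hk.aestronglyMeasurable.smul (stronglyMeasurable_hist hp t).aestronglyMeasurable) ?_
  refine (ae_restrict_iff' measurableSet_Ioi).2 (Filter.Eventually.of_forall fun s hs => ?_)
  rw [norm_smul]
  exact mul_le_mul_of_nonneg_left (hB t ⟨ht, le_rfl⟩ s hs) (norm_nonneg _)

theorem integrableOn_mul_hist_sq (hk : IntegrableOn k (Ioi 0)) (hp : Continuous p) {t : ℝ}
    (ht : 0 ≤ t) : IntegrableOn (fun s => k s * ‖hist p t s‖ ^ 2) (Ioi 0) := by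
  obtain ⟨B, hB0, hB⟩ := exists_norm_hist_le hp t
  refine (hk.norm.mul_const (B ^ 2)).mono'
    (hk.aestronglyMeasurable.mul ?_) ?_
  · exact ((stronglyMeasurable_hist hp t).norm.pow 2).aestronglyMeasurable
  refine (ae_restrict_iff' measurableSet_Ioi).2 (Filter.Eventually.of_forall fun s hs => ?_)
  rw [norm_mul, norm_pow, norm_norm]
  have := hB t ⟨ht, le_rfl⟩ s hs
  gcongr

theorem histSq_nonneg (hk0 : ∀ s > 0, 0 ≤ k s) (t : ℝ) : 0 ≤ histSq k p t :=
  setIntegral_nonneg measurableSet_Ioi fun s hs => mul_nonneg (hk0 s hs) (sq_nonneg _)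

/-- Expansion of the square. Different shifts `x` give the Cauchy-Schwarz bound for `histInt`, the
reduction of `histSq` to a convolution, the comparison of two times, and the sign of the memory
terms in the Lyapunov functional. -/
theorem integral_mul_hist_add_sq [CompleteSpace H] (hk : IntegrableOn k (Ioi 0))
    (hp : Continuous p) {t : ℝ} (ht : 0 ≤ t) (x : H) :
    IntegrableOn (fun s => k s * ‖hist p t s + x‖ ^ 2) (Ioi 0) ∧
    ∫ s in Ioi (0 : ℝ), k s * ‖hist p t s + x‖ ^ 2 =
      histSq k p t + 2 * inner ℝ (histInt k p t) x + (∫ s in Ioi (0 : ℝ), k s) * ‖x‖ ^ 2 := by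
  have h1 := integrableOn_mul_hist_sq hk hp ht
  have h2 := integrableOn_smul_hist hk hp ht
  have h3 : IntegrableOn (fun s => inner ℝ x (k s • hist p t s)) (Ioi 0) := h2.const_inner x
  have h4 : IntegrableOn (fun s => k s * ‖x‖ ^ 2) (Ioi 0) := hk.mul_const _
  have e : (fun s => k s * ‖hist p t s + x‖ ^ 2) =
      fun s => k s * ‖hist p t s‖ ^ 2 + 2 * inner ℝ x (k s • hist p t s) + k s * ‖x‖ ^ 2 := by
    ext s
    rw [norm_add_sq_real, inner_smul_right, real_inner_comm x]; ring
  rw [e]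
  refine ⟨(h1.add (h3.const_mul 2)).add h4, ?_⟩
  have i3 : ∫ s in Ioi (0 : ℝ), inner ℝ x (k s • hist p t s) = inner ℝ x (histInt k p t) :=
    integral_inner h2 x
  have h12 : IntegrableOn (fun s => k s * ‖hist p t s‖ ^ 2 + 2 * inner ℝ x (k s • hist p t s))
      (Ioi 0) := h1.add (h3.const_mul 2)
  rw [integral_add h12 h4, integral_add h1 (h3.const_mul 2), integral_const_mul, i3, integral_mul_const, real_inner_comm x]
  rfl

/-- The variance of the history about its weighted mean is nonnegative. -/
theorem norm_histInt_sq_le [CompleteSpace H] (hk : IntegrableOn k (Ioi 0))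
    (hk0 : ∀ s > 0, 0 ≤ k s) (hp : Continuous p) {t : ℝ} (ht : 0 ≤ t)
    (hM : 0 < ∫ s in Ioi (0 : ℝ), k s) :
    ‖histInt k p t‖ ^ 2 ≤ (∫ s in Ioi (0 : ℝ), k s) * histSq k p t := by
  set M := ∫ s in Ioi (0 : ℝ), k s
  have h := (integral_mul_hist_add_sq hk hp ht (-(M⁻¹ • histInt k p t))).2
  have h0 : 0 ≤ ∫ s in Ioi (0 : ℝ), k s * ‖hist p t s + -(M⁻¹ • histInt k p t)‖ ^ 2 :=
    setIntegral_nonneg measurableSet_Ioi fun s hs => mul_nonneg (hk0 s hs) (sq_nonneg _)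
  rw [h, norm_neg, norm_smul, inner_neg_right, inner_smul_right, real_inner_self_eq_norm_sq,
    mul_pow, norm_inv, Real.norm_of_nonneg hM.le] at h0
  have h5 : 0 ≤ M * (histSq k p t + 2 * -(M⁻¹ * ‖histInt k p t‖ ^ 2) +
      M * (M⁻¹ ^ 2 * ‖histInt k p t‖ ^ 2)) := mul_nonneg hM.le h0
  have h6 : M * (histSq k p t + 2 * -(M⁻¹ * ‖histInt k p t‖ ^ 2) +
      M * (M⁻¹ ^ 2 * ‖histInt k p t‖ ^ 2)) = M * histSq k p t - ‖histInt k p t‖ ^ 2 := by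
    field_simp; ring
  linarith

theorem histInt_eq [CompleteSpace H] (hk : IntegrableOn k (Ioi 0)) (hp : Continuous p) (t : ℝ) :
    histInt k p t = (∫ s in Ioi (0 : ℝ), k s) • p t - volterra k p t := by
  have h1 : IntegrableOn (fun s => k s • p t) (Ioi 0) := hk.smul_const _
  have h2 := (integrable_indicator_iff measurableSet_Ioc).2 (integrableOn_volterra hk hp t)
  have e : ∀ s ∈ Ioi (0 : ℝ), k s • hist p t s =
      k s • p t - (Ioc 0 t).indicator (fun s => k s • p (t - s)) s := by
    intro s hs
    have hs' := hs.out
    unfold hist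
    by_cases h : s ≤ t <;> simp [h, hs', smul_sub]
  rw [histInt, setIntegral_congr_fun measurableSet_Ioi e, integral_sub h1 h2.integrableOn,
    integral_smul_const, setIntegral_indicator measurableSet_Ioc, volterra,
    inter_eq_self_of_subset_right Ioc_subset_Ioi_self]

/-- Shifting the history by -p(t) leaves -p(t - s) for s ≤ t and zero afterwards, so the shifted
square is a Volterra convolution of |p|². Continuity and differentiability in time are then
inherited from `volterra`. -/
theorem histSq_eq [CompleteSpace H] (hk : IntegrableOn k (Ioi 0)) (hp : Continuous p) {t : ℝ}
    (ht : 0 ≤ t) :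
    histSq k p t = 2 * inner ℝ (p t) (histInt k p t) - (∫ s in Ioi (0 : ℝ), k s) * ‖p t‖ ^ 2
      + volterra k (fun r => ‖p r‖ ^ 2) t := by
  have h := (integral_mul_hist_add_sq hk hp ht (-p t)).2
  have e : ∀ s ∈ Ioi (0 : ℝ), k s * ‖hist p t s + -p t‖ ^ 2 =
      (Ioc 0 t).indicator (fun s => k s • ‖p (t - s)‖ ^ 2) s := by
    intro s hs
    have hs' := hs.out
    unfold hist
    by_cases h : s ≤ t
    · rw [if_pos h, indicator_of_mem (show s ∈ Ioc 0 t from ⟨hs', h⟩),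
        show p t - p (t - s) + -p t = -p (t - s) by abel, norm_neg, smul_eq_mul]
    · simp [h]
  rw [setIntegral_congr_fun measurableSet_Ioi e, setIntegral_indicator measurableSet_Ioc,
    inter_eq_self_of_subset_right Ioc_subset_Ioi_self, inner_neg_right, norm_neg,
    real_inner_comm] at h
  unfold volterra
  linarith

theorem continuousOn_histInt [CompleteSpace H] (hk : IntegrableOn k (Ioi 0)) (hp : Continuous p)
    (T : ℝ) : ContinuousOn (histInt k p) (Icc 0 T) := by
  refine ContinuousOn.congr (f := fun t => (∫ s in Ioi (0 : ℝ), k s) • p t - volterra k p t) ?_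
    fun t ht => histInt_eq hk hp t
  exact ContinuousOn.sub (by fun_prop) (continuousOn_volterra hk hp T)

theorem continuousOn_histSq [CompleteSpace H] (hk : IntegrableOn k (Ioi 0)) (hp : Continuous p)
    (T : ℝ) : ContinuousOn (histSq k p) (Icc 0 T) := by
  refine ContinuousOn.congr (f := fun t => 2 * inner ℝ (p t) (histInt k p t)
    - (∫ s in Ioi (0 : ℝ), k s) * ‖p t‖ ^ 2 + volterra k (fun r => ‖p r‖ ^ 2) t) ?_
    fun t ht => histSq_eq hk hp ht.1
  refine ContinuousOn.add (ContinuousOn.sub (continuousOn_const.mul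
    (hp.continuousOn.inner (𝕜 := ℝ) (continuousOn_histInt hk hp T))) (by fun_prop))
    (continuousOn_volterra hk (by fun_prop) T)

variable {g h : ℝ → ℝ} {T : ℝ} {u : ℝ → H}

/-- This is the formula obtained from η_t = u - η_s by parts in s. Here it follows from
`histInt_eq`: the boundary term (∫h) p(t) and the convolution with `h` combine into the history
integral for `h`. -/
theorem hasDerivWithinAt_histInt [CompleteSpace H]
    (hg : IntegrableOn g (Ioi 0)) (hh : IntegrableOn h (Ioi 0))
    (hgh : ∀ s, 0 < s → g s = ∫ r in Ioi s, h r) (hp : Continuous p) {t : ℝ} (ht : t ∈ Icc 0 T)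
    (hd : HasDerivWithinAt p (u t) (Icc 0 T) t) :
    HasDerivWithinAt (histInt g p) ((∫ s in Ioi (0 : ℝ), g s) • u t - histInt h p t)
      (Icc 0 T) t := by
  have h1 := (hd.const_smul (∫ s in Ioi (0 : ℝ), g s)).sub
    (hasDerivWithinAt_volterra (T := T) hh hgh hp ht)
  rw [← histInt_eq hh hp t] at h1
  exact h1.congr (fun x hx => histInt_eq hg hp x) (histInt_eq hg hp t)

/-- The term -`histSq h p t` is the damping produced by the memory. -/
theorem hasDerivWithinAt_histSq [CompleteSpace H]
    (hg : IntegrableOn g (Ioi 0)) (hh : IntegrableOn h (Ioi 0))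
    (hgh : ∀ s, 0 < s → g s = ∫ r in Ioi s, h r) (hp : Continuous p) {t : ℝ} (ht : t ∈ Icc 0 T)
    (hd : HasDerivWithinAt p (u t) (Icc 0 T) t) :
    HasDerivWithinAt (histSq g p) (2 * inner ℝ (histInt g p t) (u t) - histSq h p t)
      (Icc 0 T) t := by
  have hG := hasDerivWithinAt_histInt hg hh hgh hp ht hd
  have hq : Continuous fun r => ‖p r‖ ^ 2 := by fun_prop
  have h1 := (((hd.inner ℝ hG).const_mul 2).sub
    ((hd.norm_sq).const_mul (∫ s in Ioi (0 : ℝ), g s))).add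
    (hasDerivWithinAt_volterra (T := T) hh hgh hq ht)
  refine (h1.congr_deriv ?_).congr (fun x hx => histSq_eq hg hp hx.1) (histSq_eq hg hp ht.1)
  rw [histSq_eq hh hp ht.1, inner_sub_right, inner_smul_right, real_inner_comm (histInt g p t)]
  simp only [smul_eq_mul]
  ring

/-- The history is transported: its value at (t + ε, s + ε) is its value at (t, s) plus the
increment of `p`. Replacing h(s + ε) by the larger h(s) costs an inequality but no derivative of
`h`. The newly created part s ≤ ε has size O(ε²) because the curve is Lipschitz. -/
theorem histSq_add_le [CompleteSpace H] (hh : IntegrableOn h (Ioi 0)) (hh0 : ∀ s > 0, 0 ≤ h s)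
    (hanti : AntitoneOn h (Ioi 0)) (hp : Continuous p) {L : ℝ}
    (hL : ∀ a ∈ Icc 0 T, ∀ b ∈ Icc 0 T, ‖p a - p b‖ ≤ L * |a - b|) {t ε : ℝ}
    (ht : 0 ≤ t) (hε : 0 ≤ ε) (htε : t + ε ≤ T) :
    histSq h p (t + ε) ≤ histSq h p t + 2 * inner ℝ (histInt h p t) (p (t + ε) - p t)
      + (∫ s in Ioi (0 : ℝ), h s) * (‖p (t + ε) - p t‖ ^ 2 + (L * ε) ^ 2) := by
  set x := p (t + ε) - p t with hx
  have hi := integrableOn_mul_hist_sq hh hp (add_nonneg ht hε)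
  obtain ⟨hi2, hi2'⟩ := integral_mul_hist_add_sq hh hp ht x
  have hsplit : histSq h p (t + ε) = (∫ s in Ioc 0 ε, h s * ‖hist p (t + ε) s‖ ^ 2)
      + ∫ s in Ioi ε, h s * ‖hist p (t + ε) s‖ ^ 2 := by
    rw [histSq, ← setIntegral_union Ioc_disjoint_Ioi_same measurableSet_Ioi
      (hi.mono_set Ioc_subset_Ioi_self) (hi.mono_set (Ioi_subset_Ioi hε)),
      Ioc_union_Ioi_eq_Ioi hε]
  have hfirst : ∫ s in Ioc 0 ε, h s * ‖hist p (t + ε) s‖ ^ 2 ≤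
      (∫ s in Ioi (0 : ℝ), h s) * (L * ε) ^ 2 := by
    rw [← integral_mul_const]
    refine (setIntegral_mono_on (hi.mono_set Ioc_subset_Ioi_self)
      (IntegrableOn.mono_set (hh.mul_const _) Ioc_subset_Ioi_self) measurableSet_Ioc
      (g := fun s => h s * (L * ε) ^ 2) fun s hs => ?_).trans ?_
    · refine mul_le_mul_of_nonneg_left ?_ (hh0 s hs.1)
      have h1 : hist p (t + ε) s = p (t + ε) - p (t + ε - s) := if_pos (by linarith [hs.2])
      have h2 := hL (t + ε) ⟨by linarith, htε⟩ (t + ε - s)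
        ⟨by linarith [hs.2], by linarith [hs.1]⟩
      have h3 : L * |t + ε - (t + ε - s)| = L * s := by
        rw [sub_sub_cancel, abs_of_pos hs.1]
      have hL0 : 0 ≤ L := by
        have := (norm_nonneg _).trans h2
        rw [h3] at this
        exact nonneg_of_mul_nonneg_left this hs.1
      rw [h1]
      refine pow_le_pow_left₀ (norm_nonneg _) (h2.trans ?_) 2
      rw [h3]
      exact mul_le_mul_of_nonneg_left hs.2 hL0
    · refine setIntegral_mono_set (hh.mul_const _) ?_ (Filter.Eventually.of_forall
        Ioc_subset_Ioi_self)
      exact (ae_restrict_iff' measurableSet_Ioi).2 (Filter.Eventually.of_forall fun s hs =>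
        mul_nonneg (hh0 s hs) (sq_nonneg _))
  have hsecond : ∫ s in Ioi ε, h s * ‖hist p (t + ε) s‖ ^ 2 ≤
      ∫ s in Ioi (0 : ℝ), h s * ‖hist p t s + x‖ ^ 2 := by
    rw [integral_Ioi_shift]
    have hθ : ∀ s, hist p (t + ε) (s + ε) = hist p t s + x := by
      intro s
      unfold hist
      by_cases hs : s ≤ t
      · rw [if_pos (by linarith), if_pos hs, hx, show t + ε - (s + ε) = t - s by ring]; abel
      · rw [if_neg (by linarith), if_neg hs, hx]; abel
    simp only [hθ]
    refine integral_mono_of_nonneg ?_ hi2 ?_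
    · exact (ae_restrict_iff' measurableSet_Ioi).2 (Filter.Eventually.of_forall fun s hs =>
        mul_nonneg (hh0 _ (by have := hs.out; linarith)) (sq_nonneg _))
    · refine (ae_restrict_iff' measurableSet_Ioi).2 (Filter.Eventually.of_forall fun s hs =>
        mul_le_mul_of_nonneg_right (hanti hs ?_ (by linarith)) (sq_nonneg _))
      have := hs.out
      exact show 0 < s + ε by linarith
  rw [hsplit]
  linarith

/-- The kernel `h` is not assumed to be a tail integral, so `hasDerivWithinAt_histSq` is unavailable
for it. `histSq_add_le` bounds the right difference quotients instead, and the comparison principle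
for such slopes gives the integrated bound. -/
theorem histSq_le_primitive [CompleteSpace H] (hh : IntegrableOn h (Ioi 0))
    (hh0 : ∀ s > 0, 0 ≤ h s) (hanti : AntitoneOn h (Ioi 0)) (hp : Continuous p)
    (hu : ContinuousOn u (Icc 0 T))
    (hd : ∀ t ∈ Icc 0 T, HasDerivWithinAt p (u t) (Icc 0 T) t) {t : ℝ} (ht : t ∈ Icc 0 T) :
    histSq h p t ≤ histSq h p 0 + ∫ r in (0 : ℝ)..t, 2 * inner ℝ (histInt h p r) (u r) := by
  have hc : ContinuousOn (fun r => 2 * inner ℝ (histInt h p r) (u r)) (Icc 0 T) :=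
    continuousOn_const.mul ((continuousOn_histInt hh hp T).inner (𝕜 := ℝ) hu)
  obtain ⟨L, hL⟩ := isCompact_Icc.exists_bound_of_continuousOn hu
  have hLip : ∀ a ∈ Icc 0 T, ∀ b ∈ Icc 0 T, ‖p a - p b‖ ≤ L * |a - b| := fun a ha b hb =>
    (convex_Icc 0 T).norm_image_sub_le_of_norm_hasDerivWithin_le hd hL hb ha
  have hB : ∀ x ∈ Icc 0 T, HasDerivWithinAt (fun t => histSq h p 0 +
      ∫ r in (0 : ℝ)..t, 2 * inner ℝ (histInt h p r) (u r))
      (2 * inner ℝ (histInt h p x) (u x)) (Icc 0 T) x := fun x hx =>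
    (hasDerivWithinAt_primitive hc hx).const_add _
  refine image_le_of_liminf_slope_right_le_deriv_boundary (f := histSq h p) (a := 0) (b := T)
    (continuousOn_histSq hh hp T) (by simp) (fun x hx => (hB x hx).continuousWithinAt)
    (fun x hx => (hB x ⟨hx.1, hx.2.le⟩).mono_of_mem_nhdsWithin
      (Icc_mem_nhdsGE_of_mem hx)) (fun x hx r hr => ?_) ht
  refine Filter.Eventually.frequently ?_
  set M := ∫ s in Ioi (0 : ℝ), h s
  have hdx := ((hd x ⟨hx.1, hx.2.le⟩).mono_of_mem_nhdsWithin
      (Icc_mem_nhdsGT_of_mem hx) : HasDerivWithinAt p (u x) (Ioi x) x)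
  rw [hasDerivWithinAt_iff_tendsto_slope' (by simp)] at hdx
  -- This is the upper bound for the difference quotient supplied by `histSq_add_le`, divided by z -
  -- x; all quadratic terms disappear in the limit.
  have hlim : Filter.Tendsto (fun z => 2 * inner ℝ (histInt h p x) (slope p x z)
      + M * ((z - x) * ‖slope p x z‖ ^ 2 + L ^ 2 * (z - x))) (nhdsWithin x (Ioi x))
      (nhds (2 * inner ℝ (histInt h p x) (u x) + M * (0 * ‖u x‖ ^ 2 + L ^ 2 * 0))) := by
    have hz : Filter.Tendsto (fun z => z - x) (nhdsWithin x (Ioi x)) (nhds 0) := by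
      have : Filter.Tendsto (fun z => z - x) (nhds x) (nhds (x - x)) := by
        exact (continuous_id.sub continuous_const).tendsto x
      rw [sub_self] at this
      exact this.mono_left nhdsWithin_le_nhds
    exact ((tendsto_const_nhds.inner (𝕜 := ℝ) hdx).const_mul 2).add
      (((hz.mul (hdx.norm.pow 2)).add (hz.const_mul _)).const_mul M)
  rw [show 2 * inner ℝ (histInt h p x) (u x) + M * (0 * ‖u x‖ ^ 2 + L ^ 2 * 0) =
    2 * inner ℝ (histInt h p x) (u x) by ring] at hlim
  filter_upwards [hlim.eventually (gt_mem_nhds hr), Ioo_mem_nhdsGT hx.2] with z hz hzI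
  refine lt_of_le_of_lt ?_ hz
  have hpos : 0 < z - x := sub_pos.2 hzI.1
  have hstep := histSq_add_le (T := T) hh hh0 hanti hp hLip hx.1 hpos.le (by linarith [hzI.2])
  rw [add_sub_cancel] at hstep
  have hsl : p z - p x = (z - x) • slope p x z := (sub_smul_slope p x z).symm
  rw [hsl, norm_smul, inner_smul_right, Real.norm_of_nonneg hpos.le] at hstep
  rw [slope_def_field, div_le_iff₀ hpos]
  calc _ ≤ _ := sub_le_iff_le_add'.2 (by simpa only [add_assoc] using hstep)
    _ = _ := by ring

end History

/-! ### Memory kernels -/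

/-- The properties of a kernel `g` with `g' = -h` that enter the linear energy estimate. -/
structure IsHistKernel (g h : ℝ → ℝ) (M ζ : ℝ) : Prop where
  integrable : IntegrableOn g (Ioi 0)
  integrable_deriv : IntegrableOn h (Ioi 0)
  eq_integral : ∀ s, 0 < s → g s = ∫ r in Ioi s, h r
  nonneg : ∀ s > 0, 0 ≤ g s
  deriv_nonneg : ∀ s > 0, 0 ≤ h s
  antitone : AntitoneOn h (Ioi 0)
  integral_eq : ∫ s in Ioi (0 : ℝ), g s = M
  decay : ∀ s > 0, ζ * g s ≤ h s

/-- Integrability of g and g' forces g → 0 at infinity, which gives the tail formula. Nonnegativity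
of -g' comes from the decay condition. Its monotonicity comes from local absolute continuity of g'
and g'' ≥ 0 almost everywhere. -/
theorem IsMemoryKernel.exists_isHistKernel {c : ℝ} {g : ℝ → ℝ} (hg : IsMemoryKernel c g) :
    ∃ ζ, 0 < ζ ∧ IsHistKernel g (fun s => -deriv g s) (∫ s in Ioi (0 : ℝ), g s) ζ := by
  obtain ⟨ζ, hζ, hdec⟩ := hg.decay
  refine ⟨ζ, hζ, hg.integrable, hg.integrable_deriv.neg, ?_, hg.nonneg, ?_, ?_, rfl, ?_⟩
  · intro s hs
    have hd : ∀ x ∈ Ici s, HasDerivAt g (deriv g x) x := fun x hx =>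
      (hg.differentiable x (lt_of_lt_of_le hs hx)).hasDerivAt
    have hsub : Ioi s ⊆ Ioi 0 := Ioi_subset_Ioi hs.le
    have ht : Filter.Tendsto g Filter.atTop (nhds 0) :=
      tendsto_zero_of_hasDerivAt_of_integrableOn_Ioi (a := s)
        (fun x hx => hd x (mem_Ici_of_Ioi hx)) (hg.integrable_deriv.mono_set hsub)
        (hg.integrable.mono_set hsub)
    rw [integral_neg, integral_Ioi_of_hasDerivAt_of_tendsto' hd
      (hg.integrable_deriv.mono_set hsub) ht]
    ring
  · intro s hs
    have h1 := hdec s hs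
    have h2 := mul_nonneg hζ.le (hg.nonneg s hs)
    linarith
  · intro s hs r hr hsr
    rcases hsr.eq_or_lt with rfl | hlt
    · exact le_rfl
    have h1 := (hg.deriv_locally_ac s r hs hlt).integral_deriv_eq_sub
    have h2 : 0 ≤ ∫ x in s..r, deriv (deriv g) x := by
      refine intervalIntegral.integral_nonneg_of_ae_restrict hsr ?_
      exact ae_restrict_of_ae_restrict_of_subset
        (fun x hx => lt_of_lt_of_le (show (0 : ℝ) < s from hs) hx.1) hg.convex
    linarith
  · intro s hs
    have h1 := hdec s hs
    linarith

/-! ### The abstract linear system and its Lyapunov functional -/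

section Linear

variable {H : Type*} [NormedAddCommGroup H] [InnerProductSpace ℝ H] [CompleteSpace H]

/-- The linear system with forcing `N` for `p = A ψ`, `v`, `w` on `[0, T]`, with a bounded operator
`A` in the place of `(-Δ)^{1/2}`. -/
structure IsLinearSolution (A : H →L[ℝ] H) (τ a β M : ℝ) (g : ℝ → ℝ) (T : ℝ)
    (p v w N : ℝ → H) : Prop where
  symm : ∀ x y, inner ℝ (A x) y = inner ℝ x (A y)
  cont_p : Continuous p
  cont_v : Continuous v
  cont_w : Continuous w
  deriv_p : ∀ t ∈ Icc 0 T, HasDerivWithinAt p (A (v t)) (Icc 0 T) t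
  deriv_v : ∀ t ∈ Icc 0 T, HasDerivWithinAt v (w t) (Icc 0 T) t
  deriv_w : ∀ t ∈ Icc 0 T, ∃ wt, HasDerivWithinAt w wt (Icc 0 T) t ∧
    τ • wt = -w t - a • A (p t) - (β + τ * M + τ * a) • A (A (v t)) - A (histInt g p t) + N t

theorem hist_map (A : H →L[ℝ] H) (p : ℝ → H) (t s : ℝ) :
    hist (fun r => A (p r)) t s = A (hist p t s) := by
  unfold hist
  split_ifs <;> simp

theorem histInt_map (A : H →L[ℝ] H) {k : ℝ → ℝ} {p : ℝ → H} (hk : IntegrableOn k (Ioi 0))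
    (hp : Continuous p) {t : ℝ} (ht : 0 ≤ t) :
    histInt k (fun r => A (p r)) t = A (histInt k p t) := by
  unfold histInt
  rw [← A.integral_comp_comm (integrableOn_smul_hist hk hp ht)]
  simp [hist_map]

variable {A : H →L[ℝ] H} {τ a β M ζ T : ℝ} {g h : ℝ → ℝ} {p v w N : ℝ → H}

/-- `A` commutes with everything in the system. Every identity for (p, v, w) is thereby also one for
A(p, v, w), which carries the part of the energy with one more derivative. -/
theorem IsLinearSolution.map (hS : IsLinearSolution A τ a β M g T p v w N)
    (hk : IntegrableOn g (Ioi 0)) :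
    IsLinearSolution A τ a β M g T (fun t => A (p t)) (fun t => A (v t)) (fun t => A (w t))
      (fun t => A (N t)) where
  symm := hS.symm
  cont_p := A.continuous.comp hS.cont_p
  cont_v := A.continuous.comp hS.cont_v
  cont_w := A.continuous.comp hS.cont_w
  deriv_p t ht := A.hasFDerivAt.comp_hasDerivWithinAt t (hS.deriv_p t ht)
  deriv_v t ht := A.hasFDerivAt.comp_hasDerivWithinAt t (hS.deriv_v t ht)
  deriv_w t ht := by
    obtain ⟨wt, h1, h2⟩ := hS.deriv_w t ht
    refine ⟨A wt, A.hasFDerivAt.comp_hasDerivWithinAt t h1, ?_⟩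
    rw [← map_smul, h2, histInt_map A hk hS.cont_p ht.1]
    simp

/-- The energy functional of the linear system, with the contribution of the weight `h` replaced
by a differentiable majorant. -/
def lyapunov (A : H →L[ℝ] H) (τ a β M : ℝ) (g h : ℝ → ℝ) (p v w : ℝ → H) (t : ℝ) : ℝ :=
  (1 / 2) * (‖v t + τ • w t‖ ^ 2 + a * ‖p t + τ • A (v t)‖ ^ 2
    + τ * (β + τ * M) * ‖A (v t)‖ ^ 2 + histSq g p t
    + 2 * τ * inner ℝ (histInt g p t) (A (v t))
    + τ * (histSq h p 0 + ∫ r in (0 : ℝ)..t, 2 * inner ℝ (histInt h p r) (A (v r))))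

/-- In v + τw the damping term -w cancels against v' = w, and a share τa of the coefficient of A²v
completes p to p + τAv. -/
theorem IsLinearSolution.hasDerivWithinAt_vw (hS : IsLinearSolution A τ a β M g T p v w N)
    {t : ℝ} (ht : t ∈ Icc 0 T) :
    HasDerivWithinAt (fun t => v t + τ • w t)
      (-(a • A (p t + τ • A (v t))) - (β + τ * M) • A (A (v t)) - A (histInt g p t) + N t)
      (Icc 0 T) t := by
  obtain ⟨wt, h1, h2⟩ := hS.deriv_w t ht
  refine ((hS.deriv_v t ht).add (h1.const_smul τ)).congr_deriv ?_
  rw [h2]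
  simp only [map_add, map_smul]
  module

theorem IsLinearSolution.hasDerivWithinAt_pv (hS : IsLinearSolution A τ a β M g T p v w N)
    {t : ℝ} (ht : t ∈ Icc 0 T) :
    HasDerivWithinAt (fun t => p t + τ • A (v t)) (A (v t + τ • w t)) (Icc 0 T) t := by
  refine ((hS.deriv_p t ht).add ((A.hasFDerivAt.comp_hasDerivWithinAt t
    (hS.deriv_v t ht)).const_smul τ)).congr_deriv ?_
  simp

/-- The derivative of τ(G, Av) contains -τ(∫hη, Av), which the differentiable majorant cancels
exactly; this is why the functional contains the primitive and not `histSq h p t`. The remaining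
part τM|Av|² reduces the damping coefficient β + τM to β. The terms with Aw cancel in pairs by
symmetry of `A`. -/
theorem IsLinearSolution.hasDerivWithinAt_lyapunov
    (hS : IsLinearSolution A τ a β M g T p v w N) (hK : IsHistKernel g h M ζ)
    {t : ℝ} (ht : t ∈ Icc 0 T) :
    HasDerivWithinAt (lyapunov A τ a β M g h p v w)
      (-β * ‖A (v t)‖ ^ 2 - histSq h p t / 2 + inner ℝ (N t) (v t + τ • w t)) (Icc 0 T) t := by
  have hu : HasDerivWithinAt (fun t => A (v t)) (A (w t)) (Icc 0 T) t :=
    A.hasFDerivAt.comp_hasDerivWithinAt t (hS.deriv_v t ht)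
  have hG := hasDerivWithinAt_histInt (u := fun t => A (v t)) hK.integrable hK.integrable_deriv
    hK.eq_integral hS.cont_p ht (hS.deriv_p t ht)
  have hK1 := hasDerivWithinAt_histSq (u := fun t => A (v t)) hK.integrable hK.integrable_deriv
    hK.eq_integral hS.cont_p ht (hS.deriv_p t ht)
  have hc : ContinuousOn (fun r => 2 * inner ℝ (histInt h p r) (A (v r))) (Icc 0 T) :=
    continuousOn_const.mul ((continuousOn_histInt hK.integrable_deriv hS.cont_p T).inner (𝕜 := ℝ)
      (A.continuous.comp hS.cont_v).continuousOn)
  have hP := (hasDerivWithinAt_primitive hc ht).const_add (histSq h p 0)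
  have hall := ((((((hS.hasDerivWithinAt_vw ht).norm_sq).add
    (((hS.hasDerivWithinAt_pv ht).norm_sq).const_mul a)).add
    ((hu.norm_sq).const_mul (τ * (β + τ * M)))).add hK1).add
    ((hG.inner ℝ hu).const_mul (2 * τ))).add (hP.const_mul τ) |>.const_mul (1 / 2)
  refine hall.congr_deriv ?_
  rw [hK.integral_eq]
  set y := v t + τ • w t with hy
  set u := A (v t)
  set G := histInt g p t
  have e1 : inner ℝ y (A (p t + τ • u)) = inner ℝ (p t + τ • u) (A y) := by
    rw [← hS.symm, real_inner_comm]
  have e2 : inner ℝ y (A u) = ‖u‖ ^ 2 + τ * inner ℝ u (A (w t)) := by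
    rw [← hS.symm, hy, map_add, map_smul, inner_add_left, inner_smul_left,
      show A (v t) = u from rfl, real_inner_self_eq_norm_sq, real_inner_comm u]
    simp
  have e3 : inner ℝ y (A G) = inner ℝ G u + τ * inner ℝ G (A (w t)) := by
    rw [← hS.symm, hy, map_add, map_smul, inner_add_left, inner_smul_left,
      show A (v t) = u from rfl, real_inner_comm G, real_inner_comm G]
    simp
  simp only [inner_add_right, inner_sub_right, inner_neg_right, inner_smul_right,
    inner_sub_left, inner_smul_left, conj_trivial, real_inner_self_eq_norm_sq] at e1 e2 e3 ⊢
  rw [real_inner_comm y (N t)]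
  have e1' : inner ℝ y (A (p t + τ • u)) = inner ℝ (p t + τ • u) (A y) := by
    rw [← hS.symm, real_inner_comm]
  rw [e1', e2, e3]
  ring

/-- The energy of the linear system. -/
def linEnergy (A : H →L[ℝ] H) (τ : ℝ) (h : ℝ → ℝ) (p v w : ℝ → H) (t : ℝ) : ℝ :=
  ‖p t + τ • A (v t)‖ ^ 2 + ‖v t + τ • w t‖ ^ 2 + ‖A (v t)‖ ^ 2 + histSq h p t + ‖w t‖ ^ 2
    + ‖A (p t + τ • A (v t))‖ ^ 2 + ‖A (v t + τ • w t)‖ ^ 2 + ‖A (A (v t))‖ ^ 2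
    + histSq h (fun r => A (p r)) t

/-- The dissipation of the linear system. -/
def linDiss (A : H →L[ℝ] H) (τ : ℝ) (h : ℝ → ℝ) (p v w : ℝ → H) (t : ℝ) : ℝ :=
  ‖A (v t)‖ ^ 2 + histSq h p t + ‖A (p t + τ • A (v t))‖ ^ 2 + ‖A (v t + τ • w t)‖ ^ 2
    + ‖A (A (v t))‖ ^ 2 + histSq h (fun r => A (p r)) t + ‖w t‖ ^ 2

/-- The element against which the forcing is tested. -/
def testElement (A : H →L[ℝ] H) (τ l ε : ℝ) (p v w : ℝ → H) (t : ℝ) : H :=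
  l • ((v t + τ • w t) + A (A (v t + τ • w t))) + A (p t + τ • A (v t))
    - (2 * τ) • A (A (v t)) + ε • w t

/-- The part of the Lyapunov functional that yields dissipation of the remaining components. -/
def crossTerm (A : H →L[ℝ] H) (τ ε : ℝ) (p v w : ℝ → H) (t : ℝ) : ℝ :=
  inner ℝ (v t + τ • w t) (A (p t + τ • A (v t))) - 2 * τ * inner ℝ (v t + τ • w t) (A (A (v t)))
    + ε * (τ / 2) * ‖w t‖ ^ 2

/-- The product (y, Az) damps Az but creates +|Ay|². Subtracting 2τ(y, A²v) creates -2|Ay|² because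
τAw = Ay - Av, so the balance is -|Ay|². The part with `ε` damps w. -/
theorem IsLinearSolution.hasDerivWithinAt_crossTerm
    (hS : IsLinearSolution A τ a β M g T p v w N) (ε : ℝ) {t : ℝ} (ht : t ∈ Icc 0 T) :
    HasDerivWithinAt (crossTerm A τ ε p v w)
      (-‖A (v t + τ • w t)‖ ^ 2 - a * ‖A (p t + τ • A (v t))‖ ^ 2
        - (β + τ * M) * inner ℝ (A (A (v t))) (A (p t + τ • A (v t)))
        - inner ℝ (A (histInt g p t)) (A (p t + τ • A (v t)))
        + 2 * inner ℝ (A (v t + τ • w t)) (A (v t))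
        + 2 * τ * a * inner ℝ (A (p t + τ • A (v t))) (A (A (v t)))
        + 2 * τ * (β + τ * M) * ‖A (A (v t))‖ ^ 2
        + 2 * τ * inner ℝ (A (histInt g p t)) (A (A (v t)))
        + ε * (-‖w t‖ ^ 2 - a * inner ℝ (w t) (A (p t + τ • A (v t)))
          - (β + τ * M) * inner ℝ (w t) (A (A (v t))) - inner ℝ (w t) (A (histInt g p t)))
        + inner ℝ (N t) (A (p t + τ • A (v t)) - (2 * τ) • A (A (v t)) + ε • w t))
      (Icc 0 T) t := by
  obtain ⟨wt, h1, h2⟩ := hS.deriv_w t ht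
  have hy := hS.hasDerivWithinAt_vw ht
  have hAp : HasDerivWithinAt (fun t => A (p t + τ • A (v t))) (A (A (v t + τ • w t)))
    (Icc 0 T) t := A.hasFDerivAt.comp_hasDerivWithinAt t (hS.hasDerivWithinAt_pv ht)
  have hAu : HasDerivWithinAt (fun t => A (A (v t))) (A (A (w t))) (Icc 0 T) t :=
    A.hasFDerivAt.comp_hasDerivWithinAt t (A.hasFDerivAt.comp_hasDerivWithinAt t
      (hS.deriv_v t ht))
  have hall := ((hy.inner ℝ hAp).sub ((hy.inner ℝ hAu).const_mul (2 * τ))).add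
    ((h1.norm_sq).const_mul (ε * (τ / 2)))
  refine hall.congr_deriv ?_
  have e0 : τ * inner ℝ (w t) wt = inner ℝ (w t) (-w t - a • A (p t + τ • A (v t))
      - (β + τ * M) • A (A (v t)) - A (histInt g p t) + N t) := by
    rw [← inner_smul_right, h2]
    congr 1
    simp only [map_add, map_smul]
    module
  set y := v t + τ • w t with hy'
  set u := A (v t)
  set G := histInt g p t
  set z := p t + τ • u
  have e1 : inner ℝ y (A (A y)) = ‖A y‖ ^ 2 := by
    rw [← hS.symm, real_inner_self_eq_norm_sq]
  have e2 : τ * inner ℝ y (A (A (w t))) = ‖A y‖ ^ 2 - inner ℝ (A y) u := by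
    rw [← hS.symm, ← inner_smul_right, show τ • A (w t) = A y - u by simp [hy', u],
      inner_sub_right, real_inner_self_eq_norm_sq]
  simp only [inner_add_right, inner_sub_right, inner_neg_right, inner_smul_right,
    inner_sub_left, inner_smul_left, inner_add_left, inner_neg_left, conj_trivial,
    real_inner_self_eq_norm_sq] at e0 ⊢
  rw [real_inner_comm (N t) (w t)] at e0
  linear_combination e1 - 2 * e2 + ε * e0

theorem IsHistKernel.mul_histSq_le (hK : IsHistKernel g h M ζ) {q : ℝ → H}
    (hq : Continuous q) {t : ℝ} (ht : 0 ≤ t) :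
    ζ * histSq g q t ≤ histSq h q t := by
  unfold histSq
  rw [← integral_const_mul]
  refine setIntegral_mono_on ((integrableOn_mul_hist_sq hK.integrable hq ht).const_mul ζ)
    (integrableOn_mul_hist_sq hK.integrable_deriv hq ht) measurableSet_Ioi fun s hs => ?_
  rw [← mul_assoc]
  exact mul_le_mul_of_nonneg_right (hK.decay s hs) (sq_nonneg _)

/-- Nonnegativity of ∫g|η + τAv|² shows that the memory part and the mixed term cost at most
τ²M|Av|², which leaves τβ|Av|². The majorant is at least `histSq h p t` by `histSq_le_primitive`. -/
theorem IsLinearSolution.lyapunov_ge (hS : IsLinearSolution A τ a β M g T p v w N)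
    (hK : IsHistKernel g h M ζ) (hτ : 0 < τ) {t : ℝ} (ht : t ∈ Icc 0 T) :
    (1 / 2) * (‖v t + τ • w t‖ ^ 2 + a * ‖p t + τ • A (v t)‖ ^ 2 + τ * β * ‖A (v t)‖ ^ 2
      + τ * histSq h p t) ≤ lyapunov A τ a β M g h p v w t := by
  have h1 := histSq_le_primitive hK.integrable_deriv hK.deriv_nonneg hK.antitone hS.cont_p
    (A.continuous.comp hS.cont_v).continuousOn hS.deriv_p ht
  have h2 := (integral_mul_hist_add_sq hK.integrable hS.cont_p ht.1 (τ • A (v t))).2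
  have h3 : 0 ≤ ∫ s in Ioi (0 : ℝ), g s * ‖hist p t s + τ • A (v t)‖ ^ 2 :=
    setIntegral_nonneg measurableSet_Ioi fun s hs => mul_nonneg (hK.nonneg s hs) (sq_nonneg _)
  rw [h2, inner_smul_right, norm_smul, Real.norm_of_nonneg hτ.le, hK.integral_eq] at h3
  have h4 := mul_le_mul_of_nonneg_left h1 hτ.le
  unfold lyapunov
  simp only [Function.comp_apply] at h4
  nlinarith [h3, h4]

/-- An upper bound is needed only at time zero, where the majorant equals `histSq h p 0`. Here ∫g|η
- τAv|² ≥ 0 controls the mixed term, and the decay of the kernel bounds the g-weighted norm by the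
h-weighted one. -/
theorem IsLinearSolution.lyapunov_zero_le (hS : IsLinearSolution A τ a β M g T p v w N)
    (hK : IsHistKernel g h M ζ) (hζ : 0 < ζ) (hτ : 0 < τ) :
    lyapunov A τ a β M g h p v w 0 ≤
      (1 / 2) * (‖v 0 + τ • w 0‖ ^ 2 + a * ‖p 0 + τ • A (v 0)‖ ^ 2
        + τ * (β + 2 * τ * M) * ‖A (v 0)‖ ^ 2 + (2 / ζ + τ) * histSq h p 0) := by
  have h2 := (integral_mul_hist_add_sq hK.integrable hS.cont_p le_rfl (-(τ • A (v 0)))).2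
  have h3 : 0 ≤ ∫ s in Ioi (0 : ℝ), g s * ‖hist p 0 s + -(τ • A (v 0))‖ ^ 2 :=
    setIntegral_nonneg measurableSet_Ioi fun s hs => mul_nonneg (hK.nonneg s hs) (sq_nonneg _)
  rw [h2, inner_neg_right, norm_neg, inner_smul_right, norm_smul, Real.norm_of_nonneg hτ.le,
    hK.integral_eq] at h3
  have h4 : histSq g p 0 ≤ histSq h p 0 / ζ := by
    rw [le_div_iff₀ hζ, mul_comm]
    exact hK.mul_histSq_le hS.cont_p le_rfl
  unfold lyapunov
  simp only [intervalIntegral.integral_same, add_zero]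
  have h5 : (2 / ζ + τ) * histSq h p 0 = 2 * (histSq h p 0 / ζ) + τ * histSq h p 0 := by ring
  rw [h5]
  nlinarith [h3, h4]

end Linear

/-! ### The linear energy inequality, uniform in the operator -/

theorem mul_le_young {x y r : ℝ} (hr : 0 < r) : x * y ≤ r * x ^ 2 + (1 / (4 * r)) * y ^ 2 := by
  have h : 0 ≤ r * (x - y / (2 * r)) ^ 2 := by positivity
  have e : r * (x - y / (2 * r)) ^ 2 = r * x ^ 2 + (1 / (4 * r)) * y ^ 2 - x * y := by
    field_simp; ring
  linarith

section Linear

variable {H : Type*} [NormedAddCommGroup H] [InnerProductSpace ℝ H] [CompleteSpace H]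
variable {A : H →L[ℝ] H} {τ a β M ζ T : ℝ} {g h : ℝ → ℝ} {p v w N : ℝ → H}

theorem linDiss_nonneg (hh0 : ∀ s > 0, 0 ≤ h s) (t : ℝ) : 0 ≤ linDiss A τ h p v w t := by
  unfold linDiss
  have h1 := histSq_nonneg (p := p) hh0 t
  have h2 := histSq_nonneg (p := fun r => A (p r)) hh0 t
  positivity

theorem IsLinearSolution.continuousOn_linDiss (hS : IsLinearSolution A τ a β M g T p v w N)
    (hh : IntegrableOn h (Ioi 0)) : ContinuousOn (linDiss A τ h p v w) (Icc 0 T) := by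
  have hp := hS.cont_p
  have hv := hS.cont_v
  have hw := hS.cont_w
  have h1 := continuousOn_histSq hh hp T
  have h2 := continuousOn_histSq hh (A.continuous.comp hp) T
  have h3 : Continuous fun t => ‖A (v t)‖ ^ 2 := by fun_prop
  have h4 : Continuous fun t => ‖A (p t + τ • A (v t))‖ ^ 2 := by fun_prop
  have h5 : Continuous fun t => ‖A (v t + τ • w t)‖ ^ 2 := by fun_prop
  have h6 : Continuous fun t => ‖A (A (v t))‖ ^ 2 := by fun_prop
  have h7 : Continuous fun t => ‖w t‖ ^ 2 := by fun_prop
  exact (((((h3.continuousOn.add h1).add h4.continuousOn).add h5.continuousOn).add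
    h6.continuousOn).add h2).add h7.continuousOn

/-- Young's inequality keeps half of the damping of `Z`, `Y` and `w` and moves all errors to `u`,
`U` and `G`, which the two Lyapunov functionals damp. The loss in |Z|² is a/8 + a/8 + a/4; the last
share is (3/2)εa², hence ε = 1/(6a). -/
theorem crossDeriv_le {τ a B ε : ℝ} (hτ : 0 < τ) (ha : 0 < a) (hB0 : 0 < B)
    (hε : ε = 1 / (6 * a)) (Y Z U u w G : H) :
    -‖Y‖ ^ 2 - a * ‖Z‖ ^ 2 - B * inner ℝ U Z - inner ℝ G Z + 2 * inner ℝ Y u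
        + 2 * τ * a * inner ℝ Z U + 2 * τ * B * ‖U‖ ^ 2 + 2 * τ * inner ℝ G U
        + ε * (-‖w‖ ^ 2 - a * inner ℝ w Z - B * inner ℝ w U - inner ℝ w G) ≤
      -(a / 2) * ‖Z‖ ^ 2 - 1 / 2 * ‖Y‖ ^ 2 - ε / 2 * ‖w‖ ^ 2 + 2 * ‖u‖ ^ 2
        + (2 * (B + 2 * τ * a) ^ 2 / a + 2 * τ * B + τ ^ 2 + ε * (3 / 2) * B ^ 2) * ‖U‖ ^ 2
        + (2 / a + 1 + ε * (3 / 2)) * ‖G‖ ^ 2 := by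
  have hε0 : 0 < ε := by rw [hε]; positivity
  have a1 : (2 * τ * a) * inner ℝ Z U - B * inner ℝ U Z ≤ (B + 2 * τ * a) * (‖Z‖ * ‖U‖) := by
    have h1 := abs_le.1 (abs_real_inner_le_norm Z U)
    have h2 := mul_le_mul_of_nonneg_left h1.2 (by positivity : (0 : ℝ) ≤ 2 * τ * a)
    have h3 := mul_le_mul_of_nonneg_left h1.1 hB0.le
    rw [real_inner_comm Z U]
    linarith
  have a2 := mul_le_young (x := ‖Z‖) (y := (B + 2 * τ * a) * ‖U‖) (r := a / 8) (by positivity)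
  have a3 : -inner ℝ G Z ≤ ‖Z‖ * ‖G‖ := by
    have h1 := abs_le.1 (abs_real_inner_le_norm G Z)
    linarith [h1.1]
  have a4 := mul_le_young (x := ‖Z‖) (y := ‖G‖) (r := a / 8) (by positivity)
  have a5 : 2 * inner ℝ Y u ≤ (1 / 2) * ‖Y‖ ^ 2 + 2 * ‖u‖ ^ 2 := by
    have h1 := real_inner_le_norm Y u
    have h2 := sq_nonneg (‖Y‖ - 2 * ‖u‖)
    linarith
  have a6 : 2 * τ * inner ℝ G U ≤ ‖G‖ ^ 2 + τ ^ 2 * ‖U‖ ^ 2 := by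
    have h1 := mul_le_mul_of_nonneg_left (real_inner_le_norm G U) hτ.le
    have h2 := sq_nonneg (‖G‖ - τ * ‖U‖)
    linarith
  have a7 : -a * inner ℝ w Z - B * inner ℝ w U - inner ℝ w G ≤
      (1 / 2) * ‖w‖ ^ 2 + (3 / 2) * (a ^ 2 * ‖Z‖ ^ 2 + B ^ 2 * ‖U‖ ^ 2 + ‖G‖ ^ 2) := by
    have h1 := mul_le_mul_of_nonneg_left (abs_le.1 (abs_real_inner_le_norm w Z)).1 ha.le
    have h2 := mul_le_mul_of_nonneg_left (abs_le.1 (abs_real_inner_le_norm w U)).1 hB0.le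
    have h3 := (abs_le.1 (abs_real_inner_le_norm w G)).1
    have h4 := sq_nonneg (‖w‖ - 3 * (a * ‖Z‖))
    have h5 := sq_nonneg (‖w‖ - 3 * (B * ‖U‖))
    have h6 := sq_nonneg (‖w‖ - 3 * ‖G‖)
    linarith
  have a7' := mul_le_mul_of_nonneg_left a7 hε0.le
  have e2 : 1 / (4 * (a / 8)) * ((B + 2 * τ * a) * ‖U‖) ^ 2 =
      2 * (B + 2 * τ * a) ^ 2 / a * ‖U‖ ^ 2 := by field_simp; ring
  have e4 : 1 / (4 * (a / 8)) * ‖G‖ ^ 2 = 2 / a * ‖G‖ ^ 2 := by field_simp; ring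
  rw [e2] at a2
  rw [e4] at a4
  have e5 : ε * ((3 / 2) * (a ^ 2 * ‖Z‖ ^ 2)) = a / 4 * ‖Z‖ ^ 2 := by
    rw [hε]; field_simp; ring
  linarith

theorem abs_cross_le {τ : ℝ} (hτ : 0 < τ) (y Z U : H) :
    |inner ℝ y Z - 2 * τ * inner ℝ y U| ≤
      (1 / 2 + τ) * ‖y‖ ^ 2 + 1 / 2 * ‖Z‖ ^ 2 + τ * ‖U‖ ^ 2 := by
  have i1 := abs_le.1 (abs_real_inner_le_norm y Z)
  have i2 := abs_le.1 (abs_real_inner_le_norm y U)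
  have i3 := mul_le_mul_of_nonneg_left i2.1 hτ.le
  have i4 := mul_le_mul_of_nonneg_left i2.2 hτ.le
  have y1 := sq_nonneg (‖y‖ - ‖Z‖)
  have y2 := mul_nonneg hτ.le (sq_nonneg (‖y‖ - ‖U‖))
  rw [abs_le]
  constructor <;> linarith [i1.1, i1.2]

set_option maxHeartbeats 1600000 in
/-- The energy estimate of the linear system with forcing. -/
theorem exists_energy_inequality {τ a β M ζ : ℝ} (hτ : 0 < τ) (ha : 0 < a) (hβ : 0 < β)
    (hM : 0 < M) (hζ : 0 < ζ) :
    ∃ l ε C : ℝ, 0 < l ∧ 0 < ε ∧ 0 < C ∧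
      ∀ (H : Type) [NormedAddCommGroup H] [InnerProductSpace ℝ H] [CompleteSpace H]
        (A : H →L[ℝ] H) (g h : ℝ → ℝ) (T : ℝ) (p v w N : ℝ → H) (φ : ℝ → ℝ),
        IsLinearSolution A τ a β M g T p v w N → IsHistKernel g h M ζ →
        IntegrableOn φ (Icc 0 T) → (∀ t, 0 ≤ φ t) →
        (∀ t ∈ Icc 0 T, inner ℝ (N t) (testElement A τ l ε p v w t) ≤ φ t) →
        ∀ t ∈ Icc 0 T, linEnergy A τ h p v w t + ∫ r in (0 : ℝ)..t, linDiss A τ h p v w r ≤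
          C * (linEnergy A τ h p v w 0 + ∫ r in (0 : ℝ)..t, φ r) := by
  set B := β + τ * M with hB
  set ε := 1 / (6 * a) with hε
  set c2 := 2 * (B + 2 * τ * a) ^ 2 / a + 2 * τ * B + τ ^ 2 + ε * (3 / 2) * B ^ 2 with hc2
  set c3 := 2 / a + 1 + ε * (3 / 2) with hc3
  have hB0 : 0 < B := by positivity
  have hε0 : 0 < ε := by positivity
  have hc20 : 0 < c2 := by positivity
  have hc30 : 0 < c3 := by positivity
  -- Each summand serves one of the lower bounds on `l` below. Some let `l` times the damping of the
  -- Lyapunov functionals absorb the errors `c2` and `c3` of the cross term; the others keep the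
  -- total functional coercive.
  set l := (3 + c2) / β + 2 * (c3 * (M / ζ)) + 4 + 2 * τ + 2 / a + 4 / β with hl
  have hl0 : 0 < l := by positivity
  set δ := min (min 1 (a / 2)) (min (1 / 2) (ε / 2)) with hδ
  have hδ0 : 0 < δ := by positivity
  -- The coercivity constant: the coefficients left after the cross term has been subtracted, by
  -- `abs_cross_le`.
  set c0 := min (min (l * a / 2 - 1 / 2) (min (1 / 2) (l * τ * β / 2 - τ)))
    (min (l * τ / 2) (ε * τ / 2)) with hc0
  have hla : 1 ≤ l * a / 2 := by
    have : 2 / a ≤ l := by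
      rw [hl]; have : 0 < (3 + c2) / β + 2 * (c3 * (M / ζ)) + 4 + 2 * τ + 4 / β := by positivity
      linarith
    rw [div_le_iff₀ ha] at this; linarith
  have hlβ : 4 ≤ l * β := by
    have : 4 / β ≤ l := by
      rw [hl]; have : 0 < (3 + c2) / β + 2 * (c3 * (M / ζ)) + 4 + 2 * τ + 2 / a := by positivity
      linarith
    rwa [div_le_iff₀ hβ] at this
  have hl3 : 3 + c2 ≤ l * β := by
    have : (3 + c2) / β ≤ l := by
      rw [hl]; have : 0 < 2 * (c3 * (M / ζ)) + 4 + 2 * τ + 2 / a + 4 / β := by positivity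
      linarith
    rwa [div_le_iff₀ hβ] at this
  have hl4 : c3 * (M / ζ) + 1 ≤ l / 2 := by
    rw [hl]; have : 0 < (3 + c2) / β + 2 * τ + 2 / a + 4 / β := by positivity
    linarith
  have hl5 : 2 + τ ≤ l / 2 := by
    rw [hl]; have : 0 < (3 + c2) / β + 2 * (c3 * (M / ζ)) + 2 / a + 4 / β := by positivity
    linarith
  have hlτβ : τ * 2 ≤ l * τ * β / 2 := by
    have := mul_le_mul_of_nonneg_left hlβ hτ.le
    linarith
  have hc00 : 0 < c0 := by
    have h1 : 0 < l * a / 2 - 1 / 2 := by linarith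
    have h2 : 0 < l * τ * β / 2 - τ := by linarith
    rw [hc0]; positivity
  set C0 := l * (1 + a + τ * (B + τ * M) + (2 / ζ + τ)) + 1 + 2 * τ + ε * τ with hC0
  have hC00 : 0 < C0 := by positivity
  have d1 : δ ≤ 1 := (min_le_left _ _).trans (min_le_left _ _)
  have d2 : δ ≤ a / 2 := (min_le_left _ _).trans (min_le_right _ _)
  have d3 : δ ≤ 1 / 2 := (min_le_right _ _).trans (min_le_left _ _)
  have d4 : δ ≤ ε / 2 := (min_le_right _ _).trans (min_le_right _ _)
  have k1 : c0 ≤ l * a / 2 - 1 / 2 := (min_le_left _ _).trans (min_le_left _ _)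
  have k2 : c0 ≤ 1 / 2 := (min_le_left _ _).trans ((min_le_right _ _).trans (min_le_left _ _))
  have k3 : c0 ≤ l * τ * β / 2 - τ :=
    (min_le_left _ _).trans ((min_le_right _ _).trans (min_le_right _ _))
  have k4 : c0 ≤ l * τ / 2 := (min_le_right _ _).trans (min_le_left _ _)
  have k5 : c0 ≤ ε * τ / 2 := (min_le_right _ _).trans (min_le_right _ _)
  clear_value C0 c0 δ l c3 c2 ε B
  refine ⟨l, ε, (1 / c0 + 1 / δ) * (C0 + 1), hl0, hε0, by positivity, ?_⟩
  intro H _ _ _ A g h T p v w N φ hS hK hφ hφ0 hN t ht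
  have hSA := hS.map hK.integrable
  set L : ℝ → ℝ := fun t => l * (lyapunov A τ a β M g h p v w t + lyapunov A τ a β M g h
    (fun t => A (p t)) (fun t => A (v t)) (fun t => A (w t)) t) + crossTerm A τ ε p v w t with hL
  have hLd := fun (t : ℝ) (ht : t ∈ Icc 0 T) =>
    (((hS.hasDerivWithinAt_lyapunov hK ht).add (hSA.hasDerivWithinAt_lyapunov hK ht)).const_mul
      l).add (hS.hasDerivWithinAt_crossTerm ε ht)
  have hder : ∀ t ∈ Icc 0 T, ∃ L', HasDerivWithinAt L L' (Icc 0 T) t ∧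
      L' ≤ φ t - δ * linDiss A τ h p v w t := by
    intro t ht
    refine ⟨_, hLd t ht, ?_⟩
    have hNt := hN t ht
    have hKA := norm_histInt_sq_le hK.integrable hK.nonneg hSA.cont_p ht.1
      (by rw [hK.integral_eq]; exact hM)
    rw [hK.integral_eq, histInt_map A hK.integrable hS.cont_p ht.1] at hKA
    have hKA2 := hK.mul_histSq_le hSA.cont_p ht.1
    have hKp := histSq_nonneg (p := p) hK.deriv_nonneg t
    have hKAp := histSq_nonneg (p := fun r => A (p r)) hK.deriv_nonneg t
    set y := v t + τ • w t with hy
    set u := A (v t) with hu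
    set G := histInt g p t
    set z := p t + τ • u with hz
    have hG : ‖A G‖ ^ 2 ≤ M / ζ * histSq h (fun r => A (p r)) t := by
      refine hKA.trans ?_
      rw [div_mul_eq_mul_div, mul_div_assoc]
      refine mul_le_mul_of_nonneg_left ?_ hM.le
      rw [le_div_iff₀ hζ]; linarith
    -- By symmetry of `A` the forcing terms of both Lyapunov functionals and of the cross term merge
    -- into one inner product.
    have hNe : inner ℝ (N t) (testElement A τ l ε p v w t) =
        l * (inner ℝ (N t) y + inner ℝ (A (N t)) (A y))
          + inner ℝ (N t) (A z - (2 * τ) • A u + ε • w t) := by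
      rw [hS.symm (N t), testElement]
      simp only [inner_add_right, inner_sub_right, inner_smul_right, ← hu, ← hy, ← hz]
      ring
    have hAy : A (v t) + τ • A (w t) = A y := by simp [hy]
    rw [hAy]
    rw [hNe] at hNt
    have a1 := crossDeriv_le hτ ha hB0 hε (A y) (A z) (A u) u (w t) (A G)
    rw [← hc2, ← hc3] at a1
    have hG3 := mul_le_mul_of_nonneg_left hG hc30.le
    have b1 := mul_le_mul_of_nonneg_right (show 2 + δ ≤ l * β by linarith) (sq_nonneg ‖u‖)
    have b2 := mul_le_mul_of_nonneg_right (show c2 + δ ≤ l * β by linarith) (sq_nonneg ‖A u‖)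
    have b3 := mul_le_mul_of_nonneg_right (show δ ≤ l / 2 by linarith) hKp
    have b4 := mul_le_mul_of_nonneg_right (show c3 * (M / ζ) + δ ≤ l / 2 by linarith) hKAp
    have b5 := mul_le_mul_of_nonneg_right d2 (sq_nonneg ‖A z‖)
    have b6 := mul_le_mul_of_nonneg_right d3 (sq_nonneg ‖A y‖)
    have b7 := mul_le_mul_of_nonneg_right d4 (sq_nonneg ‖w t‖)
    unfold linDiss
    simp only [← hu, ← hy, ← hz, ← hB]
    linarith only [a1, hG3, b1, b2, b3, b4, b5, b6, b7, hNt]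
  have hLcont : ContinuousOn L (Icc 0 T) := fun x hx => (hLd x hx).continuousWithinAt
  choose! L' hL' hL'le using hder
  have hDc := hS.continuousOn_linDiss hK.integrable_deriv
  have hsub : Icc 0 t ⊆ Icc 0 T := Icc_subset_Icc_right ht.2
  have hDi : IntervalIntegrable (linDiss A τ h p v w) volume 0 t :=
    (hDc.mono (by rw [uIcc_of_le ht.1]; exact hsub)).intervalIntegrable
  have hφi : IntervalIntegrable φ volume 0 t :=
    (intervalIntegrable_iff_integrableOn_Icc_of_le ht.1).2 (hφ.mono_set hsub)
  -- The forcing bound `φ` is only integrable, so the differential inequality is integrated in its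
  -- one-sided form.
  have hmain := intervalIntegral.sub_le_integral_of_hasDeriv_right_of_le (g := L) (g' := L')
    (φ := fun r => φ r - δ * linDiss A τ h p v w r) ht.1 (hLcont.mono hsub)
    (fun x hx => (hL' x ⟨hx.1.le, hx.2.le.trans ht.2⟩).mono_of_mem_nhdsWithin
      (Icc_mem_nhdsGT_of_mem ⟨hx.1.le, hx.2.trans_le ht.2⟩))
    ((intervalIntegrable_iff_integrableOn_Icc_of_le ht.1).1 (hφi.sub (hDi.const_mul δ)))
    (fun x hx => hL'le x ⟨hx.1.le, hx.2.le.trans ht.2⟩)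
  rw [intervalIntegral.integral_sub hφi (hDi.const_mul δ),
    intervalIntegral.integral_const_mul] at hmain
  have hlow : c0 * linEnergy A τ h p v w t ≤ L t := by
    have g1 := mul_le_mul_of_nonneg_left (hS.lyapunov_ge hK hτ ht) hl0.le
    have g2 := mul_le_mul_of_nonneg_left (hSA.lyapunov_ge hK hτ ht) hl0.le
    have hKp := histSq_nonneg (p := p) hK.deriv_nonneg t
    have hKAp := histSq_nonneg (p := fun r => A (p r)) hK.deriv_nonneg t
    have hAy : A (v t) + τ • A (w t) = A (v t + τ • w t) := by simp
    have hAz : A (p t) + τ • A (A (v t)) = A (p t + τ • A (v t)) := by simp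
    rw [hAy, hAz] at g2
    simp only [hL]
    rw [mul_add]
    refine le_trans ?_ (add_le_add (add_le_add g1 g2) le_rfl)
    unfold linEnergy crossTerm
    set y := v t + τ • w t
    set u := A (v t)
    set z := p t + τ • u
    have i1 := (abs_le.1 (abs_cross_le hτ y (A z) (A u))).1
    have j1 := mul_le_mul_of_nonneg_right k1 (sq_nonneg ‖A z‖)
    have j1' := mul_le_mul_of_nonneg_right (show c0 ≤ l * a / 2 by linarith) (sq_nonneg ‖z‖)
    have j2 := mul_le_mul_of_nonneg_right (show c0 + 1 / 2 + τ ≤ l / 2 by linarith) (sq_nonneg ‖y‖)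
    have j2' := mul_le_mul_of_nonneg_right (show c0 ≤ l / 2 by linarith) (sq_nonneg ‖A y‖)
    have j3 := mul_le_mul_of_nonneg_right (show c0 ≤ l * τ * β / 2 by linarith) (sq_nonneg ‖u‖)
    have j3' := mul_le_mul_of_nonneg_right k3 (sq_nonneg ‖A u‖)
    have j4 := mul_le_mul_of_nonneg_right k4 hKp
    have j4' := mul_le_mul_of_nonneg_right k4 hKAp
    have j5 := mul_le_mul_of_nonneg_right k5 (sq_nonneg ‖w t‖)
    linarith only [i1, j1, j1', j2, j2', j3, j3', j4, j4', j5]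
  have hup : L 0 ≤ C0 * linEnergy A τ h p v w 0 := by
    have g1 := mul_le_mul_of_nonneg_left (hS.lyapunov_zero_le hK hζ hτ) hl0.le
    have g2 := mul_le_mul_of_nonneg_left (hSA.lyapunov_zero_le hK hζ hτ) hl0.le
    have hKp := histSq_nonneg (p := p) hK.deriv_nonneg 0
    have hKAp := histSq_nonneg (p := fun r => A (p r)) hK.deriv_nonneg 0
    have hAy : A (v 0) + τ • A (w 0) = A (v 0 + τ • w 0) := by simp
    have hAz : A (p 0) + τ • A (A (v 0)) = A (p 0 + τ • A (v 0)) := by simp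
    rw [hAy, hAz] at g2
    simp only [hL]
    rw [mul_add]
    refine (add_le_add (add_le_add g1 g2) le_rfl).trans ?_
    unfold linEnergy crossTerm
    set y := v 0 + τ • w 0
    set u := A (v 0)
    set z := p 0 + τ • u
    have i1 := (abs_le.1 (abs_cross_le hτ y (A z) (A u))).2
    have q1 : 0 < l * a := by positivity
    have q2 : 0 < l * (τ * (B + τ * M)) := by positivity
    have q3 : 0 < l * (2 / ζ + τ) := by positivity
    have q4 : 0 < ε * τ := by positivity
    have hC0' : C0 = l + l * a + l * (τ * (B + τ * M)) + l * (2 / ζ + τ) + 1 + 2 * τ + ε * τ := by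
      rw [hC0]; ring
    have eB : τ * (β + 2 * τ * M) = τ * (B + τ * M) := by rw [hB]; ring
    rw [eB]
    have j1 := mul_le_mul_of_nonneg_right (show l * a / 2 ≤ C0 by linarith) (sq_nonneg ‖z‖)
    have j1' := mul_le_mul_of_nonneg_right (show l * a / 2 + 1 / 2 ≤ C0 by linarith)
      (sq_nonneg ‖A z‖)
    have j2 := mul_le_mul_of_nonneg_right (show l / 2 + 1 / 2 + τ ≤ C0 by linarith)
      (sq_nonneg ‖y‖)
    have j2' := mul_le_mul_of_nonneg_right (show l / 2 ≤ C0 by linarith) (sq_nonneg ‖A y‖)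
    have j3 := mul_le_mul_of_nonneg_right (show l * (τ * (B + τ * M)) / 2 ≤ C0 by linarith)
      (sq_nonneg ‖u‖)
    have j3' := mul_le_mul_of_nonneg_right (show l * (τ * (B + τ * M)) / 2 + τ ≤ C0 by linarith)
      (sq_nonneg ‖A u‖)
    have j4 := mul_le_mul_of_nonneg_right (show l * (2 / ζ + τ) / 2 ≤ C0 by linarith) hKp
    have j4' := mul_le_mul_of_nonneg_right (show l * (2 / ζ + τ) / 2 ≤ C0 by linarith) hKAp
    have j5 := mul_le_mul_of_nonneg_right (show ε * τ / 2 ≤ C0 by linarith) (sq_nonneg ‖w 0‖)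
    linarith only [i1, j1, j1', j2, j2', j3, j3', j4, j4', j5]
  clear hLd hLcont hL' hL'le hN
  clear_value L
  set E := linEnergy A τ h p v w t
  set E0 := linEnergy A τ h p v w 0
  set D := ∫ r in (0 : ℝ)..t, linDiss A τ h p v w r
  set Φ := ∫ r in (0 : ℝ)..t, φ r
  have hD0 : 0 ≤ D := intervalIntegral.integral_nonneg ht.1 fun r _ =>
    linDiss_nonneg hK.deriv_nonneg r
  have hnn : ∀ s, 0 ≤ linEnergy A τ h p v w s := fun s => by
    unfold linEnergy
    have h1 := histSq_nonneg (p := p) hK.deriv_nonneg s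
    have h2 := histSq_nonneg (p := fun r => A (p r)) hK.deriv_nonneg s
    positivity
  have hE0 : 0 ≤ E := hnn t
  have hE00 : 0 ≤ E0 := hnn 0
  have hsum : c0 * E + δ * D ≤ C0 * E0 + Φ := by linarith
  have hX0 : 0 ≤ C0 * E0 + Φ := le_trans (by positivity) hsum
  have f1 : E ≤ (1 / c0) * (C0 * E0 + Φ) := by
    rw [one_div, ← div_eq_inv_mul, le_div_iff₀ hc00]
    have := mul_nonneg hδ0.le hD0
    linarith
  have f2 : D ≤ (1 / δ) * (C0 * E0 + Φ) := by
    rw [one_div, ← div_eq_inv_mul, le_div_iff₀ hδ0]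
    have := mul_nonneg hc00.le hE0
    linarith
  have f3 : C0 * E0 + Φ ≤ (C0 + 1) * (E0 + Φ) := by
    have hΦ : 0 ≤ Φ := intervalIntegral.integral_nonneg ht.1 fun r _ => hφ0 r
    have := mul_nonneg hC00.le hΦ
    linarith
  have f4 : 0 < 1 / c0 + 1 / δ := by positivity
  calc E + D ≤ (1 / c0 + 1 / δ) * (C0 * E0 + Φ) := by linarith
    _ ≤ (1 / c0 + 1 / δ) * ((C0 + 1) * (E0 + Φ)) := mul_le_mul_of_nonneg_left f3 f4.le
    _ = _ := by ring

end Linear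

/-! ### Fourier transform of weak derivatives -/

open scoped SchwartzMap FourierTransform LineDeriv ContDiff

/-- The space `L²(ℝⁿ)` of complex-valued functions. -/
abbrev CL2 (n : ℕ) : Type := Lp ℂ 2 (volume : Measure (Rn n))

variable {n : ℕ}

/-- The Fourier transform of real-valued `L²` functions. -/
def ft (n : ℕ) : L2 n →L[ℝ] CL2 n :=
  ((Lp.fourierTransformₗᵢ (Rn n) ℂ).toContinuousLinearEquiv.toContinuousLinearMap.restrictScalars
    ℝ).comp (Complex.ofRealCLM.compLpL 2 volume)

theorem ft_apply (f : L2 n) : ft n f = 𝓕 (Complex.ofRealCLM.compLpL 2 volume f : CL2 n) := rfl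

theorem norm_ofReal_compLp (f : L2 n) :
    ‖(Complex.ofRealCLM.compLpL 2 volume f : CL2 n)‖ = ‖f‖ := by
  rw [Lp.norm_def, Lp.norm_def]
  congr 1
  refine eLpNorm_congr_norm_ae ?_
  filter_upwards [Complex.ofRealCLM.coeFn_compLpL (p := 2) (μ := (volume : Measure (Rn n))) f]
    with x hx
  rw [hx]
  simp

theorem norm_ft (f : L2 n) : ‖ft n f‖ = ‖f‖ := by
  rw [ft_apply, Lp.norm_fourier_eq, norm_ofReal_compLp]

/-- The L² Fourier transform agrees with that of tempered distributions, where this duality is the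
definition. -/
theorem integral_mul_ft (f : L2 n) (θ : 𝓢(Rn n, ℂ)) :
    ∫ ξ, θ ξ * ft n f ξ = ∫ x, (𝓕 θ) x * (f x : ℂ) := by
  have h := congrArg (fun u : 𝓢'(Rn n, ℂ) => u θ)
    (Lp.fourier_toTemperedDistribution_eq (Complex.ofRealCLM.compLpL 2 volume f : CL2 n))
  simp only [TemperedDistribution.fourier_apply, Lp.toTemperedDistribution_apply,
    smul_eq_mul] at h
  rw [ft_apply, ← h]
  refine integral_congr_ae ?_
  filter_upwards [Complex.ofRealCLM.coeFn_compLpL (p := 2) (μ := (volume : Measure (Rn n))) f]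
    with x hx
  rw [hx]; rfl

theorem ae_eq_zero_of_forall_schwartz {u : Rn n → ℂ} (hu : LocallyIntegrable u)
    (h : ∀ θ : 𝓢(Rn n, ℂ), ∫ ξ, θ ξ * u ξ = 0) : ∀ᵐ ξ, u ξ = 0 := by
  refine ae_eq_zero_of_integral_contDiff_smul_eq_zero hu fun g hg hc => ?_
  have hg' : ContDiff ℝ ∞ fun x => (g x : ℂ) := Complex.ofRealCLM.contDiff.comp hg
  have hc' : HasCompactSupport fun x => (g x : ℂ) := hc.comp_left (g := ((↑) : ℝ → ℂ)) rfl
  have := h (hc'.toSchwartzMap hg')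
  simpa using this

theorem ae_eq_of_forall_schwartz {u w : Rn n → ℂ} (hu : LocallyIntegrable u)
    (hw : LocallyIntegrable w)
    (h : ∀ θ : 𝓢(Rn n, ℂ), Integrable (fun ξ => θ ξ * u ξ) ∧ Integrable (fun ξ => θ ξ * w ξ) ∧
      ∫ ξ, θ ξ * u ξ = ∫ ξ, θ ξ * w ξ) : u =ᵐ[volume] w := by
  have key := ae_eq_zero_of_forall_schwartz (u := fun ξ => u ξ - w ξ) (hu.sub hw) fun θ => by
    obtain ⟨h1, h2, h3⟩ := h θ
    simp only [mul_sub]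
    rw [integral_sub h1 h2, h3, sub_self]
  filter_upwards [key] with ξ hξ
  exact sub_eq_zero.1 hξ

theorem locallyIntegrable_of_memLp_two {u : Rn n → ℂ} (hu : MemLp u 2) : LocallyIntegrable u :=
  hu.locallyIntegrable (by norm_num)

theorem iteratedFDeriv_one_single (φ : Rn n → ℝ) (j : Fin n) (x : Rn n) :
    iteratedFDeriv ℝ 1 φ x (fun _ => EuclideanSpace.single j (1 : ℝ)) =
      fderiv ℝ φ x (EuclideanSpace.single j 1) := by
  simp [iteratedFDeriv_one_apply]

/-- A smooth cutoff function. -/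
def cutoff (n : ℕ) : ContDiffBump (0 : Rn n) := ⟨1, 2, one_pos, one_lt_two⟩

theorem exists_norm_fderiv_cutoff_le (n : ℕ) :
    ∃ C, 0 ≤ C ∧ ∀ x, ‖fderiv ℝ (cutoff n) x‖ ≤ C := by
  have h1 : Continuous fun x => fderiv ℝ (cutoff n) x :=
    ((cutoff n).contDiff (n := 1)).continuous_fderiv one_ne_zero
  have h2 : HasCompactSupport fun x => fderiv ℝ (cutoff n) x :=
    (cutoff n).hasCompactSupport.fderiv ℝ
  obtain ⟨C, hC⟩ := h2.exists_bound_of_continuous h1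
  exact ⟨C, (norm_nonneg _).trans (hC 0), hC⟩

/-- The defining relation of a weak derivative for complex test functions. -/
theorem HasWeakDeriv.integral_complex {j : Fin n} {f : Rn n → ℝ} {d : L2 n}
    (h : HasWeakDeriv (fun _ : Fin 1 => j) f d)
    {φ : Rn n → ℂ} (hφ : ContDiff ℝ ∞ φ) (hc : HasCompactSupport φ) :
    ∫ x, fderiv ℝ φ x (EuclideanSpace.single j 1) * (f x : ℂ) = -∫ x, φ x * (d x : ℂ) := by
  -- The definition admits only real test functions, so it is applied to the real and imaginary
  -- parts separately.
  have hre : ContDiff ℝ ∞ fun x => (φ x).re := Complex.reCLM.contDiff.comp hφ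
  have him : ContDiff ℝ ∞ fun x => (φ x).im := Complex.imCLM.contDiff.comp hφ
  have hcre : HasCompactSupport fun x => (φ x).re := hc.comp_left (g := Complex.re) rfl
  have hcim : HasCompactSupport fun x => (φ x).im := hc.comp_left (g := Complex.im) rfl
  have e1 := h.2 _ hre hcre
  have e2 := h.2 _ him hcim
  have hdiff : ∀ x, HasFDerivAt φ (fderiv ℝ φ x) x := fun x =>
    (hφ.differentiable (by simp) x).hasFDerivAt
  have d1 : ∀ x, fderiv ℝ (fun x => (φ x).re) x (EuclideanSpace.single j 1) =
      (fderiv ℝ φ x (EuclideanSpace.single j 1)).re := fun x => by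
    have h1 : HasFDerivAt (fun x => (φ x).re) (Complex.reCLM.comp (fderiv ℝ φ x)) x :=
      Complex.reCLM.hasFDerivAt.comp x (hdiff x)
    rw [h1.fderiv]; rfl
  have d2 : ∀ x, fderiv ℝ (fun x => (φ x).im) x (EuclideanSpace.single j 1) =
      (fderiv ℝ φ x (EuclideanSpace.single j 1)).im := fun x => by
    have h1 : HasFDerivAt (fun x => (φ x).im) (Complex.imCLM.comp (fderiv ℝ φ x)) x :=
      Complex.imCLM.hasFDerivAt.comp x (hdiff x)
    rw [h1.fderiv]; rfl
  simp only [iteratedFDeriv_one_single, d1, d2] at e1 e2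
  have hdc : HasCompactSupport fun x => fderiv ℝ φ x (EuclideanSpace.single j (1 : ℝ)) :=
    (hc.fderiv ℝ).comp_left (g := fun L : Rn n →L[ℝ] ℂ => L (EuclideanSpace.single j 1)) rfl
  have hdcont : Continuous fun x => fderiv ℝ φ x (EuclideanSpace.single j (1 : ℝ)) :=
    (hφ.continuous_fderiv (by simp)).clm_apply continuous_const
  have hfC : LocallyIntegrable fun x => (f x : ℂ) := by
    intro x
    obtain ⟨s, hs, hi⟩ := h.1 x
    exact ⟨s, hs, hi.ofReal⟩
  have hdC : LocallyIntegrable fun x => (d x : ℂ) := by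
    have : LocallyIntegrable d := (Lp.memLp d).locallyIntegrable (by norm_num)
    intro x
    obtain ⟨s, hs, hi⟩ := this x
    exact ⟨s, hs, hi.ofReal⟩
  have i1 : Integrable fun x => fderiv ℝ φ x (EuclideanSpace.single j 1) * (f x : ℂ) := by
    simpa using hfC.integrable_smul_left_of_hasCompactSupport hdcont hdc
  have i2 : Integrable fun x => φ x * (d x : ℂ) := by
    simpa using hdC.integrable_smul_left_of_hasCompactSupport hφ.continuous hc
  apply Complex.ext
  · have r1 : (∫ x, fderiv ℝ φ x (EuclideanSpace.single j 1) * (f x : ℂ)).re =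
        ∫ x, f x * (fderiv ℝ φ x (EuclideanSpace.single j 1)).re := by
      rw [← Complex.reCLM_apply, ← Complex.reCLM.integral_comp_comm i1]
      simp [mul_comm]
    have r2 : (∫ x, φ x * (d x : ℂ)).re = ∫ x, d x * (φ x).re := by
      rw [← Complex.reCLM_apply, ← Complex.reCLM.integral_comp_comm i2]
      simp [mul_comm]
    rw [Complex.neg_re, r1, r2, e1]; simp
  · have r1 : (∫ x, fderiv ℝ φ x (EuclideanSpace.single j 1) * (f x : ℂ)).im =
        ∫ x, f x * (fderiv ℝ φ x (EuclideanSpace.single j 1)).im := by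
      rw [← Complex.imCLM_apply, ← Complex.imCLM.integral_comp_comm i1]
      simp [mul_comm]
    have r2 : (∫ x, φ x * (d x : ℂ)).im = ∫ x, d x * (φ x).im := by
      rw [← Complex.imCLM_apply, ← Complex.imCLM.integral_comp_comm i2]
      simp [mul_comm]
    rw [Complex.neg_im, r1, r2, e2]; simp

theorem integrable_schwartz_mul_L2 (θ : 𝓢(Rn n, ℂ)) (f : L2 n) :
    Integrable fun x => θ x * (f x : ℂ) := by
  have h1 : MemLp (fun x => (f x : ℂ)) 2 (volume : Measure (Rn n)) := (Lp.memLp f).ofReal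
  exact (θ.memLp 2).integrable_mul h1

/-- Integration by parts against smooth functions of compact support extends to Schwartz
functions. -/
theorem integral_lineDeriv_schwartz {e : Rn n} (hen : ‖e‖ = 1) {f d : L2 n}
    (h : ∀ φ : Rn n → ℂ, ContDiff ℝ ∞ φ → HasCompactSupport φ →
      ∫ x, fderiv ℝ φ x e * (f x : ℂ) = -∫ x, φ x * (d x : ℂ)) (θ : 𝓢(Rn n, ℂ)) :
    ∫ x, (∂_{e} θ) x * (f x : ℂ) = -∫ x, θ x * (d x : ℂ) := by
  obtain ⟨C, hC0, hC⟩ := exists_norm_fderiv_cutoff_le n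
  -- The test functions are `θ` times a cutoff dilated by 1/r(k). The derivative of the cutoff
  -- carries a factor r(k) → 0, so that term vanishes in the limit, and dominated convergence
  -- handles the others.
  set r : ℕ → ℝ := fun k => ((k : ℝ) + 1)⁻¹ with hr
  have hr0 : ∀ k, 0 < r k := fun k => by positivity
  have hr1 : ∀ k, r k ≤ 1 := fun k => inv_le_one_of_one_le₀ (by simp)
  have hrt : Filter.Tendsto r Filter.atTop (nhds 0) := by
    simpa [hr, one_div] using tendsto_one_div_add_atTop_nhds_zero_nat (𝕜 := ℝ)
  set χ : ℕ → Rn n → ℝ := fun k x => cutoff n (r k • x) with hχ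
  have hχd : ∀ k x, HasFDerivAt (χ k) (r k • fderiv ℝ (cutoff n) (r k • x)) x := by
    intro k x
    have h1 : HasFDerivAt (cutoff n) (fderiv ℝ (cutoff n) (r k • x)) (r k • x) :=
      (((cutoff n).contDiff (n := 1)).differentiable one_ne_zero _).hasFDerivAt
    have h2 : HasFDerivAt (fun x : Rn n => r k • x) (r k • ContinuousLinearMap.id ℝ (Rn n)) x :=
      (hasFDerivAt_id x).const_smul (r k)
    refine (h1.comp x h2).congr_fderiv ?_
    ext; simp
  have hχs : ∀ k, ContDiff ℝ ∞ (χ k) := fun k =>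
    (cutoff n).contDiff.comp (contDiff_const_smul _)
  have hχc : ∀ k, HasCompactSupport (χ k) := fun k =>
    (cutoff n).hasCompactSupport.comp_smul (hr0 k).ne'
  have hχ1 : ∀ k x, ‖χ k x‖ ≤ 1 := fun k x => by
    rw [Real.norm_of_nonneg (cutoff n).nonneg]; exact (cutoff n).le_one
  have hχt : ∀ x, Filter.Tendsto (fun k => χ k x) Filter.atTop (nhds 1) := by
    intro x
    have h1 : Filter.Tendsto (fun k => r k • x) Filter.atTop (nhds ((0 : ℝ) • x)) :=
      hrt.smul_const x
    rw [zero_smul] at h1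
    have h2 := ((cutoff n).continuous.tendsto 0).comp h1
    have h3 : cutoff n 0 = 1 :=
      (cutoff n).one_of_mem_closedBall (by simp [(cutoff n).rIn_pos.le])
    rwa [h3] at h2
  have hθ : ∀ x, HasFDerivAt θ (fderiv ℝ θ x) x := fun x => θ.differentiableAt.hasFDerivAt
  have hfd : ∀ k x, fderiv ℝ (fun x => χ k x • θ x) x e =
      χ k x • fderiv ℝ θ x e + (r k * fderiv ℝ (cutoff n) (r k • x) e) • θ x := by
    intro k x
    have h1 : HasFDerivAt (fun x => χ k x • θ x) _ x := (hχd k x).smul (hθ x)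
    rw [h1.fderiv]
    simp
  have hk : ∀ k, ∫ x, fderiv ℝ (fun x => χ k x • θ x) x e * (f x : ℂ) =
      -∫ x, (χ k x • θ x) * (d x : ℂ) := fun k =>
    h _ ((hχs k).smul (θ.smooth ⊤)) ((hχc k).smul_right)
  have l2 : Filter.Tendsto (fun k => ∫ x, (χ k x • θ x) * (d x : ℂ)) Filter.atTop
      (nhds (∫ x, θ x * (d x : ℂ))) := by
    refine tendsto_integral_of_dominated_convergence (fun x => ‖θ x * (d x : ℂ)‖) ?_
      (integrable_schwartz_mul_L2 θ d).norm ?_ ?_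
    · intro k
      simp only [smul_mul_assoc]
      exact (hχs k).continuous.aestronglyMeasurable.smul
        (integrable_schwartz_mul_L2 θ d).aestronglyMeasurable
    · intro k
      refine Filter.Eventually.of_forall fun x => ?_
      rw [smul_mul_assoc, norm_smul]
      exact mul_le_of_le_one_left (norm_nonneg _) (hχ1 k x)
    · refine Filter.Eventually.of_forall fun x => ?_
      simp only [smul_mul_assoc]
      simpa using (hχt x).smul_const (θ x * (d x : ℂ))
  have hD : ∀ x, (∂_{e} θ) x = fderiv ℝ θ x e := fun x =>
    SchwartzMap.lineDerivOp_apply_eq_fderiv e θ x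
  generalize (∂_{e} θ : 𝓢(Rn n, ℂ)) = D at hD ⊢
  have ib1 := integrable_schwartz_mul_L2 D f
  have ib2 := integrable_schwartz_mul_L2 θ f
  have ib : Integrable fun x => ‖D x * (f x : ℂ)‖ + C * ‖θ x * (f x : ℂ)‖ :=
    Integrable.add ib1.norm (ib2.norm.const_mul C)
  have l1 : Filter.Tendsto (fun k => ∫ x, fderiv ℝ (fun x => χ k x • θ x) x e * (f x : ℂ))
      Filter.atTop (nhds (∫ x, D x * (f x : ℂ))) := by
    have hexp : ∀ k x, fderiv ℝ (fun x => χ k x • θ x) x e * (f x : ℂ) =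
        χ k x • (D x * (f x : ℂ)) +
          (r k * fderiv ℝ (cutoff n) (r k • x) e) • (θ x * (f x : ℂ)) := by
      intro k x
      rw [hfd, hD, add_mul, smul_mul_assoc, smul_mul_assoc]
    refine Filter.Tendsto.congr (fun k => integral_congr_ae (Filter.Eventually.of_forall
      fun x => (hexp k x).symm)) ?_
    refine tendsto_integral_of_dominated_convergence
      (fun x => ‖D x * (f x : ℂ)‖ + C * ‖θ x * (f x : ℂ)‖) ?_
      ib ?_ ?_
    · intro k
      have h1 : Continuous fun x => fderiv ℝ (cutoff n) x :=
        ((cutoff n).contDiff (n := 1)).continuous_fderiv one_ne_zero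
      have h2 : Continuous fun x : Rn n => r k * fderiv ℝ (cutoff n) (r k • x) e :=
        continuous_const.mul ((h1.comp (continuous_const_smul _)).clm_apply continuous_const)
      exact ((hχs k).continuous.aestronglyMeasurable.smul ib1.aestronglyMeasurable).add
        (h2.aestronglyMeasurable.smul ib2.aestronglyMeasurable)
    · intro k
      refine Filter.Eventually.of_forall fun x => (norm_add_le _ _).trans ?_
      rw [norm_smul, norm_smul]
      refine add_le_add (mul_le_of_le_one_left (norm_nonneg _) (hχ1 k x))
        (mul_le_mul_of_nonneg_right ?_ (norm_nonneg _))
      rw [norm_mul, Real.norm_of_nonneg (hr0 k).le]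
      have h1 : ‖fderiv ℝ (cutoff n) (r k • x) e‖ ≤ C := by
        refine (ContinuousLinearMap.le_opNorm _ _).trans ?_
        rw [hen, mul_one]; exact hC _
      calc r k * _ ≤ 1 * C := mul_le_mul (hr1 k) h1 (norm_nonneg _) zero_le_one
        _ = C := one_mul C
    · refine Filter.Eventually.of_forall fun x => ?_
      have t1 := (hχt x).smul_const (D x * (f x : ℂ))
      have t2 : Filter.Tendsto (fun k => r k * fderiv ℝ (cutoff n) (r k • x) e) Filter.atTop
          (nhds 0) := by
        refine squeeze_zero_norm (a := fun k => r k * C) (fun k => ?_) ?_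
        · rw [norm_mul, Real.norm_of_nonneg (hr0 k).le]
          refine mul_le_mul_of_nonneg_left ?_ (hr0 k).le
          refine (ContinuousLinearMap.le_opNorm _ _).trans ?_
          rw [hen, mul_one]; exact hC _
        · simpa using hrt.mul_const C
      have t3 := t2.smul_const (θ x * (f x : ℂ))
      simpa using t1.add t3
  simp only [hk] at l1
  exact tendsto_nhds_unique l1 l2.neg

/-- For `L²` functions the weak derivative may be tested against Schwartz functions. -/
theorem HasWeakDeriv.integral_schwartz {j : Fin n} {f d : L2 n}
    (h : HasWeakDeriv (fun _ : Fin 1 => j) f d) (θ : 𝓢(Rn n, ℂ)) :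
    ∫ x, (∂_{(EuclideanSpace.single j 1 : Rn n)} θ) x * (f x : ℂ) = -∫ x, θ x * (d x : ℂ) :=
  integral_lineDeriv_schwartz (by simp) (fun _ hφ hc => h.integral_complex hφ hc) θ

theorem exists_lineDeriv_fourier_eq (θ : 𝓢(Rn n, ℂ)) (j : Fin n) :
    ∃ θ' : 𝓢(Rn n, ℂ), (∂_{(EuclideanSpace.single j 1 : Rn n)} (𝓕 θ) : 𝓢(Rn n, ℂ)) = 𝓕 θ' ∧
      ∀ ξ, θ' ξ = -(2 * Real.pi * Complex.I * (ξ j : ℂ)) * θ ξ := by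
  refine ⟨_, SchwartzMap.lineDerivOp_fourier_eq θ _, fun ξ => ?_⟩
  have hte : (fun x : Rn n => inner ℝ x (EuclideanSpace.single j 1 : Rn n)).HasTemperateGrowth :=
    ((innerSL ℝ).flip (EuclideanSpace.single j 1 : Rn n)).hasTemperateGrowth
  have h1 : inner ℝ ξ (EuclideanSpace.single j 1 : Rn n) = ξ j := by
    rw [EuclideanSpace.inner_single_right]; simp
  rw [smul_apply, SchwartzMap.smulLeftCLM_apply_apply hte, h1, Complex.real_smul, smul_eq_mul]
  ring

/-- The Fourier transform turns weak derivatives of `L²` functions into multiplication. -/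
theorem HasWeakDeriv.ft_eq {j : Fin n} {f d : L2 n} (h : HasWeakDeriv (fun _ : Fin 1 => j) f d) :
    ft n d =ᵐ[volume] fun ξ => (2 * Real.pi * Complex.I * (ξ j : ℂ)) * ft n f ξ := by
  have hl1 : LocallyIntegrable (ft n d) := locallyIntegrable_of_memLp_two (Lp.memLp _)
  have hl2 : LocallyIntegrable fun ξ => (2 * Real.pi * Complex.I * (ξ j : ℂ)) * ft n f ξ := by
    have h2 : LocallyIntegrableOn (ft n f) univ :=
      (locallyIntegrable_of_memLp_two (Lp.memLp (ft n f))).locallyIntegrableOn _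
    have h3 := h2.continuousOn_smul (g := fun ξ : Rn n => (2 * Real.pi * Complex.I * (ξ j : ℂ)))
      isOpen_univ.isLocallyClosed (by fun_prop)
    rw [locallyIntegrableOn_univ] at h3
    simpa using h3
  refine ae_eq_of_forall_schwartz hl1 hl2 fun θ => ?_
  -- The weak derivative is tested with 𝓕 θ, whose derivative is again the transform of an explicit
  -- Schwartz function; duality then moves both transforms onto `f` and `d`.
  obtain ⟨θ', hD, hθ'⟩ := exists_lineDeriv_fourier_eq θ j
  have h3 := h.integral_schwartz (𝓕 θ)
  rw [hD, ← integral_mul_ft f θ', ← integral_mul_ft d θ] at h3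
  have i1 : Integrable fun ξ => θ ξ * ft n d ξ :=
    MemLp.integrable_mul (p := 2) (q := 2) (θ.memLp 2) (Lp.memLp _)
  have i2 : Integrable fun ξ => θ' ξ * ft n f ξ :=
    MemLp.integrable_mul (p := 2) (q := 2) (θ'.memLp 2) (Lp.memLp _)
  have e1 : ∀ ξ, θ ξ * ((2 * Real.pi * Complex.I * (ξ j : ℂ)) * ft n f ξ) =
      -(θ' ξ * ft n f ξ) := by
    intro ξ
    rw [hθ']
    ring
  refine ⟨i1, ?_, ?_⟩
  · simp only [e1]
    exact i2.neg
  · simp only [e1]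
    rw [integral_neg, h3, neg_neg]

/-! ### Fourier transform of products -/

section Product

/-- The Fourier transform of a product of Schwartz functions is a convolution. -/
theorem fourier_mul_schwartz (f h : 𝓢(Rn n, ℂ)) (ξ : Rn n) :
    𝓕 (fun x => f x * h x) ξ = ∫ η, (𝓕 f) (ξ - η) * (𝓕 h) η := by
  have hneg : ∀ (F : 𝓢(Rn n, ℂ)) x, (𝓕 (𝓕 F)) x = F (-x) := by
    intro F x
    have h1 : (𝓕⁻ (𝓕 F)) (-x) = F (-x) := by rw [FourierTransform.fourierInv_fourier_eq]
    rw [← h1, SchwartzMap.fourierInv_coe, Real.fourierInv_eq_fourier_neg, neg_neg,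
      ← SchwartzMap.fourier_coe]
  set B := ContinuousLinearMap.mul ℂ ℂ
  -- The convolution theorem gives the transform of a convolution, so both sides are transformed
  -- once more: 𝓕 ∘ 𝓕 is reflection, and 𝓕 can be cancelled at the end.
  have key : 𝓕 (SchwartzMap.pairing B f h) = SchwartzMap.convolution B (𝓕 h) (𝓕 f) := by
    have : 𝓕 (𝓕 (SchwartzMap.pairing B f h)) = 𝓕 (SchwartzMap.convolution B (𝓕 h) (𝓕 f)) := by
      rw [SchwartzMap.fourier_convolution]
      ext x
      rw [hneg]
      simp [hneg, B, mul_comm]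
    have h2 := congrArg (fun F : 𝓢(Rn n, ℂ) => 𝓕⁻ F) this
    simpa using h2
  have h3 : (fun x => f x * h x) = ⇑(SchwartzMap.pairing B f h) := by ext x; simp [B]
  rw [h3, ← SchwartzMap.fourier_coe, key, SchwartzMap.convolution_apply]
  simp [convolution, B, mul_comm]

end Product

/-- A bounded measurable function, viewed as a Fourier multiplier. -/
structure Mult (n : ℕ) where
  toFun : Rn n → ℂ
  measurable : Measurable toFun
  bound : ℝ
  norm_le : ∀ x, ‖toFun x‖ ≤ bound

namespace Mult

instance : CoeFun (Mult n) (fun _ => Rn n → ℂ) := ⟨toFun⟩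

theorem memLp (a : Mult n) (f : CL2 n) : MemLp (fun x => a x * f x) 2 volume :=
  MemLp.of_le_mul (c := a.bound) (Lp.memLp f)
    (a.measurable.aestronglyMeasurable.mul (Lp.aestronglyMeasurable f))
    (Filter.Eventually.of_forall fun x => by
      rw [norm_mul]; exact mul_le_mul_of_nonneg_right (a.norm_le x) (norm_nonneg _))

/-- The multiplication operator on `L²`. -/
def op (a : Mult n) : CL2 n →L[ℂ] CL2 n :=
  LinearMap.mkContinuous
    { toFun := fun f => (a.memLp f).toLp _
      map_add' := fun f g => by
        rw [← MemLp.toLp_add (a.memLp f) (a.memLp g)]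
        refine MemLp.toLp_congr _ _ ?_
        filter_upwards [Lp.coeFn_add f g] with x hx
        rw [Pi.add_apply, hx, Pi.add_apply, mul_add]
      map_smul' := fun c f => by
        rw [RingHom.id_apply, ← MemLp.toLp_const_smul c (a.memLp f)]
        refine MemLp.toLp_congr _ _ ?_
        filter_upwards [Lp.coeFn_smul c f] with x hx
        simp only [hx, Pi.smul_apply, smul_eq_mul]
        ring }
    a.bound fun f => by
      refine Lp.norm_le_mul_norm_of_ae_le_mul ?_
      filter_upwards [(a.memLp f).coeFn_toLp] with x hx
      simp only [LinearMap.coe_mk, AddHom.coe_mk]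
      rw [hx, norm_mul]
      exact mul_le_mul_of_nonneg_right (a.norm_le x) (norm_nonneg _)

theorem coeFn_op (a : Mult n) (f : CL2 n) : a.op f =ᵐ[volume] fun x => a x * f x :=
  (a.memLp f).coeFn_toLp

end Mult

section Product

/-- The character `x ↦ e^{-2πi⟨x,ξ⟩}`. -/
def charMult (ξ : Rn n) : Mult n where
  toFun x := Real.fourierChar (-inner ℝ x ξ)
  measurable := by fun_prop
  bound := 1
  norm_le x := (Circle.norm_coe _).le

theorem measurePreserving_const_sub (ξ : Rn n) :
    MeasurePreserving (fun η : Rn n => ξ - η) volume volume := by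
  have h := (measurePreserving_add_left (volume : Measure (Rn n)) ξ).comp
    (Measure.measurePreserving_neg (volume : Measure (Rn n)))
  simpa only [Function.comp_def, ← sub_eq_add_neg] using h

theorem fourier_toLp_mul_toLp (a b : 𝓢(Rn n, ℂ)) (ξ : Rn n) :
    𝓕 (fun x => (a.toLp 2 : CL2 n) x * (b.toLp 2 : CL2 n) x) ξ = 𝓕 (fun x => a x * b x) ξ := by
  rw [Real.fourier_eq, Real.fourier_eq]
  refine integral_congr_ae ?_
  filter_upwards [a.coeFn_toLp 2 volume, b.coeFn_toLp 2 volume] with x h1 h2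
  rw [h1, h2]

theorem integral_toLp_sub_mul_toLp (a b : 𝓢(Rn n, ℂ)) (ξ : Rn n) :
    ∫ η, (a.toLp 2 : CL2 n) (ξ - η) * (b.toLp 2 : CL2 n) η = ∫ η, a (ξ - η) * b η := by
  refine integral_congr_ae ?_
  have q1 := a.coeFn_toLp 2 (volume : Measure (Rn n))
  have q2 := b.coeFn_toLp 2 (volume : Measure (Rn n))
  have q3 := (measurePreserving_const_sub ξ).quasiMeasurePreserving.ae q1
  filter_upwards [q2, q3] with x h2 h1
  rw [h1, h2]

/-- The Fourier transform of a product of `L²` functions is the convolution of the Fourier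
transforms. -/
theorem fourier_mul_L2 (f h : CL2 n) (ξ : Rn n) :
    𝓕 (fun x => f x * h x) ξ = ∫ η, (𝓕 f : CL2 n) (ξ - η) * (𝓕 h : CL2 n) η := by
  set B := ContinuousLinearMap.mul ℂ ℂ
  set P := B.lpPairing (volume : Measure (Rn n)) 2 2
  set S := Lp.compMeasurePreservingₗᵢ (E := ℂ) (p := 2) ℂ (fun η : Rn n => ξ - η)
    (measurePreserving_const_sub ξ)
  have hL : ∀ f h : CL2 n, 𝓕 (fun x => f x * h x) ξ = P ((charMult ξ).op f) h := by
    intro f h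
    rw [Real.fourier_eq, ContinuousLinearMap.lpPairing_eq_integral]
    refine integral_congr_ae ?_
    filter_upwards [(charMult ξ).coeFn_op f] with x hx
    rw [hx]
    simp [B, charMult, Circle.smul_def, mul_assoc]
  have hR : ∀ f h : CL2 n, ∫ η, (𝓕 f : CL2 n) (ξ - η) * (𝓕 h : CL2 n) η = P (S (𝓕 f)) (𝓕 h) := by
    intro f h
    rw [ContinuousLinearMap.lpPairing_eq_integral]
    refine integral_congr_ae ?_
    filter_upwards [Lp.coeFn_compMeasurePreserving (𝓕 f : CL2 n)
      (measurePreserving_const_sub ξ)] with x hx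
    have : (S (𝓕 f) : Rn n → ℂ) x = (𝓕 f : CL2 n) (ξ - x) := hx
    rw [this]
    rfl
  rw [hL, hR]
  -- For fixed ξ both sides are continuous in the pair (f, h) in L² × L², being L² pairings after a
  -- character multiplication or a reflected translation. Density of Schwartz functions therefore
  -- suffices.
  refine DenseRange.induction_on₂ (p := fun f h : CL2 n =>
      P ((charMult ξ).op f) h = P (S (𝓕 f)) (𝓕 h))
    (SchwartzMap.denseRange_toLpCLM (F := ℂ) (p := 2) (μ := (volume : Measure (Rn n)))
      ENNReal.ofNat_ne_top) ?_ ?_ f h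
  · have hF : Continuous fun f : CL2 n => (𝓕 f : CL2 n) :=
      (Lp.fourierTransformₗᵢ (Rn n) ℂ).continuous
    refine isClosed_eq ?_ ?_
    · exact (P.continuous.comp ((charMult ξ).op.continuous.comp continuous_fst)).clm_apply
        continuous_snd
    · exact (P.continuous.comp (S.continuous.comp (hF.comp continuous_fst))).clm_apply
        (hF.comp continuous_snd)
  · intro a b
    rw [← hL, ← hR]
    simp only [SchwartzMap.toLpCLM_apply, SchwartzMap.toLp_fourier_eq]
    rw [fourier_toLp_mul_toLp, fourier_mul_schwartz, integral_toLp_sub_mul_toLp]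

theorem integrable_mul_L2 (f h : L2 n) : Integrable fun x => f x * h x :=
  MemLp.integrable_mul (p := 2) (q := 2) (Lp.memLp f) (Lp.memLp h)

/-- The convolution formula concerns the Fourier integral, whereas `ft` is the Plancherel extension.
On L¹ ∩ L² the two have the same pairings with Schwartz functions. -/
theorem ft_eq_fourier_of_integrable (N : L2 n) (hN : Integrable N) :
    ft n N =ᵐ[volume] 𝓕 (fun x => (N x : ℂ)) := by
  have hNC : Integrable fun x => (N x : ℂ) := hN.ofReal
  have hcont : Continuous (𝓕 (fun x => (N x : ℂ)) : Rn n → ℂ) :=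
    VectorFourier.fourierIntegral_continuous Real.continuous_fourierChar
      (by exact continuous_inner) hNC
  have hl1 : LocallyIntegrable (ft n N) := locallyIntegrable_of_memLp_two (Lp.memLp _)
  refine ae_eq_of_forall_schwartz hl1 hcont.locallyIntegrable fun θ => ⟨?_, ?_, ?_⟩
  · exact MemLp.integrable_mul (p := 2) (q := 2) (θ.memLp 2) (Lp.memLp _)
  · refine Integrable.mul_bdd (c := ∫ x, ‖(N x : ℂ)‖) θ.integrable hcont.aestronglyMeasurable ?_
    exact Filter.Eventually.of_forall fun x => VectorFourier.norm_fourierIntegral_le_integral_norm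
      _ _ _ _ _
  · rw [integral_mul_ft]
    have h := VectorFourier.integral_fourierIntegral_smul_eq_flip (μ := volume) (ν := volume)
      (e := Real.fourierChar) (L := innerₗ (Rn n)) (f := θ) (g := fun x => (N x : ℂ))
      Real.continuous_fourierChar (by exact continuous_inner) θ.integrable hNC
    simp only [flip_innerₗ, smul_eq_mul] at h
    exact h

/-- A finite sum of products of L² functions is in L¹, so its transform is a sum of convolutions.
Taking absolute values removes all cancellation, and only integrals of nonnegative functions remain
for the product estimates. -/
theorem enorm_ft_le_sum {ι : Type*} (s : Finset ι) (c : ι → ℝ) (f h : ι → L2 n) (N : L2 n)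
    (hN : ∀ᵐ x, N x = ∑ i ∈ s, c i * (f i x * h i x)) :
    ∀ᵐ ξ, ‖ft n N ξ‖ₑ ≤
      ∑ i ∈ s, ‖c i‖ₑ * ∫⁻ η, ‖ft n (f i) (ξ - η)‖ₑ * ‖ft n (h i) η‖ₑ := by
  have hint : Integrable N := by
    refine Integrable.congr (f := fun x => ∑ i ∈ s, c i * (f i x * h i x)) ?_
      (hN.mono fun x hx => hx.symm)
    exact integrable_finsetSum _ fun i _ => (integrable_mul_L2 (f i) (h i)).const_mul _
  filter_upwards [ft_eq_fourier_of_integrable N hint] with ξ hξ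
  rw [hξ]
  have hi : ∀ i, Integrable fun x => (f i x : ℂ) * (h i x : ℂ) := fun i => by
    have := (integrable_mul_L2 (f i) (h i)).ofReal (𝕜 := ℂ)
    simpa using this
  have h1 : 𝓕 (fun x => (N x : ℂ)) ξ =
      ∑ i ∈ s, (c i : ℂ) * 𝓕 (fun x => (f i x : ℂ) * (h i x : ℂ)) ξ := by
    simp only [Real.fourier_eq]
    have e1 : ∀ i, (c i : ℂ) * ∫ x, Real.fourierChar (-inner ℝ x ξ) •
        ((f i x : ℂ) * (h i x : ℂ)) = ∫ x, (c i : ℂ) * (Real.fourierChar (-inner ℝ x ξ) •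
        ((f i x : ℂ) * (h i x : ℂ))) := fun i => (integral_const_mul _ _).symm
    simp only [e1]
    rw [← integral_finsetSum]
    · refine integral_congr_ae ?_
      filter_upwards [hN] with x hx
      rw [hx]
      simp only [Complex.ofReal_sum, Complex.ofReal_mul, Finset.smul_sum, mul_smul_comm]
    · intro i _
      refine Integrable.const_mul ?_ _
      exact (Real.fourierIntegral_convergent_iff ξ).2 (hi i)
  rw [h1]
  refine (enorm_sum_le _ _).trans (Finset.sum_le_sum fun i _ => ?_)
  rw [enorm_mul]
  refine mul_le_mul' (by rw [← ofReal_norm, ← ofReal_norm, Complex.norm_real]) ?_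
  have h2 : 𝓕 (fun x => (f i x : ℂ) * (h i x : ℂ)) ξ =
      𝓕 (fun x => (Complex.ofRealCLM.compLpL 2 volume (f i) : CL2 n) x *
        (Complex.ofRealCLM.compLpL 2 volume (h i) : CL2 n) x) ξ := by
    rw [Real.fourier_eq, Real.fourier_eq]
    refine integral_congr_ae ?_
    filter_upwards [Complex.ofRealCLM.coeFn_compLpL (p := 2) (μ := volume) (f i),
      Complex.ofRealCLM.coeFn_compLpL (p := 2) (μ := volume) (h i)] with x h1 h2
    rw [h1, h2]; rfl
  rw [h2, fourier_mul_L2]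
  refine (enorm_integral_le_lintegral_enorm _).trans (le_of_eq ?_)
  simp only [enorm_mul]
  rfl

end Product

/-! ### Calculus of weak derivatives -/

section WeakDeriv

variable {κ : ℕ} {α : Fin κ → Fin n} {f f' : Rn n → ℝ} {d d' : L2 n}

theorem locallyIntegrable_L2 (d : L2 n) : LocallyIntegrable d :=
  (Lp.memLp d).locallyIntegrable (by norm_num)

theorem integrable_mul_test {f φ : Rn n → ℝ} (hf : LocallyIntegrable f)
    (hφ : Continuous φ) (hc : HasCompactSupport φ) : Integrable fun x => f x * φ x := by
  simpa [mul_comm] using hf.integrable_smul_left_of_hasCompactSupport hφ hc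

theorem continuous_iteratedFDeriv_apply {φ : Rn n → ℝ} (hφ : ContDiff ℝ ∞ φ)
    (v : Fin κ → Rn n) : Continuous fun x => iteratedFDeriv ℝ κ φ x v :=
  (ContinuousMultilinearMap.apply ℝ (fun _ : Fin κ => Rn n) ℝ v).continuous.comp
    (hφ.continuous_iteratedFDeriv (by exact_mod_cast le_top))

theorem hasCompactSupport_iteratedFDeriv_apply {φ : Rn n → ℝ} (hc : HasCompactSupport φ)
    (v : Fin κ → Rn n) : HasCompactSupport fun x => iteratedFDeriv ℝ κ φ x v :=
  (hc.iteratedFDeriv (𝕜 := ℝ) κ).comp_left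
    (g := fun L : ContinuousMultilinearMap ℝ (fun _ : Fin κ => Rn n) ℝ => L v) rfl

theorem HasWeakDeriv.unique (h : HasWeakDeriv α f d) (h' : HasWeakDeriv α f d') : d = d' := by
  refine Lp.ext ?_
  refine ae_eq_of_integral_contDiff_smul_eq (locallyIntegrable_L2 d) (locallyIntegrable_L2 d')
    fun φ hφ hc => ?_
  have e := (h.2 φ hφ hc).symm.trans (h'.2 φ hφ hc)
  have e' := mul_left_cancel₀ (pow_ne_zero κ (by norm_num : (-1 : ℝ) ≠ 0)) e
  simpa [mul_comm] using e'

theorem HasWeakDeriv.weakDeriv_eq (h : HasWeakDeriv α f d) : weakDeriv α f = d := by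
  have hex : ∃ g : L2 n, HasWeakDeriv α f g := ⟨d, h⟩
  rw [weakDeriv, dif_pos hex]
  exact hex.choose_spec.unique h

theorem HasWeakDeriv.congr_ae (h : HasWeakDeriv α f d) (hf : f =ᵐ[volume] f') :
    HasWeakDeriv α f' d := by
  refine ⟨h.1.congr hf, fun φ hφ hc => ?_⟩
  rw [← h.2 φ hφ hc]
  refine integral_congr_ae ?_
  filter_upwards [hf] with x hx
  rw [hx]

theorem HasWeakDeriv.add_const_mul (h : HasWeakDeriv α f d) (h' : HasWeakDeriv α f' d') (c : ℝ) :
    HasWeakDeriv α (fun x => f x + c * f' x) (d + c • d') := by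
  refine ⟨h.1.add (h'.1.smul c), fun φ hφ hc => ?_⟩
  have hcont := continuous_iteratedFDeriv_apply hφ
    (fun j => EuclideanSpace.single (α j) (1 : ℝ))
  have hcomp := hasCompactSupport_iteratedFDeriv_apply hc
    (fun j => EuclideanSpace.single (α j) (1 : ℝ))
  have e1 : ∫ x, (d + c • d' : L2 n) x * φ x = ∫ x, d x * φ x + c * (d' x * φ x) := by
    refine integral_congr_ae ?_
    filter_upwards [Lp.coeFn_add d (c • d'), Lp.coeFn_smul c d'] with x h1 h2
    rw [h1, Pi.add_apply, h2, Pi.smul_apply, smul_eq_mul]; ring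
  rw [e1, integral_add (integrable_mul_test (locallyIntegrable_L2 d)
      hφ.continuous hc) ((integrable_mul_test (locallyIntegrable_L2 d')
      hφ.continuous hc).const_mul c), integral_const_mul]
  simp only [add_mul, mul_assoc]
  rw [integral_add (integrable_mul_test h.1 hcont hcomp)
    ((integrable_mul_test h'.1 hcont hcomp).const_mul c), integral_const_mul,
    h.2 φ hφ hc, h'.2 φ hφ hc]
  ring

theorem hasWeakDeriv_zero (α : Fin 0 → Fin n) (f : L2 n) : HasWeakDeriv α f f :=
  ⟨locallyIntegrable_L2 f, fun φ _ _ => by simp⟩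

theorem iteratedFDeriv_fderiv_single {φ : Rn n → ℝ} (hφ : ContDiff ℝ ∞ φ)
    (v : Fin (κ + 1) → Rn n) (x : Rn n) :
    iteratedFDeriv ℝ κ (fun y => fderiv ℝ φ y (v (Fin.last κ))) x (Fin.init v) =
      iteratedFDeriv ℝ (κ + 1) φ x v := by
  rw [iteratedFDeriv_succ_apply_right]
  have h1 : ContDiff ℝ ∞ fun y => fderiv ℝ φ y := hφ.fderiv_right (by simp)
  have h2 := ((ContinuousLinearMap.apply ℝ ℝ (v (Fin.last κ))).iteratedFDeriv_comp_left
    (x := x) (i := κ) h1.contDiffAt (by exact_mod_cast le_top))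
  have h3 := congrArg (fun L => L (Fin.init v)) h2
  simpa [Function.comp_def] using h3

/-- Testing the lower-order derivative with the last partial derivative of φ gives the higher-order
relation for φ. This reduces symbols of all orders to the first-order statement
`HasWeakDeriv.ft_eq`. -/
theorem HasWeakDeriv.peel {α : Fin (κ + 1) → Fin n} (h : HasWeakDeriv α f d)
    (h' : HasWeakDeriv (Fin.init α : Fin κ → Fin n) f d') :
    HasWeakDeriv (fun _ : Fin 1 => α (Fin.last κ)) d' d := by
  refine ⟨locallyIntegrable_L2 d', fun φ hφ hc => ?_⟩
  have hφ' : ContDiff ℝ ∞ fun y => fderiv ℝ φ y (EuclideanSpace.single (α (Fin.last κ)) 1) :=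
    (hφ.fderiv_right (by simp)).clm_apply contDiff_const
  have hc' : HasCompactSupport
      fun y => fderiv ℝ φ y (EuclideanSpace.single (α (Fin.last κ)) (1 : ℝ)) :=
    (hc.fderiv ℝ).comp_left
      (g := fun L : Rn n →L[ℝ] ℝ => L (EuclideanSpace.single (α (Fin.last κ)) 1)) rfl
  have e1 := h'.2 _ hφ' hc'
  have e2 := h.2 φ hφ hc
  have e3 : ∀ x, iteratedFDeriv ℝ κ
      (fun y => fderiv ℝ φ y (EuclideanSpace.single (α (Fin.last κ)) 1)) x
      (fun j => EuclideanSpace.single ((Fin.init α : Fin κ → Fin n) j) (1 : ℝ)) =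
      iteratedFDeriv ℝ (κ + 1) φ x (fun j => EuclideanSpace.single (α j) (1 : ℝ)) := fun x =>
    iteratedFDeriv_fderiv_single hφ (fun j => EuclideanSpace.single (α j) (1 : ℝ)) x
  simp only [e3] at e1
  rw [e2, pow_succ, mul_assoc] at e1
  have e4 := mul_left_cancel₀ (pow_ne_zero κ (by norm_num : (-1 : ℝ) ≠ 0)) e1
  simp only [iteratedFDeriv_one_single]
  rw [← e4, pow_one]

theorem HasWeakDeriv.swap {i j : Fin n} (h : HasWeakDeriv ![i, j] f d) :
    HasWeakDeriv ![j, i] f d := by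
  refine ⟨h.1, fun φ hφ hc => ?_⟩
  rw [← h.2 φ hφ hc]
  congr 1; ext x; congr 1
  rw [iteratedFDeriv_two_apply, iteratedFDeriv_two_apply]
  simp only [Matrix.cons_val_zero, Matrix.cons_val_one]
  exact (hφ.contDiffAt.isSymmSndFDerivAt (by rw [minSmoothness_of_isRCLikeNormedField]; exact WithTop.coe_le_coe.2 (le_top : (2 : ℕ∞) ≤ ⊤))) _ _

end WeakDeriv

/-! ### Fourier symbols and Sobolev seminorms -/

/-- The symbol `2π|ξ|` of `(-Δ)^{1/2}`. -/
def afun (ξ : Rn n) : ℝ := 2 * Real.pi * ‖ξ‖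

theorem afun_nonneg (ξ : Rn n) : 0 ≤ afun ξ := by unfold afun; positivity

@[fun_prop]
theorem measurable_afun : Measurable (afun : Rn n → ℝ) := by unfold afun; fun_prop

/-- The symbol `2π|ξ|` as an extended nonnegative number. -/
def eA (ξ : Rn n) : ℝ≥0∞ := ENNReal.ofReal (afun ξ)

@[fun_prop]
theorem measurable_eA : Measurable (eA : Rn n → ℝ≥0∞) := measurable_afun.ennreal_ofReal

theorem eA_ne_top (ξ : Rn n) : eA ξ ≠ ⊤ := ENNReal.ofReal_ne_top

theorem enorm_afun (ξ : Rn n) : ‖(afun ξ : ℂ)‖ₑ = eA ξ := by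
  rw [← ofReal_norm, Complex.norm_real, Real.norm_of_nonneg (afun_nonneg ξ), eA]

/-- The Fourier symbol of `∂_{α 0} ⋯ ∂_{α (κ-1)}`. -/
def sym {κ : ℕ} (α : Fin κ → Fin n) (ξ : Rn n) : ℂ :=
  ∏ i, (2 * Real.pi * Complex.I * (ξ (α i) : ℂ))

theorem sum_sq_coord (ξ : Rn n) : ∑ j, ξ j ^ 2 = ‖ξ‖ ^ 2 := by
  rw [EuclideanSpace.norm_sq_eq]; simp

theorem sum_enorm_coord_sq (ξ : Rn n) :
    ∑ j : Fin n, ‖(2 * Real.pi * Complex.I * (ξ j : ℂ))‖ₑ ^ 2 = eA ξ ^ 2 := by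
  have h : ∀ j : Fin n, ‖(2 * Real.pi * Complex.I * (ξ j : ℂ))‖ₑ ^ 2 =
      ENNReal.ofReal ((2 * Real.pi) ^ 2 * ξ j ^ 2) := fun j => by
    rw [← ofReal_norm, ← ENNReal.ofReal_pow (norm_nonneg _)]
    congr 1
    simp [mul_pow, abs_of_pos Real.pi_pos]
  simp only [h]
  rw [← ENNReal.ofReal_sum_of_nonneg (fun _ _ => by positivity), ← Finset.mul_sum, sum_sq_coord,
    eA, ← ENNReal.ofReal_pow (afun_nonneg ξ), afun]
  congr 1; ring

theorem enorm_sym {κ : ℕ} (α : Fin κ → Fin n) (ξ : Rn n) :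
    ‖sym α ξ‖ₑ = ∏ i, ‖(2 * Real.pi * Complex.I * (ξ (α i) : ℂ))‖ₑ := by
  rw [sym, ← ofReal_norm, norm_prod, ENNReal.ofReal_prod_of_nonneg (fun _ _ => norm_nonneg _)]
  simp only [ofReal_norm]

/-- Since the sum runs over ordered index tuples, it is the expansion of the κ-th power of ∑_j
|2πξ_j|², with no multinomial coefficients. -/
theorem sum_enorm_sym_sq (κ : ℕ) (ξ : Rn n) :
    ∑ α : Fin κ → Fin n, ‖sym α ξ‖ₑ ^ 2 = eA ξ ^ (2 * κ) := by
  simp only [enorm_sym, ← Finset.prod_pow]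
  rw [pow_mul, ← sum_enorm_coord_sq, Fintype.sum_pow]

theorem sum_coord_sq (ξ : Rn n) :
    ∑ j : Fin n, (2 * Real.pi * Complex.I * (ξ j : ℂ)) ^ 2 = -(afun ξ : ℂ) ^ 2 := by
  have h : ∀ j : Fin n, (2 * Real.pi * Complex.I * (ξ j : ℂ)) ^ 2 =
      -(((2 * Real.pi) ^ 2 * ξ j ^ 2 : ℝ) : ℂ) := fun j => by
    push_cast
    rw [mul_pow, mul_pow, Complex.I_sq]; ring
  simp only [h]
  rw [Finset.sum_neg_distrib, ← Complex.ofReal_sum, ← Finset.mul_sum, sum_sq_coord]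
  simp [afun, mul_pow]

/-- All weak derivatives of `f` of order `κ` are in `L²`, and on the Fourier side they are the
products of the symbols of the derivatives with `σ`. -/
def HasSymbol (κ : ℕ) (f : Rn n → ℝ) (σ : Rn n → ℂ) : Prop :=
  ∀ α : Fin κ → Fin n, ∃ d : L2 n, HasWeakDeriv α f d ∧
    ft n d =ᵐ[volume] fun ξ => sym α ξ * σ ξ

theorem enorm_sq_L2 (F : CL2 n) : ‖F‖ₑ ^ 2 = ∫⁻ ξ, ‖F ξ‖ₑ ^ 2 := by
  rw [Lp.enorm_def]
  have h := eLpNorm_nnreal_pow_eq_lintegral (μ := (volume : Measure (Rn n))) (f := F) (p := 2)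
    two_ne_zero
  simpa using h

theorem enorm_ft (f : L2 n) : ‖ft n f‖ₑ = ‖f‖ₑ := by
  rw [← ofReal_norm, norm_ft, ofReal_norm]

theorem weakDeriv_zero_eq (α : Fin 0 → Fin n) (f : L2 n) : weakDeriv α f = f :=
  (hasWeakDeriv_zero α f).weakDeriv_eq

namespace HasSymbol

variable {κ : ℕ} {f f' : Rn n → ℝ} {σ σ' : Rn n → ℂ}

theorem ft_weakDeriv (h : HasSymbol κ f σ) (α : Fin κ → Fin n) :
    ft n (weakDeriv α f) =ᵐ[volume] fun ξ => sym α ξ * σ ξ := by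
  obtain ⟨d, hd, he⟩ := h α
  rw [hd.weakDeriv_eq]; exact he

theorem succ (h : HasSymbol κ f σ)
    (hd : ∀ α : Fin (κ + 1) → Fin n, ∃ d : L2 n, HasWeakDeriv α f d) :
    HasSymbol (κ + 1) f σ := by
  intro α
  obtain ⟨d, hd⟩ := hd α
  obtain ⟨d', hd', he⟩ := h (Fin.init α)
  refine ⟨d, hd, ?_⟩
  filter_upwards [(hd.peel hd').ft_eq, he] with ξ h1 h2
  rw [h1, h2, sym, sym, Fin.prod_univ_castSucc]
  simp only [Fin.init]
  ring

theorem congr_ae (h : HasSymbol κ f σ) (hf : f =ᵐ[volume] f') : HasSymbol κ f' σ := fun α => by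
  obtain ⟨d, hd, he⟩ := h α
  exact ⟨d, hd.congr_ae hf, he⟩

theorem add_const_mul (h : HasSymbol κ f σ) (h' : HasSymbol κ f' σ') (c : ℝ) :
    HasSymbol κ (fun x => f x + c * f' x) (fun ξ => σ ξ + c * σ' ξ) := fun α => by
  obtain ⟨d, hd, he⟩ := h α
  obtain ⟨d', hd', he'⟩ := h' α
  refine ⟨_, hd.add_const_mul hd' c, ?_⟩
  rw [map_add, map_smul]
  filter_upwards [he, he', Lp.coeFn_add (ft n d) (c • ft n d'),
    Lp.coeFn_smul c (ft n d')] with ξ h1 h2 h3 h4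
  rw [h3, Pi.add_apply, h4, Pi.smul_apply, h1, h2, Complex.real_smul]
  ring

/-- Plancherel for each tuple of indices, followed by `sum_enorm_sym_sq` under the integral. -/
theorem gradSq_eq (h : HasSymbol κ f σ) :
    gradSq κ f = ∫⁻ ξ, eA ξ ^ (2 * κ) * ‖σ ξ‖ₑ ^ 2 := by
  have h1 : ∀ α : Fin κ → Fin n, ‖weakDeriv α f‖ₑ ^ 2 =
      ∫⁻ ξ, ‖ft n (weakDeriv α f) ξ‖ₑ ^ 2 := fun α => by
    rw [← enorm_sq_L2, enorm_ft]
  rw [gradSq]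
  simp only [h1]
  rw [← lintegral_finsetSum' _ fun α _ =>
    (Lp.aestronglyMeasurable (ft n (weakDeriv α f))).enorm.pow_const 2]
  refine lintegral_congr_ae ?_
  filter_upwards [ae_all_iff.2 h.ft_weakDeriv] with ξ hξ
  simp only [hξ, enorm_mul, mul_pow]
  rw [← Finset.sum_mul, sum_enorm_sym_sq]

theorem ft_lapDeriv (h : HasSymbol (κ + 2) f σ) (α : Fin κ → Fin n) :
    ft n (lapDeriv α f) =ᵐ[volume] fun ξ => -(afun ξ : ℂ) ^ 2 * (sym α ξ * σ ξ) := by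
  rw [lapDeriv, map_sum]
  filter_upwards [Lp.coeFn_finsetSum Finset.univ fun j : Fin n =>
    ft n (weakDeriv (Fin.cons j (Fin.cons j α) : Fin (κ + 2) → Fin n) f),
    ae_all_iff.2 fun j : Fin n => h.ft_weakDeriv (Fin.cons j (Fin.cons j α))] with ξ h1 h2
  rw [h1, Finset.sum_apply]
  simp only [h2]
  rw [← Finset.sum_mul, ← mul_assoc]
  congr 1
  rw [← sum_coord_sq, Finset.sum_mul]
  refine Finset.sum_congr rfl fun j _ => ?_
  rw [sym, sym, Fin.prod_univ_succ, Fin.prod_univ_succ]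
  simp only [Fin.cons_zero, Fin.cons_succ]
  ring

theorem ft_lap (h : HasSymbol 2 f σ) :
    ft n (lap f) =ᵐ[volume] fun ξ => -(afun ξ : ℂ) ^ 2 * σ ξ := by
  filter_upwards [h.ft_lapDeriv (κ := 0) Fin.elim0] with ξ hξ
  rw [lap, hξ]; simp [sym]

theorem lapGradSq_eq (h : HasSymbol (κ + 2) f σ) :
    lapGradSq κ f = ∫⁻ ξ, eA ξ ^ (2 * κ + 4) * ‖σ ξ‖ₑ ^ 2 := by
  have h1 : ∀ α : Fin κ → Fin n, ‖lapDeriv α f‖ₑ ^ 2 =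
      ∫⁻ ξ, ‖ft n (lapDeriv α f) ξ‖ₑ ^ 2 := fun α => by
    rw [← enorm_sq_L2, enorm_ft]
  rw [lapGradSq]
  simp only [h1]
  rw [← lintegral_finsetSum' _ fun α _ =>
    (Lp.aestronglyMeasurable (ft n (lapDeriv α f))).enorm.pow_const 2]
  refine lintegral_congr_ae ?_
  filter_upwards [ae_all_iff.2 h.ft_lapDeriv] with ξ hξ
  simp only [hξ, enorm_mul, mul_pow, enorm_neg, enorm_pow, enorm_afun]
  rw [← Finset.mul_sum, ← Finset.sum_mul, sum_enorm_sym_sq]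
  ring

end HasSymbol

theorem MemDerivs.hasSymbol_L2 {q : ℕ} {f : L2 n} (h : MemDerivs 0 q (f : Rn n → ℝ)) :
    ∀ κ ≤ q, HasSymbol κ f (ft n f) := by
  intro κ
  induction κ with
  | zero =>
    intro _ α
    refine ⟨f, hasWeakDeriv_zero α f, ?_⟩
    filter_upwards with ξ
    simp [sym]
  | succ κ ih => exact fun hκ => (ih (by omega)).succ (h (κ + 1) (by omega) hκ)

/-- The Riesz transform symbol `-i ξ_j / |ξ|`. -/
def rieszMult (j : Fin n) : Mult n where
  toFun ξ := -Complex.I * ((ξ j / ‖ξ‖ : ℝ) : ℂ)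
  measurable := by fun_prop
  bound := 1
  norm_le ξ := by
    rw [norm_mul, norm_neg, Complex.norm_I, one_mul, Complex.norm_real, norm_div, norm_norm]
    exact div_le_one_of_le₀ (PiLp.norm_apply_le ξ j) (norm_nonneg _)

/-- The Fourier transform of `(-Δ)^{1/2} f`, computed from the gradient of `f`. -/
def gradFt (f : Rn n → ℝ) : CL2 n := ∑ j, (rieszMult j).op (ft n (weakPartial j f))

theorem coeFn_gradFt (f : Rn n → ℝ) : gradFt f =ᵐ[volume]
    fun ξ => ∑ j, -Complex.I * ((ξ j / ‖ξ‖ : ℝ) : ℂ) * ft n (weakPartial j f) ξ := by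
  filter_upwards [Lp.coeFn_finsetSum Finset.univ fun j : Fin n =>
    (rieszMult j).op (ft n (weakPartial j f)),
    ae_all_iff.2 fun j : Fin n => (rieszMult j).coeFn_op (ft n (weakPartial j f))] with ξ h1 h2
  rw [gradFt, h1, Finset.sum_apply]
  simp only [h2]
  rfl

theorem weakDeriv_spec {κ : ℕ} {α : Fin κ → Fin n} {f : Rn n → ℝ}
    (h : ∃ d : L2 n, HasWeakDeriv α f d) : HasWeakDeriv α f (weakDeriv α f) := by
  obtain ⟨d, hd⟩ := h
  rwa [hd.weakDeriv_eq]

/-- A gradient is curl free: both sides come from the mixed second derivative of `f`. This replaces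
the formula for the transform of ∂_i f in terms of that of `f`, which is not available when `f` is
not in L². -/
theorem MemDerivs.coord_mul_ft_weakPartial {q : ℕ} (hq : 2 ≤ q) {f : Rn n → ℝ}
    (h : MemDerivs 1 q f) (i j : Fin n) :
    ∀ᵐ ξ : Rn n, (ξ j : ℂ) * ft n (weakPartial i f) ξ = (ξ i : ℂ) * ft n (weakPartial j f) ξ := by
  have h1 : ∀ i, HasWeakDeriv (fun _ : Fin 1 => i) f (weakPartial i f) := fun i =>
    weakDeriv_spec (h 1 le_rfl (by omega) _)
  obtain ⟨d, hd⟩ := h 2 (by norm_num) hq ![i, j]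
  have e1 := (hd.peel (κ := 1) (d' := weakPartial i f) (by
    convert h1 i using 1; ext k; fin_cases k; rfl)).ft_eq
  have e2 := (hd.swap.peel (κ := 1) (d' := weakPartial j f) (by
    convert h1 j using 1; ext k; fin_cases k; rfl)).ft_eq
  filter_upwards [e1, e2] with ξ h1 h2
  have h3 := h1.symm.trans h2
  simp only [show (Fin.last 1 : Fin 2) = 1 from rfl, Matrix.cons_val_one,
    Matrix.cons_val_zero] at h3
  have hne : (2 * Real.pi * Complex.I : ℂ) ≠ 0 := by
    simp [Real.pi_ne_zero, Complex.I_ne_zero]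
  exact mul_left_cancel₀ hne (by linear_combination h3)

/-- The Riesz sum `gradFt f` stands for 2π|ξ| times the transform of `f`. The curl-free relation
recovers each partial derivative from it, and higher orders follow by `HasSymbol.succ`. The quotient
by 2π|ξ| need not be in L². -/
theorem MemDerivs.hasSymbol_grad {q : ℕ} (hq : 2 ≤ q) {f : Rn n → ℝ} (h : MemDerivs 1 q f) :
    ∀ κ, κ + 1 ≤ q → HasSymbol (κ + 1) f (fun ξ => gradFt f ξ / (afun ξ : ℂ)) := by
  intro κ
  induction κ with
  | zero =>
    intro _ α
    refine ⟨weakDeriv α f, weakDeriv_spec (h 1 le_rfl (by omega) α), ?_⟩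
    have hα : α = fun _ : Fin 1 => α 0 := by ext k; fin_cases k; rfl
    -- The index α 0 shows that the dimension is positive, so the frequency ξ = 0, where the symbol
    -- divides by zero, is a null set.
    have hnt : Nontrivial (Rn n) := by
      refine ⟨EuclideanSpace.single (α 0) 1, 0, fun h => ?_⟩
      have := congrArg (fun x : Rn n => x (α 0)) h
      simp at this
    have h0 : ∀ᵐ ξ : Rn n, ξ ≠ 0 := by
      rw [ae_iff]; simp
    filter_upwards [h0, coeFn_gradFt f,
      ae_all_iff.2 fun j => h.coord_mul_ft_weakPartial hq (α 0) j] with ξ h0 h1 h2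
    have hw : weakDeriv α f = weakPartial (α 0) f := by rw [weakPartial, ← hα]
    rw [hw, h1, sym, Fin.prod_univ_succ]
    simp only [Finset.univ_eq_empty, Finset.prod_empty, mul_one]
    have hn : (‖ξ‖ : ℂ) ≠ 0 := by simpa using h0
    have hpi : (Real.pi : ℂ) ≠ 0 := by simp
    have e : ∑ j, -Complex.I * ((ξ j / ‖ξ‖ : ℝ) : ℂ) * ft n (weakPartial j f) ξ =
        -Complex.I / ‖ξ‖ * ∑ j, (ξ j : ℂ) * ft n (weakPartial j f) ξ := by
      rw [Finset.mul_sum]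
      refine Finset.sum_congr rfl fun j _ => ?_
      push_cast; field_simp
    have e2 : (ξ (α 0) : ℂ) * ∑ j, (ξ j : ℂ) * ft n (weakPartial j f) ξ =
        (‖ξ‖ : ℂ) ^ 2 * ft n (weakPartial (α 0) f) ξ := by
      have e3 : ((‖ξ‖ : ℂ)) ^ 2 = ∑ j, (ξ j : ℂ) ^ 2 := by
        have := congrArg (fun r : ℝ => (r : ℂ)) (sum_sq_coord ξ)
        push_cast at this
        exact this.symm
      rw [e3, Finset.mul_sum, Finset.sum_mul]
      refine Finset.sum_congr rfl fun j _ => ?_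
      rw [mul_left_comm, ← h2 j]; ring
    rw [e, afun]
    push_cast
    field_simp
    rw [mul_assoc, e2, Complex.I_sq]; ring
  | succ κ ih => exact fun hκ => (ih (by omega)).succ (h (κ + 2) (by omega) hκ)

/-! ### Weighted convolution estimates -/

/-- The `L²` norm of a function with values in `[0, ∞]`. -/
def nrm (f : Rn n → ℝ≥0∞) : ℝ≥0∞ := (∫⁻ ξ, f ξ ^ 2) ^ (1 / 2 : ℝ)

theorem rpow_half_sq (x : ℝ≥0∞) : (x ^ (1 / 2 : ℝ)) ^ 2 = x := by
  rw [← ENNReal.rpow_natCast, ← ENNReal.rpow_mul]; norm_num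

theorem sq_rpow_half (x : ℝ≥0∞) : (x ^ 2) ^ (1 / 2 : ℝ) = x := by
  rw [← ENNReal.rpow_natCast, ← ENNReal.rpow_mul]; norm_num

theorem nrm_sq (f : Rn n → ℝ≥0∞) : nrm f ^ 2 = ∫⁻ ξ, f ξ ^ 2 := rpow_half_sq _

theorem le_of_sq_le_sq {x y : ℝ≥0∞} (h : x ^ 2 ≤ y ^ 2) : x ≤ y := by
  rwa [ENNReal.pow_le_pow_left_iff two_ne_zero] at h

theorem nrm_mono_ae {f g : Rn n → ℝ≥0∞} (h : ∀ᵐ ξ, f ξ ≤ g ξ) : nrm f ≤ nrm g := by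
  refine ENNReal.rpow_le_rpow (lintegral_mono_ae ?_) (by norm_num)
  filter_upwards [h] with ξ hξ
  gcongr

theorem nrm_mono {f g : Rn n → ℝ≥0∞} (h : ∀ ξ, f ξ ≤ g ξ) : nrm f ≤ nrm g :=
  nrm_mono_ae (Filter.Eventually.of_forall h)

theorem nrm_add_le {f g : Rn n → ℝ≥0∞} (hf : Measurable f) (hg : Measurable g) :
    nrm (fun ξ => f ξ + g ξ) ≤ nrm f + nrm g := by
  have h := ENNReal.lintegral_Lp_add_le (μ := (volume : Measure (Rn n))) hf.aemeasurable
    hg.aemeasurable (p := 2) one_le_two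
  simpa [nrm] using h

theorem nrm_const_mul (c : ℝ≥0∞) {f : Rn n → ℝ≥0∞} (hf : Measurable f) :
    nrm (fun ξ => c * f ξ) = c * nrm f := by
  simp only [nrm, mul_pow]
  rw [lintegral_const_mul _ (by fun_prop), ENNReal.mul_rpow_of_nonneg _ _ (by norm_num),
    sq_rpow_half]

theorem lintegral_mul_le_nrm {f g : Rn n → ℝ≥0∞} (hf : AEMeasurable f) (hg : AEMeasurable g) :
    ∫⁻ ξ, f ξ * g ξ ≤ nrm f * nrm g := by
  have h := ENNReal.lintegral_mul_le_Lp_mul_Lq (volume : Measure (Rn n))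
    (Real.HolderConjugate.two_two) hf hg
  simpa [nrm] using h

/-- The convolution of two functions with values in `[0, ∞]`. -/
def conv (F G : Rn n → ℝ≥0∞) (ξ : Rn n) : ℝ≥0∞ := ∫⁻ η, F (ξ - η) * G η

theorem measurable_conv {F G : Rn n → ℝ≥0∞} (hF : Measurable F) (hG : Measurable G) :
    Measurable (conv F G) := by
  unfold conv
  refine Measurable.lintegral_prod_right' (f := fun q : Rn n × Rn n => F (q.1 - q.2) * G q.2) ?_
  fun_prop

theorem conv_comm (F G : Rn n → ℝ≥0∞) (ξ : Rn n) : conv F G ξ = conv G F ξ := by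
  unfold conv
  rw [← lintegral_sub_left_eq_self (μ := (volume : Measure (Rn n)))
    (fun η => F (ξ - η) * G η) ξ]
  simp only [sub_sub_cancel, mul_comm]

theorem lintegral_conv {F G : Rn n → ℝ≥0∞} (hF : Measurable F) (hG : Measurable G) :
    ∫⁻ ξ, conv F G ξ = (∫⁻ ξ, F ξ) * ∫⁻ ξ, G ξ := by
  unfold conv
  rw [lintegral_lintegral_swap (by fun_prop)]
  have h : ∀ η, ∫⁻ ξ, F (ξ - η) * G η = (∫⁻ ξ, F ξ) * G η := fun η => by
    rw [lintegral_mul_const _ (by fun_prop), lintegral_sub_right_eq_self (fun x => F x) η]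
  simp only [h]
  rw [lintegral_const_mul _ hG]

/-- Cauchy-Schwarz in the convolution integral after inserting the weights and their inverses. -/
theorem conv_sq_le {F G a b : Rn n → ℝ≥0∞} (hF : Measurable F) (hG : Measurable G)
    (ha : Measurable a) (hb : Measurable b) (ha0 : ∀ᵐ ξ, a ξ ≠ 0) (hat : ∀ ξ, a ξ ≠ ⊤)
    (hb0 : ∀ᵐ ξ, b ξ ≠ 0) (hbt : ∀ ξ, b ξ ≠ ⊤) (ξ : Rn n) :
    conv F G ξ ^ 2 ≤ conv (fun η => (a η ^ 2)⁻¹) (fun η => (b η ^ 2)⁻¹) ξ *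
      conv (fun η => (a η * F η) ^ 2) (fun η => (b η * G η) ^ 2) ξ := by
  have h1 : conv F G ξ ≤ nrm (fun η => (a (ξ - η))⁻¹ * (b η)⁻¹) *
      nrm (fun η => (a (ξ - η) * F (ξ - η)) * (b η * G η)) := by
    refine le_trans (le_of_eq ?_) (lintegral_mul_le_nrm (by fun_prop) (by fun_prop))
    refine lintegral_congr_ae ?_
    filter_upwards [hb0, (measurePreserving_const_sub ξ).quasiMeasurePreserving.ae ha0]
      with η h1 h2
    calc F (ξ - η) * G η = ((a (ξ - η))⁻¹ * a (ξ - η)) * ((b η)⁻¹ * b η) * (F (ξ - η) * G η) := by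
          rw [ENNReal.inv_mul_cancel h1 (hbt _), ENNReal.inv_mul_cancel h2 (hat _)]; simp
      _ = _ := by ring
  calc conv F G ξ ^ 2 ≤ _ := pow_le_pow_left' h1 2
    _ = _ := by
      rw [mul_pow, nrm_sq, nrm_sq]
      simp only [conv, mul_pow, ENNReal.inv_pow]

/-- After `conv_sq_le` the kernel factor is bounded uniformly in ξ, and the integral of the
remaining convolution is the product of the two integrals. A bilinear L² bound is thus reduced to a
pointwise bound on the convolution of the inverse squared weights. -/
theorem nrm_mul_conv_le {F G a b c : Rn n → ℝ≥0∞} {Q : ℝ≥0∞} (hF : Measurable F)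
    (hG : Measurable G) (ha : Measurable a) (hb : Measurable b) (ha0 : ∀ᵐ ξ, a ξ ≠ 0)
    (hat : ∀ ξ, a ξ ≠ ⊤) (hb0 : ∀ᵐ ξ, b ξ ≠ 0) (hbt : ∀ ξ, b ξ ≠ ⊤)
    (hQ : ∀ ξ, c ξ ^ 2 * conv (fun η => (a η ^ 2)⁻¹) (fun η => (b η ^ 2)⁻¹) ξ ≤ Q ^ 2) :
    nrm (fun ξ => c ξ * conv F G ξ) ≤
      Q * (nrm (fun ξ => a ξ * F ξ) * nrm fun ξ => b ξ * G ξ) := by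
  refine le_of_sq_le_sq ?_
  rw [mul_pow, mul_pow, nrm_sq, nrm_sq, nrm_sq,
    ← lintegral_conv (by fun_prop) (by fun_prop), ← lintegral_const_mul _
      (measurable_conv (by fun_prop) (by fun_prop))]
  refine lintegral_mono fun ξ => ?_
  rw [mul_pow]
  calc c ξ ^ 2 * conv F G ξ ^ 2 ≤ c ξ ^ 2 *
        (conv (fun η => (a η ^ 2)⁻¹) (fun η => (b η ^ 2)⁻¹) ξ *
          conv (fun η => (a η * F η) ^ 2) (fun η => (b η * G η) ^ 2) ξ) := by
        gcongr; exact conv_sq_le hF hG ha hb ha0 hat hb0 hbt ξ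
    _ ≤ _ := by rw [← mul_assoc]; gcongr; exact hQ ξ

/-- By Tonelli the trilinear form pairs `K` with the convolution of the reflected `F` and `G`. This
leaves `K` unweighted and puts the weights on the other two factors. -/
theorem lintegral_conv_mul_le {F K G a b : Rn n → ℝ≥0∞} {Q : ℝ≥0∞} (hF : Measurable F)
    (hK : Measurable K) (hG : Measurable G) (ha : Measurable a) (hb : Measurable b)
    (ha0 : ∀ᵐ ξ, a ξ ≠ 0) (hat : ∀ ξ, a ξ ≠ ⊤) (hb0 : ∀ᵐ ξ, b ξ ≠ 0) (hbt : ∀ ξ, b ξ ≠ ⊤)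
    (heven : ∀ ξ, a (-ξ) = a ξ)
    (hQ : ∀ ξ, conv (fun η => (a η ^ 2)⁻¹) (fun η => (b η ^ 2)⁻¹) ξ ≤ Q ^ 2) :
    ∫⁻ ξ, conv F K ξ * G ξ ≤
      Q * (nrm (fun ξ => a ξ * F ξ) * nrm fun ξ => b ξ * G ξ) * nrm K := by
  have h1 : ∫⁻ ξ, conv F K ξ * G ξ = ∫⁻ η, conv (fun x => F (-x)) G η * K η := by
    have e1 : ∀ ξ, conv F K ξ * G ξ = ∫⁻ η, F (ξ - η) * K η * G ξ := fun ξ => by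
      rw [conv, lintegral_mul_const _ (by fun_prop)]
    have e2 : ∀ η, conv (fun x => F (-x)) G η * K η = ∫⁻ ξ, F (ξ - η) * K η * G ξ := fun η => by
      rw [conv, ← lintegral_mul_const _ (by fun_prop)]
      simp only [neg_sub]
      refine lintegral_congr fun ξ => ?_
      ring
    simp only [e1, e2]
    rw [lintegral_lintegral_swap (by fun_prop)]
  rw [h1]
  have hF' : Measurable fun x => F (-x) := by fun_prop
  refine (lintegral_mul_le_nrm (measurable_conv hF' hG).aemeasurable hK.aemeasurable).trans ?_
  gcongr
  have h2 := nrm_mul_conv_le (c := fun _ => 1) hF' hG ha hb ha0 hat hb0 hbt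
    (by simpa using hQ)
  simp only [one_mul] at h2
  refine h2.trans (le_of_eq ?_)
  congr 2
  simp only [nrm]
  congr 1
  have h4 := lintegral_neg_eq_self (μ := (volume : Measure (Rn n))) (fun x => (a x * F x) ^ 2)
  rw [← h4]
  simp only [heven]

/-- The weight `1 + 2π|ξ|`. -/
def eJ (ξ : Rn n) : ℝ≥0∞ := 1 + eA ξ

@[fun_prop]
theorem measurable_eJ : Measurable (eJ : Rn n → ℝ≥0∞) := by unfold eJ; fun_prop

theorem one_le_eJ (ξ : Rn n) : 1 ≤ eJ ξ := le_self_add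

theorem eJ_ne_zero (ξ : Rn n) : eJ ξ ≠ 0 := (one_pos.trans_le (one_le_eJ ξ)).ne'

theorem eJ_ne_top (ξ : Rn n) : eJ ξ ≠ ⊤ := by simp [eJ, eA_ne_top]

theorem eA_neg (ξ : Rn n) : eA (-ξ) = eA ξ := by simp [eA, afun]

theorem eJ_neg (ξ : Rn n) : eJ (-ξ) = eJ ξ := by simp [eJ, eA_neg]

theorem ae_eA_ne_zero (hn : 3 ≤ n) : ∀ᵐ ξ : Rn n, eA ξ ≠ 0 := by
  have hnt : Nontrivial (Rn n) := by
    refine ⟨EuclideanSpace.single ⟨0, by omega⟩ 1, 0, fun h => ?_⟩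
    have := congrArg (fun x : Rn n => x ⟨0, by omega⟩) h
    simp at this
  have h0 : ∀ᵐ ξ : Rn n, ξ ≠ 0 := by
    rw [ae_iff]; simp
  filter_upwards [h0] with ξ hξ
  have : 0 < afun ξ := by
    have := norm_pos_iff.2 hξ
    have := Real.pi_pos
    unfold afun; positivity
  simpa [eA] using this

theorem eJ_le_add (ξ η : Rn n) : eJ ξ ≤ eJ (ξ - η) + eJ η := by
  have h : eA ξ ≤ eA (ξ - η) + eA η := by
    rw [eA, eA, eA, ← ENNReal.ofReal_add (afun_nonneg _) (afun_nonneg _)]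
    refine ENNReal.ofReal_le_ofReal ?_
    unfold afun
    have h1 := norm_add_le (ξ - η) η
    rw [sub_add_cancel] at h1
    rw [← mul_add]
    exact mul_le_mul_of_nonneg_left h1 (by positivity)
  calc eJ ξ ≤ 1 + (eA (ξ - η) + eA η) := by unfold eJ; gcongr
    _ ≤ 1 + (eA (ξ - η) + eA η) + 1 := le_self_add
    _ = _ := by unfold eJ; ring

theorem add_pow_le_two_pow_mul (x y : ℝ≥0∞) (p : ℕ) : (x + y) ^ p ≤ 2 ^ p * (x ^ p + y ^ p) := by
  rcases le_total x y with h | h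
  · calc (x + y) ^ p ≤ (y + y) ^ p := by gcongr
      _ = 2 ^ p * y ^ p := by rw [← two_mul, mul_pow]
      _ ≤ _ := by gcongr; exact le_add_self
  · calc (x + y) ^ p ≤ (x + x) ^ p := by gcongr
      _ = 2 ^ p * x ^ p := by rw [← two_mul, mul_pow]
      _ ≤ _ := by gcongr; exact le_self_add

theorem lintegral_inv_eJ_lt_top {s : ℕ} (hs : n < 2 * s) :
    ∫⁻ ξ : Rn n, (eJ ξ ^ (2 * s))⁻¹ < ⊤ := by
  have h := finite_integral_one_add_norm (E := Rn n) (μ := volume) (r := ((2 * s : ℕ) : ℝ))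
    (by rw [finrank_euclideanSpace_fin]; exact_mod_cast hs)
  refine lt_of_le_of_lt (lintegral_mono fun ξ => ?_) h
  rw [Real.rpow_neg (by positivity), Real.rpow_natCast,
    ENNReal.ofReal_inv_of_pos (by positivity), ENNReal.ofReal_pow (by positivity)]
  refine ENNReal.inv_le_inv.2 (pow_le_pow_left' ?_ _)
  rw [eJ, ENNReal.ofReal_add zero_le_one (norm_nonneg _), ENNReal.ofReal_one, eA]
  gcongr
  unfold afun
  have := Real.two_le_pi
  nlinarith [norm_nonneg ξ]

/-- In polar coordinates the radial density is r^{n-1} r^{-2} = r^{n-3}, which is bounded near 0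
exactly because n ≥ 3. -/
theorem setLIntegral_inv_eA_lt_top (hn : 3 ≤ n) :
    ∫⁻ ξ in Metric.ball (0 : Rn n) 1, (eA ξ ^ 2)⁻¹ < ⊤ := by
  have hnt : Nontrivial (Rn n) := by
    refine ⟨EuclideanSpace.single ⟨0, by omega⟩ 1, 0, fun h => ?_⟩
    have := congrArg (fun x : Rn n => x ⟨0, by omega⟩) h
    simp at this
  have h1 : IntegrableOn (fun ξ : Rn n => (‖ξ‖ ^ 2)⁻¹) (Metric.ball 0 1) := by
    rw [integrableOn_fun_norm_addHaar volume (f := fun y : ℝ => (y ^ 2)⁻¹),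
      finrank_euclideanSpace_fin]
    refine IntegrableOn.congr_fun (f := fun y : ℝ => y ^ (n - 3)) ?_ (fun y hy => ?_)
      measurableSet_Ioo
    · exact ((continuous_pow (n - 3)).integrableOn_Icc (a := 0) (b := 1)).mono_set
        Ioo_subset_Icc_self
    · have hy0 : y ≠ 0 := hy.1.ne'
      obtain ⟨q, rfl⟩ : ∃ q, n = q + 3 := ⟨n - 3, by omega⟩
      simp only [Nat.add_sub_cancel, smul_eq_mul, show q + 3 - 1 = q + 2 by omega]
      field_simp
      ring
  have h2 := h1.2
  rw [hasFiniteIntegral_iff_enorm] at h2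
  refine lt_of_le_of_lt (setLIntegral_mono_ae (by fun_prop) ?_) h2
  filter_upwards [ae_eA_ne_zero hn] with ξ h0 _
  have hpos : 0 < ‖ξ‖ := by
    by_contra hcon
    have : ‖ξ‖ = 0 := le_antisymm (not_lt.1 hcon) (norm_nonneg _)
    exact h0 (by simp [eA, afun, this])
  rw [← ofReal_norm, Real.norm_of_nonneg (by positivity), ENNReal.ofReal_inv_of_pos (by positivity),
    ENNReal.ofReal_pow (norm_nonneg _)]
  refine ENNReal.inv_le_inv.2 (pow_le_pow_left' (ENNReal.ofReal_le_ofReal ?_) _)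
  unfold afun
  have := Real.two_le_pi
  nlinarith [norm_nonneg ξ]

theorem inv_eA_sq_le (ξ : Rn n) :
    (eA ξ ^ 2)⁻¹ ≤ (Metric.ball (0 : Rn n) 1).indicator (fun ξ => (eA ξ ^ 2)⁻¹) ξ + 1 := by
  by_cases h : ξ ∈ Metric.ball (0 : Rn n) 1
  · rw [indicator_of_mem h]; exact le_self_add
  · rw [indicator_of_notMem h, zero_add, ENNReal.inv_le_one]
    refine one_le_pow_of_one_le' ?_ _
    rw [eA, ENNReal.one_le_ofReal, afun]
    have : 1 ≤ ‖ξ‖ := by simpa using h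
    have := Real.two_le_pi
    nlinarith

/-- The constant bounding the convolution kernels. -/
def kernelConst (n s : ℕ) : ℝ≥0∞ :=
  (∫⁻ ξ in Metric.ball (0 : Rn n) 1, (eA ξ ^ 2)⁻¹) + ∫⁻ ξ : Rn n, (eJ ξ ^ (2 * s))⁻¹

theorem kernelConst_lt_top {s : ℕ} (hn : 3 ≤ n) (hs : n < 2 * s) : kernelConst n s < ⊤ :=
  ENNReal.add_lt_top.2 ⟨setLIntegral_inv_eA_lt_top hn, lintegral_inv_eJ_lt_top hs⟩

/-- The singular factor is integrable on the unit ball, where the other factor is at most 1. Off the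
ball the singular factor is at most 1 and the other factor is integrated. -/
theorem conv_inv_eA_inv_eJ_le (s : ℕ) (ξ : Rn n) :
    conv (fun η => (eA η ^ 2)⁻¹) (fun η => (eJ η ^ (2 * s))⁻¹) ξ ≤ kernelConst n s := by
  have hm : Measurable ((Metric.ball (0 : Rn n) 1).indicator fun ξ => (eA ξ ^ 2)⁻¹) :=
    Measurable.indicator (by fun_prop) measurableSet_ball
  calc conv (fun η => (eA η ^ 2)⁻¹) (fun η => (eJ η ^ (2 * s))⁻¹) ξ
      ≤ ∫⁻ η, ((Metric.ball (0 : Rn n) 1).indicator (fun ξ => (eA ξ ^ 2)⁻¹) (ξ - η) +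
          (eJ η ^ (2 * s))⁻¹) := by
        refine lintegral_mono fun η => ?_
        have h1 : (eJ η ^ (2 * s))⁻¹ ≤ 1 :=
          ENNReal.inv_le_one.2 (one_le_pow_of_one_le' (one_le_eJ η) _)
        calc (eA (ξ - η) ^ 2)⁻¹ * (eJ η ^ (2 * s))⁻¹ ≤
            ((Metric.ball (0 : Rn n) 1).indicator (fun ξ => (eA ξ ^ 2)⁻¹) (ξ - η) + 1) *
              (eJ η ^ (2 * s))⁻¹ := by gcongr; exact inv_eA_sq_le _
          _ ≤ _ := by
            rw [add_mul, one_mul]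
            gcongr
            exact mul_le_of_le_one_right' h1
    _ = _ := by
        rw [lintegral_add_left (by fun_prop), lintegral_sub_left_eq_self, kernelConst,
          lintegral_indicator measurableSet_ball]

theorem lintegral_inv_eJ_le (s : ℕ) : ∫⁻ ξ : Rn n, (eJ ξ ^ (2 * s))⁻¹ ≤ kernelConst n s :=
  le_add_self

theorem lintegral_inv_eA_mul_inv_eJ_le (s : ℕ) :
    ∫⁻ ξ : Rn n, (eA ξ ^ 2)⁻¹ * (eJ ξ ^ (2 * s))⁻¹ ≤ kernelConst n s := by
  have h := conv_inv_eA_inv_eJ_le s (0 : Rn n)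
  simpa [conv, eA_neg] using h

theorem eJ_sq_mul_inv_eA_le (ξ : Rn n) : eJ ξ ^ 2 * (eA ξ ^ 2)⁻¹ ≤ 4 * ((eA ξ ^ 2)⁻¹ + 1) := by
  calc eJ ξ ^ 2 * (eA ξ ^ 2)⁻¹ ≤ 2 ^ 2 * (1 ^ 2 + eA ξ ^ 2) * (eA ξ ^ 2)⁻¹ := by
        gcongr; exact add_pow_le_two_pow_mul 1 (eA ξ) 2
    _ = 4 * ((eA ξ ^ 2)⁻¹ + eA ξ ^ 2 * (eA ξ ^ 2)⁻¹) := by ring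
    _ ≤ _ := by gcongr; exact ENNReal.mul_inv_le_one _

/-- The homogeneous weight |ξ|(1 + |ξ|)^k is as good as (1 + |ξ|)^{k+1} except for the singularity
|ξ|^{-2} at low frequency. -/
theorem inv_weight_le (k : ℕ) (ξ : Rn n) :
    ((eA ξ * eJ ξ ^ k) ^ 2)⁻¹ ≤ 4 * ((eA ξ ^ 2)⁻¹ + 1) * (eJ ξ ^ (2 * (k + 1)))⁻¹ := by
  have e : ((eA ξ * eJ ξ ^ k) ^ 2)⁻¹ =
      eJ ξ ^ 2 * (eA ξ ^ 2)⁻¹ * (eJ ξ ^ (2 * (k + 1)))⁻¹ := by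
    have hJ0 : ∀ p, eJ ξ ^ p ≠ 0 := fun p => pow_ne_zero _ (eJ_ne_zero ξ)
    have hJt : ∀ p, eJ ξ ^ p ≠ ⊤ := fun p => ENNReal.pow_ne_top (eJ_ne_top ξ)
    have e1 : eJ ξ ^ (2 * (k + 1)) = eJ ξ ^ 2 * (eJ ξ ^ k) ^ 2 := by ring
    rw [mul_pow, e1, ENNReal.mul_inv (Or.inr (by rw [← pow_mul]; exact hJt _))
      (Or.inr (by rw [← pow_mul]; exact hJ0 _)), ENNReal.mul_inv (Or.inl (hJ0 _)) (Or.inl (hJt _))]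
    calc (eA ξ ^ 2)⁻¹ * ((eJ ξ ^ k) ^ 2)⁻¹ =
          (eJ ξ ^ 2 * (eJ ξ ^ 2)⁻¹) * ((eA ξ ^ 2)⁻¹ * ((eJ ξ ^ k) ^ 2)⁻¹) := by
          rw [ENNReal.mul_inv_cancel (hJ0 _) (hJt _), one_mul]
      _ = _ := by ring
  rw [e]
  exact mul_le_mul' (eJ_sq_mul_inv_eA_le ξ) le_rfl

/-- The outer weight is split between ξ - η and η by the triangle inequality, and each share cancels
the inverse weight of one factor. What remains are the convolution and integrals bounded by
`kernelConst`. -/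
theorem eJ_pow_mul_conv_le (k : ℕ) (ξ : Rn n) :
    (eJ ξ ^ (k + 1)) ^ 2 * conv (fun η => ((eA η * eJ η ^ k) ^ 2)⁻¹)
      (fun η => ((eJ η ^ (k + 1)) ^ 2)⁻¹) ξ ≤ 2 ^ (2 * (k + 1)) * 16 * kernelConst n (k + 1) := by
  set s := k + 1 with hs
  have e0 : ∀ η : Rn n, (eJ η ^ s) ^ 2 = eJ η ^ (2 * s) := fun η => by ring
  simp only [e0]
  have hJ0 : ∀ (η : Rn n) p, eJ η ^ p ≠ 0 := fun η p => pow_ne_zero _ (eJ_ne_zero η)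
  have hJt : ∀ (η : Rn n) p, eJ η ^ p ≠ ⊤ := fun η p => ENNReal.pow_ne_top (eJ_ne_top η)
  have hpt : ∀ η, eJ ξ ^ (2 * s) * (((eA (ξ - η) * eJ (ξ - η) ^ k) ^ 2)⁻¹ *
      (eJ η ^ (2 * s))⁻¹) ≤ 2 ^ (2 * s) * 4 *
        (((eA (ξ - η) ^ 2)⁻¹ * (eJ η ^ (2 * s))⁻¹ + (eJ η ^ (2 * s))⁻¹) +
        ((eA (ξ - η) ^ 2)⁻¹ * (eJ (ξ - η) ^ (2 * s))⁻¹ + (eJ (ξ - η) ^ (2 * s))⁻¹)) := fun η => by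
    calc eJ ξ ^ (2 * s) * (((eA (ξ - η) * eJ (ξ - η) ^ k) ^ 2)⁻¹ * (eJ η ^ (2 * s))⁻¹)
        ≤ (2 ^ (2 * s) * (eJ (ξ - η) ^ (2 * s) + eJ η ^ (2 * s))) *
          ((4 * ((eA (ξ - η) ^ 2)⁻¹ + 1) * (eJ (ξ - η) ^ (2 * s))⁻¹) * (eJ η ^ (2 * s))⁻¹) := by
          gcongr
          · exact (pow_le_pow_left' (eJ_le_add ξ η) _).trans (add_pow_le_two_pow_mul _ _ _)
          · exact inv_weight_le k _
      _ = 2 ^ (2 * s) * 4 * ((eA (ξ - η) ^ 2)⁻¹ + 1) *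
          ((eJ (ξ - η) ^ (2 * s) * (eJ (ξ - η) ^ (2 * s))⁻¹) * (eJ η ^ (2 * s))⁻¹ +
            (eJ η ^ (2 * s) * (eJ η ^ (2 * s))⁻¹) * (eJ (ξ - η) ^ (2 * s))⁻¹) := by ring
      _ = _ := by
          rw [ENNReal.mul_inv_cancel (hJ0 _ _) (hJt _ _), ENNReal.mul_inv_cancel (hJ0 _ _) (hJt _ _)]
          ring
  rw [conv, ← lintegral_const_mul _ (by fun_prop)]
  refine (lintegral_mono hpt).trans ?_
  rw [lintegral_const_mul _ (by fun_prop), lintegral_add_left (by fun_prop),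
    lintegral_add_left (by fun_prop), lintegral_add_left (by fun_prop)]
  have h1 := conv_inv_eA_inv_eJ_le s ξ
  have h2 := lintegral_inv_eJ_le (n := n) s
  have h3 : ∫⁻ η, (eA (ξ - η) ^ 2)⁻¹ * (eJ (ξ - η) ^ (2 * s))⁻¹ ≤ kernelConst n s := by
    rw [lintegral_sub_left_eq_self (fun x : Rn n => (eA x ^ 2)⁻¹ * (eJ x ^ (2 * s))⁻¹) ξ]
    exact lintegral_inv_eA_mul_inv_eJ_le s
  have h4 : ∫⁻ η, (eJ (ξ - η) ^ (2 * s))⁻¹ ≤ kernelConst n s := by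
    rw [lintegral_sub_left_eq_self (fun x : Rn n => (eJ x ^ (2 * s))⁻¹) ξ]
    exact h2
  unfold conv at h1
  calc _ ≤ 2 ^ (2 * s) * 4 * ((kernelConst n s + kernelConst n s) +
        (kernelConst n s + kernelConst n s)) := by gcongr
    _ = _ := by ring

/-- The weight `∑_{κ ≤ k} (2π|ξ|)^{2κ}`. -/
def eS (k : ℕ) (ξ : Rn n) : ℝ≥0∞ := ∑ κ ∈ Finset.range (k + 1), eA ξ ^ (2 * κ)

@[fun_prop]
theorem measurable_eS (k : ℕ) : Measurable (eS k : Rn n → ℝ≥0∞) := by unfold eS; fun_prop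

theorem eA_le_eJ (ξ : Rn n) : eA ξ ≤ eJ ξ := le_add_self

theorem eS_le (k : ℕ) (ξ : Rn n) : eS k ξ ≤ (k + 1) * (eJ ξ ^ k * eJ ξ ^ k) := by
  have h : ∀ κ ∈ Finset.range (k + 1), eA ξ ^ (2 * κ) ≤ eJ ξ ^ k * eJ ξ ^ k := fun κ hκ => by
    rw [Finset.mem_range] at hκ
    calc eA ξ ^ (2 * κ) ≤ eJ ξ ^ (2 * κ) := pow_le_pow_left' (eA_le_eJ ξ) _
      _ ≤ eJ ξ ^ (k + k) := pow_le_pow_right₀ (one_le_eJ ξ) (by omega)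
      _ = _ := pow_add _ _ _
  refine (Finset.sum_le_sum h).trans ?_
  simp

/-- This separates the term of order zero, so that all others carry a derivative on each of two
factors. -/
theorem eS_le_one_add (k : ℕ) (ξ : Rn n) : eS k ξ ≤ 1 + eA ξ ^ 2 * eS k ξ := by
  unfold eS
  conv_lhs => rw [Finset.sum_range_succ']
  rw [add_comm]
  refine add_le_add (by simp) ?_
  rw [Finset.mul_sum, Finset.sum_range_succ]
  refine le_trans (le_of_eq ?_) le_self_add
  refine Finset.sum_congr rfl fun κ _ => ?_
  ring

theorem eJ_pow_le_eS (k : ℕ) (ξ : Rn n) : (eJ ξ ^ k) ^ 2 ≤ 2 ^ (2 * k + 1) * eS k ξ := by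
  have h1 : eA ξ ^ (2 * k) ≤ eS k ξ :=
    Finset.single_le_sum (f := fun κ => eA ξ ^ (2 * κ)) (fun _ _ => zero_le)
      (Finset.mem_range.2 (Nat.lt_succ_self k))
  have h2 : 1 ≤ eS k ξ := by
    have := Finset.single_le_sum (f := fun κ => eA ξ ^ (2 * κ)) (s := Finset.range (k + 1))
      (fun _ _ => zero_le) (Finset.mem_range.2 (Nat.succ_pos k))
    simpa [eS] using this
  calc (eJ ξ ^ k) ^ 2 = (1 + eA ξ) ^ (2 * k) := by unfold eJ; ring
    _ ≤ 2 ^ (2 * k) * (1 ^ (2 * k) + eA ξ ^ (2 * k)) := add_pow_le_two_pow_mul _ _ _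
    _ ≤ 2 ^ (2 * k) * (eS k ξ + eS k ξ) := by rw [one_pow]; gcongr
    _ = _ := by ring

/-- The constant in the product estimates. -/
def prodConst (n k : ℕ) : ℝ≥0∞ := (2 ^ (2 * (k + 1)) * 16 * kernelConst n (k + 1)) ^ (1 / 2 : ℝ)

theorem prodConst_lt_top {k : ℕ} (hn : 3 ≤ n) (hk : n < 2 * (k + 1)) : prodConst n k < ⊤ := by
  refine ENNReal.rpow_lt_top_of_nonneg (by norm_num) (ENNReal.mul_ne_top ?_
    (kernelConst_lt_top hn hk).ne)
  exact ENNReal.mul_ne_top (ENNReal.pow_ne_top (by norm_num)) (by norm_num)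

/-- An H^{k+1} product estimate in which the first factor is measured by its gradient only. This is
the form needed for v, of which only the gradient is dissipated. -/
theorem nrm_eJ_conv_le (hn : 3 ≤ n) (k : ℕ) {F G : Rn n → ℝ≥0∞} (hF : Measurable F)
    (hG : Measurable G) :
    nrm (fun ξ => eJ ξ ^ (k + 1) * conv F G ξ) ≤ prodConst n k *
      (nrm (fun ξ => eA ξ * eJ ξ ^ k * F ξ) * nrm fun ξ => eJ ξ ^ (k + 1) * G ξ) := by
  refine nrm_mul_conv_le (a := fun ξ => eA ξ * eJ ξ ^ k) (b := fun ξ => eJ ξ ^ (k + 1)) hF hG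
    (by fun_prop) (by fun_prop) ?_ (fun ξ => ?_) ?_ (fun ξ => ?_) (fun ξ => ?_)
  · filter_upwards [ae_eA_ne_zero hn] with ξ hξ
    exact mul_ne_zero hξ (pow_ne_zero _ (eJ_ne_zero ξ))
  · exact ENNReal.mul_ne_top (eA_ne_top ξ) (ENNReal.pow_ne_top (eJ_ne_top ξ))
  · exact Filter.Eventually.of_forall fun ξ => pow_ne_zero _ (eJ_ne_zero ξ)
  · exact ENNReal.pow_ne_top (eJ_ne_top ξ)
  · rw [prodConst, rpow_half_sq]
    exact eJ_pow_mul_conv_le k ξ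

theorem kernelConst_le_prodConst_sq (k : ℕ) : kernelConst n (k + 1) ≤ prodConst n k ^ 2 := by
  rw [prodConst, rpow_half_sq]
  refine le_mul_of_one_le_left' ?_
  exact one_le_mul (one_le_pow_of_one_le' (by norm_num) _) (by norm_num)

/-- The trilinear bound for the low-frequency part of the test with y: one factor enters through its
gradient, one in L² and one in H^{k+1}. The next lemma exchanges the roles of the first and last
factors. -/
theorem lintegral_conv_mul_eA_le (hn : 3 ≤ n) (k : ℕ) {F K G : Rn n → ℝ≥0∞} (hF : Measurable F)
    (hK : Measurable K) (hG : Measurable G) :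
    ∫⁻ ξ, conv F K ξ * G ξ ≤ prodConst n k *
      (nrm (fun ξ => eA ξ * F ξ) * nrm fun ξ => eJ ξ ^ (k + 1) * G ξ) * nrm K := by
  refine lintegral_conv_mul_le (a := eA) (b := fun ξ => eJ ξ ^ (k + 1)) hF hK hG
    (by fun_prop) (by fun_prop) (ae_eA_ne_zero hn) eA_ne_top ?_ (fun ξ => ?_) eA_neg (fun ξ => ?_)
  · exact Filter.Eventually.of_forall fun ξ => pow_ne_zero _ (eJ_ne_zero ξ)
  · exact ENNReal.pow_ne_top (eJ_ne_top ξ)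
  · refine le_trans (le_of_eq ?_) ((conv_inv_eA_inv_eJ_le (k + 1) ξ).trans
      (kernelConst_le_prodConst_sq k))
    congr 1; ext η; congr 1; ring

theorem lintegral_conv_mul_eJ_le (hn : 3 ≤ n) (k : ℕ) {F K G : Rn n → ℝ≥0∞} (hF : Measurable F)
    (hK : Measurable K) (hG : Measurable G) :
    ∫⁻ ξ, conv F K ξ * G ξ ≤ prodConst n k *
      (nrm (fun ξ => eJ ξ ^ (k + 1) * F ξ) * nrm fun ξ => eA ξ * G ξ) * nrm K := by
  refine lintegral_conv_mul_le (a := fun ξ => eJ ξ ^ (k + 1)) (b := eA) hF hK hG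
    (by fun_prop) (by fun_prop) ?_ (fun ξ => ?_) (ae_eA_ne_zero hn) eA_ne_top
    (fun ξ => by simp only [eJ_neg]) (fun ξ => ?_)
  · exact Filter.Eventually.of_forall fun ξ => pow_ne_zero _ (eJ_ne_zero ξ)
  · exact ENNReal.pow_ne_top (eJ_ne_top ξ)
  · rw [conv_comm]
    refine le_trans (le_of_eq ?_) ((conv_inv_eA_inv_eJ_le (k + 1) ξ).trans
      (kernelConst_le_prodConst_sq k))
    congr 1; ext η; congr 1; ring

theorem nrm_eJ_succ_le (k : ℕ) {f : Rn n → ℝ≥0∞} (hf : Measurable f) :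
    nrm (fun ξ => eJ ξ ^ (k + 1) * f ξ) ≤
      nrm (fun ξ => eJ ξ ^ k * f ξ) + nrm fun ξ => eJ ξ ^ k * (eA ξ * f ξ) := by
  refine le_trans (le_of_eq ?_) (nrm_add_le (by fun_prop) (by fun_prop))
  congr 1; ext ξ
  rw [pow_succ]
  conv_lhs => enter [1, 2]; unfold eJ
  ring

theorem nrm_le_nrm_eJ (k : ℕ) (f : Rn n → ℝ≥0∞) : nrm f ≤ nrm fun ξ => eJ ξ ^ k * f ξ :=
  nrm_mono fun ξ => le_mul_of_one_le_left' (one_le_pow_of_one_le' (one_le_eJ ξ) k)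

/-! ### Estimate of the nonlinear term -/

/-- The quantities controlled by the energy (by `e`) and by the dissipation (by `d`). -/
structure FreqBounds (k : ℕ) (v w q y : Rn n → ℝ≥0∞) (e d : ℝ≥0∞) : Prop where
  q_le : nrm (fun ξ => eJ ξ ^ k * q ξ) ≤ e
  y_le : nrm (fun ξ => eJ ξ ^ k * y ξ) ≤ e
  v_le : nrm (fun ξ => eJ ξ ^ k * (eA ξ * v ξ)) ≤ e
  w_le : nrm (fun ξ => eJ ξ ^ k * w ξ) ≤ e
  q_le' : nrm (fun ξ => eJ ξ ^ k * (eA ξ * q ξ)) ≤ e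
  y_le' : nrm (fun ξ => eJ ξ ^ k * (eA ξ * y ξ)) ≤ e
  v_le' : nrm (fun ξ => eJ ξ ^ k * (eA ξ * (eA ξ * v ξ))) ≤ e
  v_diss : nrm (fun ξ => eJ ξ ^ k * (eA ξ * v ξ)) ≤ d
  q_diss : nrm (fun ξ => eJ ξ ^ k * (eA ξ * q ξ)) ≤ d
  y_diss : nrm (fun ξ => eJ ξ ^ k * (eA ξ * y ξ)) ≤ d
  v_diss' : nrm (fun ξ => eJ ξ ^ k * (eA ξ * (eA ξ * v ξ))) ≤ d
  w_diss : nrm (fun ξ => eJ ξ ^ k * w ξ) ≤ d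

section Nonlinear

variable {k : ℕ} {p v w q y N : Rn n → ℝ≥0∞} {e d c : ℝ≥0∞}

/-- The order k + 1 of w is not listed among the energy bounds; it is recovered from w = (y - v)/τ.
-/
theorem FreqBounds.nrm_w_le (h : FreqBounds k v w q y e d) (hv : Measurable v) (hw : Measurable w)
    (hy : Measurable y) (hwy : ∀ᵐ ξ, w ξ ≤ c * (y ξ + v ξ)) :
    nrm (fun ξ => eJ ξ ^ (k + 1) * w ξ) ≤ (2 + 2 * c) * e := by
  have h1 : nrm (fun ξ => eJ ξ ^ k * (eA ξ * w ξ)) ≤ c * (e + e) := by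
    calc nrm (fun ξ => eJ ξ ^ k * (eA ξ * w ξ))
        ≤ nrm (fun ξ => c * (eJ ξ ^ k * (eA ξ * y ξ) + eJ ξ ^ k * (eA ξ * v ξ))) := by
          refine nrm_mono_ae ?_
          filter_upwards [hwy] with ξ hξ
          calc eJ ξ ^ k * (eA ξ * w ξ) ≤ eJ ξ ^ k * (eA ξ * (c * (y ξ + v ξ))) := by gcongr
            _ = _ := by ring
      _ ≤ _ := by
          rw [nrm_const_mul _ (by fun_prop)]
          gcongr
          exact (nrm_add_le (by fun_prop) (by fun_prop)).trans (add_le_add h.y_le' h.v_le)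
  refine (nrm_eJ_succ_le k hw).trans ((add_le_add h.w_le h1).trans ?_)
  calc e + c * (e + e) ≤ e + c * (e + e) + e := le_self_add
    _ = _ := by ring

/-- Here `q` stands for p + τAv, so p is recovered at the cost of Av and A²v. -/
theorem FreqBounds.nrm_p_le (h : FreqBounds k v w q y e d) (hp : Measurable p) (hv : Measurable v)
    (hq : Measurable q) (hpq : ∀ᵐ ξ, p ξ ≤ q ξ + c * (eA ξ * v ξ)) :
    nrm (fun ξ => eJ ξ ^ (k + 1) * p ξ) ≤ (2 + 2 * c) * e := by
  have h0 : nrm (fun ξ => eJ ξ ^ k * p ξ) ≤ e + c * e := by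
    calc nrm (fun ξ => eJ ξ ^ k * p ξ)
        ≤ nrm (fun ξ => eJ ξ ^ k * q ξ + c * (eJ ξ ^ k * (eA ξ * v ξ))) := by
          refine nrm_mono_ae ?_
          filter_upwards [hpq] with ξ hξ
          calc eJ ξ ^ k * p ξ ≤ eJ ξ ^ k * (q ξ + c * (eA ξ * v ξ)) := by gcongr
            _ = _ := by ring
      _ ≤ _ := by
          refine (nrm_add_le (by fun_prop) (by fun_prop)).trans ?_
          rw [nrm_const_mul _ (by fun_prop)]
          gcongr
          exacts [h.q_le, h.v_le]
  have h1 : nrm (fun ξ => eJ ξ ^ k * (eA ξ * p ξ)) ≤ e + c * e := by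
    calc nrm (fun ξ => eJ ξ ^ k * (eA ξ * p ξ))
        ≤ nrm (fun ξ => eJ ξ ^ k * (eA ξ * q ξ) + c * (eJ ξ ^ k * (eA ξ * (eA ξ * v ξ)))) := by
          refine nrm_mono_ae ?_
          filter_upwards [hpq] with ξ hξ
          calc eJ ξ ^ k * (eA ξ * p ξ) ≤ eJ ξ ^ k * (eA ξ * (q ξ + c * (eA ξ * v ξ))) := by gcongr
            _ = _ := by ring
      _ ≤ _ := by
          refine (nrm_add_le (by fun_prop) (by fun_prop)).trans ?_
          rw [nrm_const_mul _ (by fun_prop)]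
          gcongr
          exacts [h.q_le', h.v_le']
  refine (nrm_eJ_succ_le k hp).trans ((add_le_add h0 h1).trans (le_of_eq ?_))
  ring

theorem FreqBounds.nrm_y_le (h : FreqBounds k v w q y e d) (hy : Measurable y) :
    nrm (fun ξ => eJ ξ ^ (k + 1) * y ξ) ≤ (2 + 2 * c) * e := by
  refine (nrm_eJ_succ_le k hy).trans ((add_le_add h.y_le h.y_le').trans ?_)
  rw [← two_mul]
  gcongr
  exact le_self_add

/-- In vw the factor v, and in ∇ψ · ∇v the factor ∇v, is placed in the gradient norm controlled by
`d`; the other factor is placed in H^{k+1}, controlled by `e`. -/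
theorem FreqBounds.nrm_eJ_N_le (hn : 3 ≤ n) (h : FreqBounds k v w q y e d) (hp : Measurable p)
    (hv : Measurable v) (hw : Measurable w) (hq : Measurable q) (hy : Measurable y)
    (hpq : ∀ᵐ ξ, p ξ ≤ q ξ + c * (eA ξ * v ξ)) (hwy : ∀ᵐ ξ, w ξ ≤ c * (y ξ + v ξ))
    (hN : ∀ᵐ ξ, N ξ ≤ c * (conv v w ξ + conv p (fun η => eA η * v η) ξ)) :
    nrm (fun ξ => eJ ξ ^ (k + 1) * N ξ) ≤ 2 * c * prodConst n k * (2 + 2 * c) * e * d := by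
  have hAv : Measurable fun η => eA η * v η := by fun_prop
  have m1 := measurable_conv hv hw
  have m2 := measurable_conv hAv hp
  calc nrm (fun ξ => eJ ξ ^ (k + 1) * N ξ)
      ≤ nrm (fun ξ => c * (eJ ξ ^ (k + 1) * conv v w ξ +
          eJ ξ ^ (k + 1) * conv (fun η => eA η * v η) p ξ)) := by
        refine nrm_mono_ae ?_
        filter_upwards [hN] with ξ hξ
        rw [conv_comm p] at hξ
        calc eJ ξ ^ (k + 1) * N ξ ≤ eJ ξ ^ (k + 1) *
            (c * (conv v w ξ + conv (fun η => eA η * v η) p ξ)) := by gcongr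
          _ = _ := by ring
    _ ≤ c * (prodConst n k * (d * ((2 + 2 * c) * e)) + prodConst n k * (d * ((2 + 2 * c) * e))) := by
        rw [nrm_const_mul _ (by fun_prop)]
        gcongr
        refine (nrm_add_le (by fun_prop) (by fun_prop)).trans (add_le_add ?_ ?_)
        · refine (nrm_eJ_conv_le hn k hv hw).trans ?_
          gcongr
          · refine le_trans (le_of_eq ?_) h.v_diss
            congr 1; ext ξ; ring
          · exact h.nrm_w_le hv hw hy hwy
        · refine (nrm_eJ_conv_le hn k hAv hp).trans ?_
          gcongr
          · refine le_trans (le_of_eq ?_) h.v_diss'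
            congr 1; ext ξ; ring
          · exact h.nrm_p_le hp hv hq hpq
    _ = _ := by ring

/-- Without a derivative y is not dissipated, so bounding N by e·d in L² would leave a factor e² d.
The trilinear estimates instead find two dissipated factors: Av and w for the product vw, and Av and
Ay for ∇ψ · ∇v. -/
theorem FreqBounds.lintegral_N_mul_y_le (hn : 3 ≤ n) (h : FreqBounds k v w q y e d)
    (hp : Measurable p) (hv : Measurable v) (hw : Measurable w) (hq : Measurable q)
    (hy : Measurable y) (hpq : ∀ᵐ ξ, p ξ ≤ q ξ + c * (eA ξ * v ξ))
    (hN : ∀ᵐ ξ, N ξ ≤ c * (conv v w ξ + conv p (fun η => eA η * v η) ξ)) :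
    ∫⁻ ξ, N ξ * y ξ ≤ 2 * c * prodConst n k * (2 + 2 * c) * e * d ^ 2 := by
  have hAv : Measurable fun η => eA η * v η := by fun_prop
  have m1 := measurable_conv hv hw
  have m2 := measurable_conv hp hAv
  have hAvd : nrm (fun ξ => eA ξ * v ξ) ≤ d := (nrm_le_nrm_eJ k _).trans h.v_diss
  have hAyd : nrm (fun ξ => eA ξ * y ξ) ≤ d := (nrm_le_nrm_eJ k _).trans h.y_diss
  have hwd : nrm w ≤ d := (nrm_le_nrm_eJ k _).trans h.w_diss
  calc ∫⁻ ξ, N ξ * y ξ ≤ ∫⁻ ξ, c * (conv v w ξ * y ξ + conv p (fun η => eA η * v η) ξ * y ξ) := by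
        refine lintegral_mono_ae ?_
        filter_upwards [hN] with ξ hξ
        calc N ξ * y ξ ≤ c * (conv v w ξ + conv p (fun η => eA η * v η) ξ) * y ξ := by gcongr
          _ = _ := by ring
    _ = c * ((∫⁻ ξ, conv v w ξ * y ξ) + ∫⁻ ξ, conv p (fun η => eA η * v η) ξ * y ξ) := by
        rw [lintegral_const_mul _ (by fun_prop), lintegral_add_left (by fun_prop)]
    _ ≤ c * (prodConst n k * (d * ((2 + 2 * c) * e)) * d +
          prodConst n k * (((2 + 2 * c) * e) * d) * d) := by
        gcongr
        · refine (lintegral_conv_mul_eA_le hn k hv hw hy).trans ?_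
          gcongr
          exact h.nrm_y_le hy
        · refine (lintegral_conv_mul_eJ_le hn k hp hAv hy).trans ?_
          gcongr
          exact h.nrm_p_le hp hv hq hpq
    _ = _ := by ring

theorem lintegral_eS_mul_le (hN : Measurable N) {z : Rn n → ℝ≥0∞} (hz : Measurable z) :
    ∫⁻ ξ, (eJ ξ ^ (k + 1) * N ξ) * (eJ ξ ^ k * z ξ) ≤
      nrm (fun ξ => eJ ξ ^ (k + 1) * N ξ) * nrm fun ξ => eJ ξ ^ k * z ξ :=
  lintegral_mul_le_nrm (by fun_prop) (by fun_prop)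

/-- The constant in the estimate of the nonlinear term. -/
def nonlinConst (n k : ℕ) (c : ℝ≥0∞) : ℝ≥0∞ :=
  c * (1 + 5 * (k + 1)) * (2 * c * prodConst n k * (2 + 2 * c))

theorem nonlinConst_lt_top (hn : 3 ≤ n) (hk : n < 2 * (k + 1)) (hc : c < ⊤) :
    nonlinConst n k c < ⊤ := by
  have h1 : (k + 1 : ℝ≥0∞) < ⊤ := by exact_mod_cast ENNReal.natCast_lt_top (k + 1)
  have h2 : (2 : ℝ≥0∞) < ⊤ := by simp
  have h5 : (5 : ℝ≥0∞) < ⊤ := by simp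
  have hq := prodConst_lt_top hn hk
  unfold nonlinConst
  exact ENNReal.mul_lt_top (ENNReal.mul_lt_top hc (ENNReal.add_lt_top.2
    ⟨ENNReal.one_lt_top, ENNReal.mul_lt_top h5 h1⟩)) (ENNReal.mul_lt_top (ENNReal.mul_lt_top
      (ENNReal.mul_lt_top h2 hc) hq) (ENNReal.add_lt_top.2 ⟨h2, ENNReal.mul_lt_top h2 hc⟩))

/-- All parts of the test element except y of order zero are dissipated, if one derivative of A²y is
moved to N. They pair with the bound e·d for N in H^{k+1}; the exceptional part is
`FreqBounds.lintegral_N_mul_y_le`. -/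
theorem FreqBounds.lintegral_nonlinear_le (hn : 3 ≤ n) (h : FreqBounds k v w q y e d)
    (hp : Measurable p) (hv : Measurable v) (hw : Measurable w) (hq : Measurable q)
    (hy : Measurable y) (hNm : Measurable N) (hpq : ∀ᵐ ξ, p ξ ≤ q ξ + c * (eA ξ * v ξ))
    (hwy : ∀ᵐ ξ, w ξ ≤ c * (y ξ + v ξ))
    (hN : ∀ᵐ ξ, N ξ ≤ c * (conv v w ξ + conv p (fun η => eA η * v η) ξ)) :
    ∫⁻ ξ, eS k ξ * N ξ * (c * (y ξ + eA ξ * (eA ξ * y ξ) + eA ξ * q ξ + eA ξ * (eA ξ * v ξ)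
      + w ξ)) ≤ nonlinConst n k c * e * d ^ 2 := by
  have b1 := h.lintegral_N_mul_y_le hn hp hv hw hq hy hpq hN
  have b2 := h.nrm_eJ_N_le hn hp hv hw hq hy hpq hwy hN
  set B := 2 * c * prodConst n k * (2 + 2 * c) with hB
  have t : ∀ z : Rn n → ℝ≥0∞, Measurable z → nrm (fun ξ => eJ ξ ^ k * z ξ) ≤ d →
      ∫⁻ ξ, (eJ ξ ^ (k + 1) * N ξ) * (eJ ξ ^ k * z ξ) ≤ B * e * d * d := fun z hz hzd =>
    (lintegral_eS_mul_le hNm hz).trans (mul_le_mul' b2 hzd)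
  have t1 := t _ (by fun_prop) h.y_diss
  have t2 := t _ (by fun_prop) h.q_diss
  have t3 := t _ (by fun_prop) h.v_diss'
  have t4 := t _ hw h.w_diss
  have hpt : ∀ ξ, eS k ξ * N ξ * (c * (y ξ + eA ξ * (eA ξ * y ξ) + eA ξ * q ξ
      + eA ξ * (eA ξ * v ξ) + w ξ)) ≤ c * (N ξ * y ξ + (k + 1) *
        ((((eJ ξ ^ (k + 1) * N ξ) * (eJ ξ ^ k * (eA ξ * y ξ)) +
          (eJ ξ ^ (k + 1) * N ξ) * (eJ ξ ^ k * (eA ξ * y ξ))) +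
          (eJ ξ ^ (k + 1) * N ξ) * (eJ ξ ^ k * (eA ξ * q ξ))) +
          (eJ ξ ^ (k + 1) * N ξ) * (eJ ξ ^ k * (eA ξ * (eA ξ * v ξ))) +
          (eJ ξ ^ (k + 1) * N ξ) * (eJ ξ ^ k * w ξ))) := fun ξ => by
    have s1 := eS_le k ξ
    have s2 := eS_le_one_add k ξ
    have hA := eA_le_eJ ξ
    have h1 := one_le_eJ ξ
    -- `eS_le_one_add` isolates the order-zero part; in the rest one power of |ξ| makes y dissipated
    -- and the other is given to N.
    have u1 : eS k ξ * N ξ * y ξ ≤ N ξ * y ξ + (k + 1) *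
        ((eJ ξ ^ (k + 1) * N ξ) * (eJ ξ ^ k * (eA ξ * y ξ))) := by
      calc eS k ξ * N ξ * y ξ ≤ (1 + eA ξ ^ 2 * eS k ξ) * N ξ * y ξ := by gcongr
        _ = N ξ * y ξ + eA ξ * eS k ξ * N ξ * (eA ξ * y ξ) := by ring
        _ ≤ N ξ * y ξ + eJ ξ * ((k + 1) * (eJ ξ ^ k * eJ ξ ^ k)) * N ξ * (eA ξ * y ξ) := by gcongr
        _ = _ := by ring
    have u2 : eS k ξ * N ξ * (eA ξ * (eA ξ * y ξ)) ≤ (k + 1) *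
        ((eJ ξ ^ (k + 1) * N ξ) * (eJ ξ ^ k * (eA ξ * y ξ))) := by
      calc eS k ξ * N ξ * (eA ξ * (eA ξ * y ξ)) ≤
          ((k + 1) * (eJ ξ ^ k * eJ ξ ^ k)) * N ξ * (eJ ξ * (eA ξ * y ξ)) := by gcongr
        _ = _ := by ring
    have u3 : ∀ z, eS k ξ * N ξ * z ≤ (k + 1) * ((eJ ξ ^ (k + 1) * N ξ) * (eJ ξ ^ k * z)) := by
      intro z
      calc eS k ξ * N ξ * z ≤ ((k + 1) * (eJ ξ ^ k * eJ ξ ^ k)) * N ξ * z := by gcongr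
        _ ≤ eJ ξ * (((k + 1) * (eJ ξ ^ k * eJ ξ ^ k)) * N ξ * z) := le_mul_of_one_le_left' h1
        _ = _ := by ring
    calc eS k ξ * N ξ * (c * (y ξ + eA ξ * (eA ξ * y ξ) + eA ξ * q ξ
          + eA ξ * (eA ξ * v ξ) + w ξ))
        = c * (eS k ξ * N ξ * y ξ + eS k ξ * N ξ * (eA ξ * (eA ξ * y ξ)) +
          eS k ξ * N ξ * (eA ξ * q ξ) + eS k ξ * N ξ * (eA ξ * (eA ξ * v ξ))
          + eS k ξ * N ξ * w ξ) := by ring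
      _ ≤ c * ((N ξ * y ξ + (k + 1) * ((eJ ξ ^ (k + 1) * N ξ) * (eJ ξ ^ k * (eA ξ * y ξ)))) +
          (k + 1) * ((eJ ξ ^ (k + 1) * N ξ) * (eJ ξ ^ k * (eA ξ * y ξ))) +
          (k + 1) * ((eJ ξ ^ (k + 1) * N ξ) * (eJ ξ ^ k * (eA ξ * q ξ))) +
          (k + 1) * ((eJ ξ ^ (k + 1) * N ξ) * (eJ ξ ^ k * (eA ξ * (eA ξ * v ξ)))) +
          (k + 1) * ((eJ ξ ^ (k + 1) * N ξ) * (eJ ξ ^ k * w ξ))) := by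
          refine mul_le_mul' le_rfl ?_
          exact add_le_add (add_le_add (add_le_add (add_le_add u1 u2) (u3 _)) (u3 _)) (u3 _)
      _ = _ := by ring
  refine (lintegral_mono hpt).trans ?_
  rw [lintegral_const_mul _ (by fun_prop), lintegral_add_left (by fun_prop),
    lintegral_const_mul _ (by fun_prop), lintegral_add_left (by fun_prop),
    lintegral_add_left (by fun_prop), lintegral_add_left (by fun_prop),
    lintegral_add_left (by fun_prop)]
  calc _ ≤ c * (B * e * d ^ 2 + (k + 1) * (B * e * d * d + B * e * d * d + B * e * d * d
        + B * e * d * d + B * e * d * d)) := by gcongr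
    _ = _ := by rw [nonlinConst, ← hB]; ring

end Nonlinear

/-! ### Frequency truncation and its removal -/

/-- The real-valued version of the weight `eS`. -/
def sfun (k : ℕ) (ξ : Rn n) : ℝ := ∑ κ ∈ Finset.range (k + 1), afun ξ ^ (2 * κ)

theorem sfun_nonneg (k : ℕ) (ξ : Rn n) : 0 ≤ sfun k ξ :=
  Finset.sum_nonneg fun _ _ => pow_nonneg (afun_nonneg ξ) _

theorem ofReal_sfun (k : ℕ) (ξ : Rn n) : ENNReal.ofReal (sfun k ξ) = eS k ξ := by
  rw [sfun, eS, ENNReal.ofReal_sum_of_nonneg fun _ _ => pow_nonneg (afun_nonneg ξ) _]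
  exact Finset.sum_congr rfl fun κ _ => ENNReal.ofReal_pow (afun_nonneg ξ) _

@[fun_prop]
theorem measurable_sfun (k : ℕ) : Measurable (sfun k : Rn n → ℝ) := by unfold sfun; fun_prop

/-- The multiplier `2π|ξ|`, cut off at the frequency `N`. -/
def aMult (n N : ℕ) : Mult n where
  toFun ξ := if ‖ξ‖ ≤ N then (afun ξ : ℂ) else 0
  measurable := Measurable.ite (measurableSet_le measurable_norm measurable_const)
    (by fun_prop) measurable_const
  bound := 2 * Real.pi * N
  norm_le ξ := by
    split_ifs with h
    · rw [Complex.norm_real, Real.norm_of_nonneg (afun_nonneg ξ), afun]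
      exact mul_le_mul_of_nonneg_left h (by positivity)
    · simp; positivity

/-- The multiplier `(∑_{κ ≤ k} (2π|ξ|)^{2κ})^{1/2}`, cut off at the frequency `N`. -/
def sMult (n k N : ℕ) : Mult n where
  toFun ξ := if ‖ξ‖ ≤ N then (√(sfun k ξ) : ℂ) else 0
  measurable := Measurable.ite (measurableSet_le measurable_norm measurable_const)
    (by fun_prop) measurable_const
  bound := √(∑ κ ∈ Finset.range (k + 1), (2 * Real.pi * N) ^ (2 * κ))
  norm_le ξ := by
    split_ifs with h
    · rw [Complex.norm_real, Real.norm_of_nonneg (Real.sqrt_nonneg _)]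
      refine Real.sqrt_le_sqrt (Finset.sum_le_sum fun κ _ => ?_)
      refine pow_le_pow_left₀ (afun_nonneg ξ) ?_ _
      exact mul_le_mul_of_nonneg_left h (by positivity)
    · simp

/-- The weight `eS`, cut off at the frequency `N`. -/
def cutS (k N : ℕ) : Rn n → ℝ≥0∞ := {ξ | ‖ξ‖ ≤ N}.indicator (eS k)

theorem measurableSet_norm_le (N : ℕ) : MeasurableSet {ξ : Rn n | ‖ξ‖ ≤ N} :=
  measurableSet_le measurable_norm measurable_const

@[fun_prop]
theorem measurable_cutS (k N : ℕ) : Measurable (cutS k N : Rn n → ℝ≥0∞) :=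
  (measurable_eS k).indicator (measurableSet_norm_le N)

theorem cutS_le (k N : ℕ) (ξ : Rn n) : cutS k N ξ ≤ eS k ξ := indicator_le_self _ _ ξ

theorem cutS_mono (k : ℕ) (ξ : Rn n) : Monotone fun N => cutS k N ξ := by
  intro N N' hN
  have hN' : (N : ℝ) ≤ N' := by exact_mod_cast hN
  exact indicator_le_indicator_of_subset (fun x (hx : ‖x‖ ≤ N) => hx.trans hN')
    (fun _ => zero_le) ξ

theorem tendsto_cutS (k : ℕ) (ξ : Rn n) :
    Filter.Tendsto (fun N => cutS k N ξ) Filter.atTop (nhds (eS k ξ)) := by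
  refine tendsto_const_nhds.congr' ?_
  filter_upwards [Filter.eventually_ge_atTop ⌈‖ξ‖⌉₊] with N hN
  have h : ‖ξ‖ ≤ N := (Nat.le_ceil _).trans (by exact_mod_cast hN)
  exact (indicator_of_mem (s := {ξ : Rn n | ‖ξ‖ ≤ N}) h (eS k)).symm

theorem enorm_sMult_sq (k N : ℕ) (ξ : Rn n) : ‖sMult n k N ξ‖ₑ ^ 2 = cutS k N ξ := by
  simp only [sMult, cutS]
  by_cases h : ‖ξ‖ ≤ N
  · rw [if_pos h, indicator_of_mem (s := {ξ : Rn n | ‖ξ‖ ≤ N}) h, ← ofReal_norm,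
      Complex.norm_real, Real.norm_of_nonneg (Real.sqrt_nonneg _),
      ← ENNReal.ofReal_pow (Real.sqrt_nonneg _), Real.sq_sqrt (sfun_nonneg k ξ), ofReal_sfun]
  · rw [if_neg h, indicator_of_notMem (s := {ξ : Rn n | ‖ξ‖ ≤ N}) h]
    simp

theorem aMult_mul_sMult (k N : ℕ) (ξ : Rn n) :
    aMult n N ξ * sMult n k N ξ = sMult n k N ξ * afun ξ := by
  simp only [sMult, aMult]
  split_ifs <;> simp [mul_comm]

/-- A multiplier as an operator on `L²`, viewed as a real Hilbert space. -/
def Mult.opR (a : Mult n) : CL2 n →L[ℝ] CL2 n := a.op.restrictScalars ℝ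

theorem Mult.coeFn_opR (a : Mult n) (f : CL2 n) : a.opR f =ᵐ[volume] fun x => a x * f x :=
  a.coeFn_op f

theorem inner_aMult (N : ℕ) (f g : CL2 n) :
    inner ℝ ((aMult n N).opR f) g = inner ℝ f ((aMult n N).opR g) := by
  rw [L2.inner_def, L2.inner_def]
  refine integral_congr_ae ?_
  filter_upwards [(aMult n N).coeFn_opR f, (aMult n N).coeFn_opR g] with ξ h1 h2
  rw [h1, h2]
  simp only [aMult, Complex.inner]
  split_ifs
  · simp; ring
  · simp

/-- The weighted square integral of `G`. -/
def wsq (ρ : Rn n → ℝ≥0∞) (G : Rn n → ℂ) : ℝ≥0∞ := ∫⁻ ξ, ρ ξ * ‖G ξ‖ₑ ^ 2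

theorem wsq_congr {ρ : Rn n → ℝ≥0∞} {G G' : Rn n → ℂ} (h : G =ᵐ[volume] G') :
    wsq ρ G = wsq ρ G' := by
  refine lintegral_congr_ae ?_
  filter_upwards [h] with ξ hξ
  rw [hξ]

theorem enorm_sq_eq_wsq {k N : ℕ} {u : CL2 n} {G : Rn n → ℂ}
    (h : u =ᵐ[volume] fun ξ => sMult n k N ξ * G ξ) : ‖u‖ₑ ^ 2 = wsq (cutS k N) G := by
  rw [enorm_sq_L2]
  refine lintegral_congr_ae ?_
  filter_upwards [h] with ξ hξ
  rw [hξ, enorm_mul, mul_pow, enorm_sMult_sq]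

theorem aMult_eq_sMult_mul {k N : ℕ} {u : CL2 n} {G : Rn n → ℂ}
    (h : u =ᵐ[volume] fun ξ => sMult n k N ξ * G ξ) :
    (aMult n N).opR u =ᵐ[volume] fun ξ => sMult n k N ξ * (afun ξ * G ξ) := by
  filter_upwards [h, (aMult n N).coeFn_opR u] with ξ h1 h2
  rw [h2, h1, ← mul_assoc, aMult_mul_sMult, mul_assoc]

theorem add_smul_eq_sMult_mul {k N : ℕ} {u u' : CL2 n} {G G' : Rn n → ℂ}
    (h : u =ᵐ[volume] fun ξ => sMult n k N ξ * G ξ)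
    (h' : u' =ᵐ[volume] fun ξ => sMult n k N ξ * G' ξ) (c : ℝ) :
    (u + c • u' : CL2 n) =ᵐ[volume] fun ξ => sMult n k N ξ * (G ξ + c * G' ξ) := by
  filter_upwards [h, h', Lp.coeFn_add u (c • u'), Lp.coeFn_smul c u'] with ξ h1 h2 h3 h4
  rw [h3, Pi.add_apply, h4, Pi.smul_apply, h1, h2, Complex.real_smul]
  ring

/-- Monotone convergence in the cutoff; the limit may be infinite, so no regularity of `G` is
needed. -/
theorem tendsto_wsq (k : ℕ) {G : Rn n → ℂ} (hG : Measurable G) :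
    Filter.Tendsto (fun N => wsq (cutS k N) G) Filter.atTop (nhds (wsq (eS k) G)) := by
  refine lintegral_tendsto_of_tendsto_of_monotone (fun N => ?_) ?_ ?_
  · exact (by fun_prop : Measurable _).aemeasurable
  · refine Filter.Eventually.of_forall fun ξ N N' hN => ?_
    exact mul_le_mul' (cutS_mono k ξ hN) le_rfl
  · refine Filter.Eventually.of_forall fun ξ => ?_
    refine ENNReal.Tendsto.mul_const (tendsto_cutS k ξ) (Or.inr ?_)
    exact ENNReal.pow_ne_top enorm_ne_top

theorem wsq_mono {ρ ρ' : Rn n → ℝ≥0∞} (h : ∀ ξ, ρ ξ ≤ ρ' ξ) (G : Rn n → ℂ) :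
    wsq ρ G ≤ wsq ρ' G := lintegral_mono fun ξ => mul_le_mul' (h ξ) le_rfl

theorem wsq_cutS_mono (k : ℕ) (G : Rn n → ℂ) : Monotone fun N => wsq (cutS k N) G :=
  fun _ _ hN => wsq_mono (fun ξ => cutS_mono k ξ hN) G

/-- The function `p + τ A v` on the Fourier side. -/
def freqPV (τ : ℝ) (P V : Rn n → ℂ) (ξ : Rn n) : ℂ := P ξ + τ * (afun ξ * V ξ)

/-- The function `v + τ w` on the Fourier side. -/
def freqVW (τ : ℝ) (V W : Rn n → ℂ) (ξ : Rn n) : ℂ := V ξ + τ * W ξ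

/-- Multiplication with `2π|ξ|`. -/
def mulA (G : Rn n → ℂ) (ξ : Rn n) : ℂ := afun ξ * G ξ

/-- The weighted history norm on the Fourier side. -/
def freqHist (ρ : Rn n → ℝ≥0∞) (h : ℝ → ℝ) (η : ℝ → Rn n → ℂ) : ℝ≥0∞ :=
  ∫⁻ s in Ioi (0 : ℝ), ENNReal.ofReal (h s) * wsq ρ (η s)

/-- The energy on the Fourier side. -/
def freqEnergy (ρ : Rn n → ℝ≥0∞) (τ : ℝ) (h : ℝ → ℝ) (P V W : ℝ → CL2 n) (t : ℝ) : ℝ≥0∞ :=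
  wsq ρ (freqPV τ (P t) (V t)) + wsq ρ (freqVW τ (V t) (W t)) + wsq ρ (mulA (V t))
    + freqHist ρ h (fun s => (hist P t s : CL2 n)) + wsq ρ (W t)
    + wsq ρ (mulA (freqPV τ (P t) (V t))) + wsq ρ (mulA (freqVW τ (V t) (W t)))
    + wsq ρ (mulA (mulA (V t))) + freqHist ρ h (fun s => mulA (hist P t s : CL2 n))

/-- The dissipation on the Fourier side. -/
def freqDiss (ρ : Rn n → ℝ≥0∞) (τ : ℝ) (h : ℝ → ℝ) (P V W : ℝ → CL2 n) (t : ℝ) : ℝ≥0∞ :=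
  wsq ρ (mulA (V t)) + freqHist ρ h (fun s => (hist P t s : CL2 n))
    + wsq ρ (mulA (freqPV τ (P t) (V t))) + wsq ρ (mulA (freqVW τ (V t) (W t)))
    + wsq ρ (mulA (mulA (V t))) + freqHist ρ h (fun s => mulA (hist P t s : CL2 n)) + wsq ρ (W t)

theorem freqDiss_le_freqEnergy (ρ : Rn n → ℝ≥0∞) (τ : ℝ) (h : ℝ → ℝ) (P V W : ℝ → CL2 n)
    (t : ℝ) : freqDiss ρ τ h P V W t ≤ freqEnergy ρ τ h P V W t := by
  unfold freqDiss freqEnergy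
  refine le_trans (le_add_left le_rfl :
    _ ≤ (wsq ρ (freqPV τ (P t) (V t)) + wsq ρ (freqVW τ (V t) (W t))) + _) (le_of_eq ?_)
  ring

theorem ofReal_norm_sq (u : CL2 n) : ENNReal.ofReal (‖u‖ ^ 2) = ‖u‖ₑ ^ 2 := by
  rw [ENNReal.ofReal_pow (norm_nonneg _), ofReal_norm]

theorem ofReal_histSq {h : ℝ → ℝ} (hh : IntegrableOn h (Ioi 0)) (hh0 : ∀ s > 0, 0 ≤ h s)
    {p : ℝ → CL2 n} (hp : Continuous p) {t : ℝ} (ht : 0 ≤ t) {k N : ℕ} {η : ℝ → Rn n → ℂ}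
    (hη : ∀ s, (hist p t s : CL2 n) =ᵐ[volume] fun ξ => sMult n k N ξ * η s ξ) :
    ENNReal.ofReal (histSq h p t) = freqHist (cutS k N) h η := by
  rw [histSq, ofReal_integral_eq_lintegral_ofReal (integrableOn_mul_hist_sq hh hp ht)]
  · refine setLIntegral_congr_fun measurableSet_Ioi fun s hs => ?_
    rw [ENNReal.ofReal_mul (hh0 s hs), ofReal_norm_sq, enorm_sq_eq_wsq (hη s)]
  · exact (ae_restrict_iff' measurableSet_Ioi).2 (Filter.Eventually.of_forall fun s hs =>
      mul_nonneg (hh0 s hs) (sq_nonneg _))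

section Truncated

variable {τ : ℝ} {h : ℝ → ℝ} {P V W : ℝ → CL2 n} {k N : ℕ} {t : ℝ}

theorem freqPV_ae (k N : ℕ) (τ : ℝ) (p v : CL2 n) :
    ((sMult n k N).opR p + τ • (aMult n N).opR ((sMult n k N).opR v) : CL2 n) =ᵐ[volume]
      fun ξ => sMult n k N ξ * freqPV τ p v ξ :=
  add_smul_eq_sMult_mul ((sMult n k N).coeFn_opR p)
    (aMult_eq_sMult_mul ((sMult n k N).coeFn_opR v)) τ

theorem freqVW_ae (k N : ℕ) (τ : ℝ) (v w : CL2 n) :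
    ((sMult n k N).opR v + τ • (sMult n k N).opR w : CL2 n) =ᵐ[volume]
      fun ξ => sMult n k N ξ * freqVW τ v w ξ :=
  add_smul_eq_sMult_mul ((sMult n k N).coeFn_opR v) ((sMult n k N).coeFn_opR w) τ

theorem ofReal_histSq_cut (hh : IntegrableOn h (Ioi 0)) (hh0 : ∀ s > 0, 0 ≤ h s)
    (hP : Continuous P) (ht : 0 ≤ t) :
    ENNReal.ofReal (histSq h (fun r => (sMult n k N).opR (P r)) t) =
      freqHist (cutS k N) h (fun s => (hist P t s : CL2 n)) :=
  ofReal_histSq (p := fun r => (sMult n k N).opR (P r)) hh hh0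
    ((sMult n k N).opR.continuous.comp hP) ht fun s => by
    rw [hist_map]
    exact (sMult n k N).coeFn_opR _

theorem ofReal_histSq_cut_mulA (hh : IntegrableOn h (Ioi 0)) (hh0 : ∀ s > 0, 0 ≤ h s)
    (hP : Continuous P) (ht : 0 ≤ t) :
    ENNReal.ofReal (histSq h (fun r => (aMult n N).opR ((sMult n k N).opR (P r))) t) =
      freqHist (cutS k N) h (fun s => mulA (hist P t s : CL2 n)) :=
  ofReal_histSq (p := fun r => (aMult n N).opR ((sMult n k N).opR (P r))) hh hh0
    ((aMult n N).opR.continuous.comp ((sMult n k N).opR.continuous.comp hP)) ht fun s => by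
    have e : hist (fun r => (aMult n N).opR ((sMult n k N).opR (P r))) t s =
        (aMult n N).opR ((sMult n k N).opR (hist P t s)) := by
      rw [hist_map (aMult n N).opR (fun r => (sMult n k N).opR (P r)), hist_map]
    rw [e]
    exact aMult_eq_sMult_mul ((sMult n k N).coeFn_opR _)

/-- The square of the multiplier `sMult` is the cut-off sum of all weights up to order k. The
abstract energy of the truncated curves is therefore the weighted energy of all these orders
together. -/
theorem ofReal_linEnergy (hh : IntegrableOn h (Ioi 0)) (hh0 : ∀ s > 0, 0 ≤ h s)
    (hP : Continuous P) (ht : 0 ≤ t) :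
    ENNReal.ofReal (linEnergy (aMult n N).opR τ h (fun r => (sMult n k N).opR (P r))
      (fun r => (sMult n k N).opR (V r)) (fun r => (sMult n k N).opR (W r)) t) =
      freqEnergy (cutS k N) τ h P V W t := by
  have h1 := histSq_nonneg (p := fun r => (sMult n k N).opR (P r)) hh0 t
  have h2 := histSq_nonneg (p := fun r => (aMult n N).opR ((sMult n k N).opR (P r))) hh0 t
  have hv := (sMult n k N).coeFn_opR (V t)
  unfold linEnergy freqEnergy
  rw [ENNReal.ofReal_add (by positivity) h2, ENNReal.ofReal_add (by positivity) (by positivity),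
    ENNReal.ofReal_add (by positivity) (by positivity),
    ENNReal.ofReal_add (by positivity) (by positivity),
    ENNReal.ofReal_add (by positivity) (by positivity), ENNReal.ofReal_add (by positivity) h1,
    ENNReal.ofReal_add (by positivity) (by positivity),
    ENNReal.ofReal_add (by positivity) (by positivity)]
  simp only [ofReal_norm_sq]
  rw [ofReal_histSq_cut hh hh0 hP ht, ofReal_histSq_cut_mulA hh hh0 hP ht,
    enorm_sq_eq_wsq (freqPV_ae k N τ (P t) (V t)), enorm_sq_eq_wsq (freqVW_ae k N τ (V t) (W t)),
    enorm_sq_eq_wsq (aMult_eq_sMult_mul hv),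
    enorm_sq_eq_wsq ((sMult n k N).coeFn_opR (W t)),
    enorm_sq_eq_wsq (aMult_eq_sMult_mul (freqPV_ae k N τ (P t) (V t))),
    enorm_sq_eq_wsq (aMult_eq_sMult_mul (freqVW_ae k N τ (V t) (W t))),
    enorm_sq_eq_wsq (aMult_eq_sMult_mul (aMult_eq_sMult_mul hv))]
  rfl

theorem ofReal_linDiss (hh : IntegrableOn h (Ioi 0)) (hh0 : ∀ s > 0, 0 ≤ h s)
    (hP : Continuous P) (ht : 0 ≤ t) :
    ENNReal.ofReal (linDiss (aMult n N).opR τ h (fun r => (sMult n k N).opR (P r))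
      (fun r => (sMult n k N).opR (V r)) (fun r => (sMult n k N).opR (W r)) t) =
      freqDiss (cutS k N) τ h P V W t := by
  have h1 := histSq_nonneg (p := fun r => (sMult n k N).opR (P r)) hh0 t
  have h2 := histSq_nonneg (p := fun r => (aMult n N).opR ((sMult n k N).opR (P r))) hh0 t
  have hv := (sMult n k N).coeFn_opR (V t)
  unfold linDiss freqDiss
  rw [ENNReal.ofReal_add (by positivity) (by positivity), ENNReal.ofReal_add (by positivity) h2,
    ENNReal.ofReal_add (by positivity) (by positivity),
    ENNReal.ofReal_add (by positivity) (by positivity),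
    ENNReal.ofReal_add (by positivity) (by positivity), ENNReal.ofReal_add (by positivity) h1]
  simp only [ofReal_norm_sq]
  rw [ofReal_histSq_cut hh hh0 hP ht, ofReal_histSq_cut_mulA hh hh0 hP ht,
    enorm_sq_eq_wsq (aMult_eq_sMult_mul hv),
    enorm_sq_eq_wsq ((sMult n k N).coeFn_opR (W t)),
    enorm_sq_eq_wsq (aMult_eq_sMult_mul (freqPV_ae k N τ (P t) (V t))),
    enorm_sq_eq_wsq (aMult_eq_sMult_mul (freqVW_ae k N τ (V t) (W t))),
    enorm_sq_eq_wsq (aMult_eq_sMult_mul (aMult_eq_sMult_mul hv))]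
  rfl

end Truncated

theorem measurable_CL2 (F : CL2 n) : Measurable F := (Lp.stronglyMeasurable F).measurable

theorem measurable_mulA {G : Rn n → ℂ} (hG : Measurable G) : Measurable (mulA G) := by
  unfold mulA; fun_prop

theorem measurable_freqPV (τ : ℝ) {P V : Rn n → ℂ} (hP : Measurable P) (hV : Measurable V) :
    Measurable (freqPV τ P V) := by
  unfold freqPV; fun_prop

theorem measurable_freqVW (τ : ℝ) {V W : Rn n → ℂ} (hV : Measurable V) (hW : Measurable W) :
    Measurable (freqVW τ V W) := by
  unfold freqVW; fun_prop

theorem enorm_mulA (G : Rn n → ℂ) (ξ : Rn n) : ‖mulA G ξ‖ₑ = eA ξ * ‖G ξ‖ₑ := by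
  rw [mulA, enorm_mul, enorm_afun]

section Limit

variable {τ : ℝ} {h : ℝ → ℝ} {P V W : ℝ → CL2 n} {k : ℕ} {t : ℝ}

theorem tendsto_freqHist (hh : IntegrableOn h (Ioi 0)) {η : ℝ → Rn n → ℂ}
    (hη : ∀ s, Measurable (η s)) (hm : ∀ N, Measurable fun s => wsq (cutS k N) (η s)) :
    Filter.Tendsto (fun N => freqHist (cutS k N) h η) Filter.atTop
      (nhds (freqHist (eS k) h η)) := by
  refine lintegral_tendsto_of_tendsto_of_monotone (fun N => ?_) ?_ ?_
  · exact hh.aestronglyMeasurable.aemeasurable.ennreal_ofReal.mul (hm N).aemeasurable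
  · refine Filter.Eventually.of_forall fun s N N' hN => ?_
    exact mul_le_mul' le_rfl (wsq_cutS_mono k (η s) hN)
  · refine Filter.Eventually.of_forall fun s => ?_
    exact ENNReal.Tendsto.const_mul (tendsto_wsq k (hη s)) (Or.inr ENNReal.ofReal_ne_top)

/-- With the cutoff the integral is the squared norm of a bounded operator applied to the history,
which is strongly measurable in s. The untruncated case is obtained only as a limit. -/
theorem measurable_wsq_hist (hP : Continuous P) (t : ℝ) (N : ℕ) :
    Measurable fun s => wsq (cutS k N) (hist P t s : CL2 n) := by
  have e : ∀ s, wsq (cutS k N) (hist P t s : CL2 n) = ‖(sMult n k N).opR (hist P t s)‖ₑ ^ 2 :=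
    fun s => (enorm_sq_eq_wsq ((sMult n k N).coeFn_opR _)).symm
  simp only [e]
  exact (((sMult n k N).opR.continuous.comp_stronglyMeasurable
    (stronglyMeasurable_hist hP t)).enorm).pow_const 2

theorem measurable_wsq_mulA_hist (hP : Continuous P) (t : ℝ) (N : ℕ) :
    Measurable fun s => wsq (cutS k N) (mulA (hist P t s : CL2 n)) := by
  have e : ∀ s, wsq (cutS k N) (mulA (hist P t s : CL2 n)) =
      ‖(aMult n N).opR ((sMult n k N).opR (hist P t s))‖ₑ ^ 2 :=
    fun s => (enorm_sq_eq_wsq (aMult_eq_sMult_mul ((sMult n k N).coeFn_opR _))).symm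
  simp only [e]
  exact (((aMult n N).opR.continuous.comp_stronglyMeasurable
    ((sMult n k N).opR.continuous.comp_stronglyMeasurable
      (stronglyMeasurable_hist hP t))).enorm).pow_const 2

theorem tendsto_freqEnergy (hh : IntegrableOn h (Ioi 0)) (hP : Continuous P) (t : ℝ) :
    Filter.Tendsto (fun N => freqEnergy (cutS k N) τ h P V W t) Filter.atTop
      (nhds (freqEnergy (eS k) τ h P V W t)) := by
  have mP := measurable_CL2 (P t)
  have mV := measurable_CL2 (V t)
  have mW := measurable_CL2 (W t)
  have mpv := measurable_freqPV τ mP mV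
  have mvw := measurable_freqVW τ mV mW
  unfold freqEnergy
  refine ((((((((tendsto_wsq k mpv).add (tendsto_wsq k mvw)).add
    (tendsto_wsq k (measurable_mulA mV))).add ?_).add (tendsto_wsq k mW)).add
    (tendsto_wsq k (measurable_mulA mpv))).add (tendsto_wsq k (measurable_mulA mvw))).add
    (tendsto_wsq k (measurable_mulA (measurable_mulA mV)))).add ?_
  · exact tendsto_freqHist hh (fun s => measurable_CL2 _) (measurable_wsq_hist hP t)
  · exact tendsto_freqHist hh (fun s => measurable_mulA (measurable_CL2 _))
      (measurable_wsq_mulA_hist hP t)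

theorem tendsto_freqDiss (hh : IntegrableOn h (Ioi 0)) (hP : Continuous P) (t : ℝ) :
    Filter.Tendsto (fun N => freqDiss (cutS k N) τ h P V W t) Filter.atTop
      (nhds (freqDiss (eS k) τ h P V W t)) := by
  have mP := measurable_CL2 (P t)
  have mV := measurable_CL2 (V t)
  have mW := measurable_CL2 (W t)
  have mpv := measurable_freqPV τ mP mV
  have mvw := measurable_freqVW τ mV mW
  unfold freqDiss
  refine (((((((tendsto_wsq k (measurable_mulA mV))).add ?_).add
    (tendsto_wsq k (measurable_mulA mpv))).add (tendsto_wsq k (measurable_mulA mvw))).add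
    (tendsto_wsq k (measurable_mulA (measurable_mulA mV)))).add ?_).add (tendsto_wsq k mW)
  · exact tendsto_freqHist hh (fun s => measurable_CL2 _) (measurable_wsq_hist hP t)
  · exact tendsto_freqHist hh (fun s => measurable_mulA (measurable_CL2 _))
      (measurable_wsq_mulA_hist hP t)

theorem freqHist_mono {ρ ρ' : Rn n → ℝ≥0∞} (hρ : ∀ ξ, ρ ξ ≤ ρ' ξ) (h : ℝ → ℝ)
    (η : ℝ → Rn n → ℂ) : freqHist ρ h η ≤ freqHist ρ' h η :=
  lintegral_mono fun s => mul_le_mul' le_rfl (wsq_mono hρ (η s))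

theorem freqEnergy_mono {ρ ρ' : Rn n → ℝ≥0∞} (hρ : ∀ ξ, ρ ξ ≤ ρ' ξ) (τ : ℝ) (h : ℝ → ℝ)
    (P V W : ℝ → CL2 n) (t : ℝ) : freqEnergy ρ τ h P V W t ≤ freqEnergy ρ' τ h P V W t := by
  unfold freqEnergy
  have h1 := wsq_mono hρ
  have h2 := freqHist_mono hρ h
  gcongr <;> first | exact h1 _ | exact h2 _

theorem freqDiss_mono {ρ ρ' : Rn n → ℝ≥0∞} (hρ : ∀ ξ, ρ ξ ≤ ρ' ξ) (τ : ℝ) (h : ℝ → ℝ)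
    (P V W : ℝ → CL2 n) (t : ℝ) : freqDiss ρ τ h P V W t ≤ freqDiss ρ' τ h P V W t := by
  unfold freqDiss
  have h1 := wsq_mono hρ
  have h2 := freqHist_mono hρ h
  gcongr <;> first | exact h1 _ | exact h2 _

end Limit

theorem nrm_eJ_le_wsq (k : ℕ) (G : Rn n → ℂ) :
    nrm (fun ξ => eJ ξ ^ k * ‖G ξ‖ₑ) ≤ (2 ^ (2 * k + 1) * wsq (eS k) G) ^ (1 / 2 : ℝ) := by
  refine ENNReal.rpow_le_rpow ?_ (by norm_num)
  rw [wsq, ← lintegral_const_mul' _ _ (ENNReal.pow_ne_top (by norm_num))]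
  refine lintegral_mono fun ξ => ?_
  simp only
  rw [mul_pow, ← mul_assoc]
  exact mul_le_mul' (eJ_pow_le_eS k ξ) le_rfl

/-- The energy side uses a bound `E` that will be uniform in time, while the dissipation side keeps
its value at time t, so that it can later be integrated. -/
theorem freqBounds_of_freqEnergy {k : ℕ} {τ : ℝ} {h : ℝ → ℝ} {P V W : ℝ → CL2 n} {t : ℝ}
    {E : ℝ≥0∞} (hE : freqEnergy (eS k) τ h P V W t ≤ E) :
    FreqBounds k (fun ξ => ‖V t ξ‖ₑ) (fun ξ => ‖W t ξ‖ₑ) (fun ξ => ‖freqPV τ (P t) (V t) ξ‖ₑ)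
      (fun ξ => ‖freqVW τ (V t) (W t) ξ‖ₑ) ((2 ^ (2 * k + 1) * E) ^ (1 / 2 : ℝ))
      ((2 ^ (2 * k + 1) * freqDiss (eS k) τ h P V W t) ^ (1 / 2 : ℝ)) := by
  have key : ∀ (G : Rn n → ℂ) (X : ℝ≥0∞), wsq (eS k) G ≤ X →
      nrm (fun ξ => eJ ξ ^ k * ‖G ξ‖ₑ) ≤ (2 ^ (2 * k + 1) * X) ^ (1 / 2 : ℝ) := fun G X hX =>
    (nrm_eJ_le_wsq k G).trans (ENNReal.rpow_le_rpow (mul_le_mul' le_rfl hX) (by norm_num))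
  have d1 : wsq (eS k) (mulA (V t)) ≤ freqDiss (eS k) τ h P V W t := by
    unfold freqDiss; simp only [add_assoc]; exact le_self_add
  have d2 : wsq (eS k) (mulA (freqPV τ (P t) (V t))) ≤ freqDiss (eS k) τ h P V W t := by
    unfold freqDiss; simp only [add_assoc]
    exact le_add_left (le_add_left le_self_add)
  have d3 : wsq (eS k) (mulA (freqVW τ (V t) (W t))) ≤ freqDiss (eS k) τ h P V W t := by
    unfold freqDiss; simp only [add_assoc]
    exact le_add_left (le_add_left (le_add_left le_self_add))
  have d4 : wsq (eS k) (mulA (mulA (V t))) ≤ freqDiss (eS k) τ h P V W t := by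
    unfold freqDiss; simp only [add_assoc]
    exact le_add_left (le_add_left (le_add_left (le_add_left le_self_add)))
  have d5 : wsq (eS k) (W t) ≤ freqDiss (eS k) τ h P V W t := by
    unfold freqDiss; exact le_add_self
  have hD := (freqDiss_le_freqEnergy (eS k) τ h P V W t).trans hE
  have e1 : wsq (eS k) (freqPV τ (P t) (V t)) ≤ E := by
    refine le_trans ?_ hE
    unfold freqEnergy; simp only [add_assoc]; exact le_self_add
  have e2 : wsq (eS k) (freqVW τ (V t) (W t)) ≤ E := by
    refine le_trans ?_ hE
    unfold freqEnergy; simp only [add_assoc]; exact le_add_left le_self_add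
  exact
    { q_le := key _ _ e1
      y_le := key _ _ e2
      v_le := by simpa only [enorm_mulA] using key (mulA (V t)) _ (d1.trans hD)
      w_le := key _ _ (d5.trans hD)
      q_le' := by simpa only [enorm_mulA] using key (mulA (freqPV τ (P t) (V t))) _ (d2.trans hD)
      y_le' := by simpa only [enorm_mulA] using key (mulA (freqVW τ (V t) (W t))) _ (d3.trans hD)
      v_le' := by simpa only [enorm_mulA] using key (mulA (mulA (V t))) _ (d4.trans hD)
      v_diss := by simpa only [enorm_mulA] using key (mulA (V t)) _ d1
      q_diss := by simpa only [enorm_mulA] using key (mulA (freqPV τ (P t) (V t))) _ d2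
      y_diss := by simpa only [enorm_mulA] using key (mulA (freqVW τ (V t) (W t))) _ d3
      v_diss' := by simpa only [enorm_mulA] using key (mulA (mulA (V t))) _ d4
      w_diss := key _ _ d5 }

/-! ### Testing the nonlinearity -/

/-- The function against which the nonlinearity is tested, on the Fourier side. -/
def freqTest (τ l ε : ℝ) (P V W : Rn n → ℂ) (ξ : Rn n) : ℂ :=
  ((l * (freqVW τ V W ξ + (1 : ℝ) * mulA (mulA (freqVW τ V W)) ξ)
    + (1 : ℝ) * mulA (freqPV τ P V) ξ) + (-(2 * τ) : ℝ) * mulA (mulA V) ξ) + ε * W ξ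

theorem testElement_ae (k N : ℕ) (τ l ε : ℝ) (P V W : ℝ → CL2 n) (t : ℝ) :
    (testElement (aMult n N).opR τ l ε (fun r => (sMult n k N).opR (P r))
      (fun r => (sMult n k N).opR (V r)) (fun r => (sMult n k N).opR (W r)) t : CL2 n) =ᵐ[volume]
      fun ξ => sMult n k N ξ * freqTest τ l ε (P t) (V t) (W t) ξ := by
  have hv := (sMult n k N).coeFn_opR (V t)
  have hw := (sMult n k N).coeFn_opR (W t)
  have hvw := freqVW_ae k N τ (V t) (W t)
  have hpv := freqPV_ae k N τ (P t) (V t)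
  -- The combination lemma produces u + c·u', so a pure multiple by `l` is built on the zero
  -- function.
  have h0 : (0 : CL2 n) =ᵐ[volume] fun ξ => sMult n k N ξ * (0 : ℂ) := by
    filter_upwards [Lp.coeFn_zero ℂ 2 (volume : Measure (Rn n))] with ξ hξ
    rw [hξ]; simp
  have a1 := add_smul_eq_sMult_mul hvw (aMult_eq_sMult_mul (aMult_eq_sMult_mul hvw)) 1
  have a2 := add_smul_eq_sMult_mul h0 a1 l
  have a3 := add_smul_eq_sMult_mul a2 (aMult_eq_sMult_mul hpv) 1
  have a4 := add_smul_eq_sMult_mul a3 (aMult_eq_sMult_mul (aMult_eq_sMult_mul hv)) (-(2 * τ))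
  have a5 := add_smul_eq_sMult_mul a4 hw ε
  simp only [zero_add, one_smul, neg_smul, ← sub_eq_add_neg] at a5
  exact a5

theorem enorm_freqTest_le {τ l ε : ℝ} {c : ℝ≥0∞} (h1 : 1 ≤ c) (hl : ‖l‖ₑ ≤ c)
    (hτ : ‖2 * τ‖ₑ ≤ c) (hε : ‖ε‖ₑ ≤ c) (P V W : Rn n → ℂ) (ξ : Rn n) :
    ‖freqTest τ l ε P V W ξ‖ₑ ≤ c * (‖freqVW τ V W ξ‖ₑ + eA ξ * (eA ξ * ‖freqVW τ V W ξ‖ₑ)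
      + eA ξ * ‖freqPV τ P V ξ‖ₑ + eA ξ * (eA ξ * ‖V ξ‖ₑ) + ‖W ξ‖ₑ) := by
  have hr : ∀ r : ℝ, ‖(r : ℂ)‖ₑ = ‖r‖ₑ := fun r => by
    rw [← ofReal_norm, Complex.norm_real, ofReal_norm]
  simp only [← enorm_mulA]
  unfold freqTest
  calc _ ≤ ‖(l : ℂ)‖ₑ * (‖freqVW τ V W ξ‖ₑ + ‖((1 : ℝ) : ℂ)‖ₑ *
        ‖mulA (mulA (freqVW τ V W)) ξ‖ₑ) + ‖((1 : ℝ) : ℂ)‖ₑ * ‖mulA (freqPV τ P V) ξ‖ₑ +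
        ‖((-(2 * τ) : ℝ) : ℂ)‖ₑ * ‖mulA (mulA V) ξ‖ₑ + ‖(ε : ℂ)‖ₑ * ‖W ξ‖ₑ := by
        simp only [← enorm_mul]
        refine (enorm_add_le _ _).trans (add_le_add ((enorm_add_le _ _).trans
          (add_le_add ((enorm_add_le _ _).trans (add_le_add ?_ le_rfl)) le_rfl)) le_rfl)
        rw [enorm_mul]
        exact mul_le_mul' le_rfl (enorm_add_le _ _)
    _ ≤ c * (‖freqVW τ V W ξ‖ₑ + 1 * ‖mulA (mulA (freqVW τ V W)) ξ‖ₑ) +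
        c * ‖mulA (freqPV τ P V) ξ‖ₑ + c * ‖mulA (mulA V) ξ‖ₑ + c * ‖W ξ‖ₑ := by
        simp only [hr, enorm_neg]
        gcongr <;> simp [h1]
    _ = _ := by ring

theorem ofReal_inner_le (f g : CL2 n) :
    ENNReal.ofReal (inner ℝ f g) ≤ ∫⁻ ξ, ‖f ξ‖ₑ * ‖g ξ‖ₑ := by
  rw [L2.inner_def]
  calc ENNReal.ofReal (∫ ξ, inner ℝ (f ξ) (g ξ)) ≤ ‖∫ ξ, inner ℝ (f ξ) (g ξ)‖ₑ :=
        Real.ofReal_le_enorm _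
    _ ≤ ∫⁻ ξ, ‖inner ℝ (f ξ) (g ξ)‖ₑ := enorm_integral_le_lintegral_enorm _
    _ ≤ _ := by
        refine lintegral_mono fun ξ => ?_
        simp only
        rw [← ofReal_norm, ← ofReal_norm, ← ofReal_norm, ← ENNReal.ofReal_mul (norm_nonneg _)]
        exact ENNReal.ofReal_le_ofReal (norm_inner_le_norm _ _)

/-- Both factors of the inner product carry the truncated multiplier, so its square appears and is
at most the full weight `eS`. The bound is consequently independent of the cutoff `N`. -/
theorem ofReal_inner_testElement_le (hn : 3 ≤ n) {k : ℕ} {τ l ε : ℝ} {h : ℝ → ℝ} {c E : ℝ≥0∞}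
    {P V W : ℝ → CL2 n} {Nh : CL2 n} {t : ℝ} (N : ℕ) (hτ0 : 0 < τ) (h1 : 1 ≤ c) (hl : ‖l‖ₑ ≤ c)
    (hτ : ‖2 * τ‖ₑ ≤ c) (hτi : ‖τ⁻¹‖ₑ ≤ c) (hε : ‖ε‖ₑ ≤ c)
    (hE : freqEnergy (eS k) τ h P V W t ≤ E)
    (hN : ∀ᵐ ξ, ‖Nh ξ‖ₑ ≤ c * (conv (fun η => ‖V t η‖ₑ) (fun η => ‖W t η‖ₑ) ξ +
      conv (fun η => ‖P t η‖ₑ) (fun η => eA η * ‖V t η‖ₑ) ξ)) :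
    ENNReal.ofReal (inner ℝ ((sMult n k N).opR Nh) (testElement (aMult n N).opR τ l ε
      (fun r => (sMult n k N).opR (P r)) (fun r => (sMult n k N).opR (V r))
      (fun r => (sMult n k N).opR (W r)) t)) ≤
      nonlinConst n k c * (2 ^ (2 * k + 1) * E) ^ (1 / 2 : ℝ) *
        (2 ^ (2 * k + 1) * freqDiss (eS k) τ h P V W t) := by
  have mP := measurable_CL2 (P t)
  have mV := measurable_CL2 (V t)
  have mW := measurable_CL2 (W t)
  have mN := measurable_CL2 Nh
  have hτc : ‖τ‖ₑ ≤ c := by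
    refine le_trans ?_ hτ
    rw [← ofReal_norm, ← ofReal_norm]
    refine ENNReal.ofReal_le_ofReal ?_
    rw [Real.norm_of_nonneg hτ0.le, Real.norm_of_nonneg (by positivity)]
    linarith
  have hr : ∀ r : ℝ, ‖(r : ℂ)‖ₑ = ‖r‖ₑ := fun r => by
    rw [← ofReal_norm, Complex.norm_real, ofReal_norm]
  have hpq : ∀ ξ, ‖P t ξ‖ₑ ≤ ‖freqPV τ (P t) (V t) ξ‖ₑ + c * (eA ξ * ‖V t ξ‖ₑ) := fun ξ => by
    have e : P t ξ = freqPV τ (P t) (V t) ξ - τ * mulA (V t) ξ := by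
      simp only [freqPV, mulA]; ring
    rw [← enorm_mulA]
    calc ‖P t ξ‖ₑ ≤ ‖freqPV τ (P t) (V t) ξ‖ₑ + ‖(τ : ℂ) * mulA (V t) ξ‖ₑ := by
          conv_lhs => rw [e]
          exact enorm_sub_le
      _ ≤ _ := by rw [enorm_mul, hr]; gcongr
  have hwy : ∀ ξ, ‖W t ξ‖ₑ ≤ c * (‖freqVW τ (V t) (W t) ξ‖ₑ + ‖V t ξ‖ₑ) := fun ξ => by
    have e : W t ξ = ((τ⁻¹ : ℝ) : ℂ) * (freqVW τ (V t) (W t) ξ - V t ξ) := by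
      have : (τ : ℂ) ≠ 0 := by exact_mod_cast hτ0.ne'
      simp only [freqVW]; push_cast; field_simp; ring
    calc ‖W t ξ‖ₑ = ‖τ⁻¹‖ₑ * ‖freqVW τ (V t) (W t) ξ - V t ξ‖ₑ := by
          conv_lhs => rw [e]
          rw [enorm_mul, hr]
      _ ≤ _ := mul_le_mul' hτi enorm_sub_le
  refine (ofReal_inner_le _ _).trans ?_
  have key := (freqBounds_of_freqEnergy hE).lintegral_nonlinear_le (c := c) hn
    (p := fun ξ => ‖P t ξ‖ₑ) (N := fun ξ => ‖Nh ξ‖ₑ) mP.enorm mV.enorm mW.enorm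
    (measurable_freqPV τ mP mV).enorm (measurable_freqVW τ mV mW).enorm mN.enorm
    (Filter.Eventually.of_forall hpq) (Filter.Eventually.of_forall hwy) hN
  rw [rpow_half_sq] at key
  refine le_trans (lintegral_mono_ae ?_) key
  filter_upwards [(sMult n k N).coeFn_opR Nh, testElement_ae k N τ l ε P V W t] with ξ a1 a2
  rw [a1, a2, enorm_mul, enorm_mul]
  calc ‖sMult n k N ξ‖ₑ * ‖Nh ξ‖ₑ * (‖sMult n k N ξ‖ₑ * ‖freqTest τ l ε (P t) (V t) (W t) ξ‖ₑ)
      = ‖sMult n k N ξ‖ₑ ^ 2 * ‖Nh ξ‖ₑ * ‖freqTest τ l ε (P t) (V t) (W t) ξ‖ₑ := by ring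
    _ ≤ _ := by
      rw [enorm_sMult_sq]
      exact mul_le_mul' (mul_le_mul' (cutS_le k N ξ) le_rfl)
        (enorm_freqTest_le h1 hl hτ hε (P t) (V t) (W t) ξ)

/-! ### The energy estimate on the Fourier side -/

section FrequencyLimit

variable {τ a β M ζ T : ℝ} {g h : ℝ → ℝ} {P V W Nh : ℝ → CL2 n} {k : ℕ}

theorem aemeasurable_freqDiss_cut (hh : IntegrableOn h (Ioi 0)) (hh0 : ∀ s > 0, 0 ≤ h s)
    (hP : Continuous P) {N : ℕ}
    (hS : IsLinearSolution (aMult n N).opR τ a β M g T (fun r => (sMult n k N).opR (P r))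
      (fun r => (sMult n k N).opR (V r)) (fun r => (sMult n k N).opR (W r))
      (fun r => (sMult n k N).opR (Nh r))) :
    AEMeasurable (fun r => freqDiss (cutS k N) τ h P V W r) (volume.restrict (Icc 0 T)) := by
  have h1 := ((hS.continuousOn_linDiss hh).aemeasurable (μ := volume)
    measurableSet_Icc).ennreal_ofReal
  refine h1.congr ?_
  refine (ae_restrict_iff' measurableSet_Icc).2 (Filter.Eventually.of_forall fun r hr => ?_)
  exact ofReal_linDiss hh hh0 hP hr.1

theorem aemeasurable_freqDiss (hh : IntegrableOn h (Ioi 0)) (hh0 : ∀ s > 0, 0 ≤ h s)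
    (hP : Continuous P)
    (hS : ∀ N, IsLinearSolution (aMult n N).opR τ a β M g T (fun r => (sMult n k N).opR (P r))
      (fun r => (sMult n k N).opR (V r)) (fun r => (sMult n k N).opR (W r))
      (fun r => (sMult n k N).opR (Nh r))) :
    AEMeasurable (fun r => freqDiss (eS k) τ h P V W r) (volume.restrict (Icc 0 T)) :=
  aemeasurable_of_tendsto_metrizable_ae Filter.atTop
    (fun N => aemeasurable_freqDiss_cut hh hh0 hP (hS N))
    (Filter.Eventually.of_forall fun r => tendsto_freqDiss hh hP r)

theorem tendsto_lintegral_freqDiss (hh : IntegrableOn h (Ioi 0)) (hh0 : ∀ s > 0, 0 ≤ h s)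
    (hP : Continuous P)
    (hS : ∀ N, IsLinearSolution (aMult n N).opR τ a β M g T (fun r => (sMult n k N).opR (P r))
      (fun r => (sMult n k N).opR (V r)) (fun r => (sMult n k N).opR (W r))
      (fun r => (sMult n k N).opR (Nh r))) {t : ℝ} (ht : t ∈ Icc 0 T) :
    Filter.Tendsto (fun N => ∫⁻ r in Icc 0 t, freqDiss (cutS k N) τ h P V W r) Filter.atTop
      (nhds (∫⁻ r in Icc 0 t, freqDiss (eS k) τ h P V W r)) := by
  refine lintegral_tendsto_of_tendsto_of_monotone (fun N => ?_) ?_ ?_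
  · exact (aemeasurable_freqDiss_cut hh hh0 hP (hS N)).mono_measure
      (Measure.restrict_mono (Icc_subset_Icc_right ht.2) le_rfl)
  · exact Filter.Eventually.of_forall fun r N N' hN =>
      freqDiss_mono (fun ξ => cutS_mono k ξ hN) τ h P V W r
  · exact Filter.Eventually.of_forall fun r => tendsto_freqDiss hh hP r

theorem ofReal_intervalIntegral_eq {f : ℝ → ℝ} {t : ℝ} (ht : 0 ≤ t) (hf : IntegrableOn f (Icc 0 t))
    (hf0 : ∀ r ∈ Icc 0 t, 0 ≤ f r) :
    ENNReal.ofReal (∫ r in (0 : ℝ)..t, f r) = ∫⁻ r in Icc 0 t, ENNReal.ofReal (f r) := by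
  rw [intervalIntegral.integral_of_le ht, ← integral_Icc_eq_integral_Ioc,
    ofReal_integral_eq_lintegral_ofReal hf]
  exact (ae_restrict_iff' measurableSet_Icc).2 (Filter.Eventually.of_forall hf0)

end FrequencyLimit

/-- The linear inequality is applied to every truncation with the same forcing bound, a multiple of
E^{1/2} times the full dissipation. Its right-hand side does not depend on the cutoff, and the
left-hand side converges monotonically. Finiteness of `E` is needed because the linear inequality is
real valued. -/
theorem exists_freqEnergy_estimate (hn : 3 ≤ n) {k : ℕ} (hk : n < 2 * (k + 1))
    {τ a β M ζ : ℝ} (hτ : 0 < τ) (ha : 0 < a) (hβ : 0 < β) (hM : 0 < M) (hζ : 0 < ζ)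
    {c₀ : ℝ≥0∞} (hc₀ : c₀ < ⊤) :
    ∃ C : ℝ≥0∞, C < ⊤ ∧ ∀ (g h : ℝ → ℝ) (T : ℝ) (P V W Nh : ℝ → CL2 n) (E : ℝ≥0∞),
      0 ≤ T → Continuous P → IsHistKernel g h M ζ →
      (∀ N, IsLinearSolution (aMult n N).opR τ a β M g T (fun r => (sMult n k N).opR (P r))
        (fun r => (sMult n k N).opR (V r)) (fun r => (sMult n k N).opR (W r))
        (fun r => (sMult n k N).opR (Nh r))) →
      E < ⊤ → (∀ t ∈ Icc 0 T, freqEnergy (eS k) τ h P V W t ≤ E) →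
      (∀ t ∈ Icc 0 T, ∀ᵐ ξ, ‖Nh t ξ‖ₑ ≤ c₀ *
        (conv (fun η => ‖V t η‖ₑ) (fun η => ‖W t η‖ₑ) ξ +
          conv (fun η => ‖P t η‖ₑ) (fun η => eA η * ‖V t η‖ₑ) ξ)) →
      ∀ t ∈ Icc 0 T, freqEnergy (eS k) τ h P V W t + ∫⁻ r in Icc 0 t, freqDiss (eS k) τ h P V W r ≤
        C * (freqEnergy (eS k) τ h P V W 0 +
          E ^ (1 / 2 : ℝ) * ∫⁻ r in Icc 0 T, freqDiss (eS k) τ h P V W r) := by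
  obtain ⟨l, ε, C₁, -, -, hC₁, hmain⟩ := exists_energy_inequality hτ ha hβ hM hζ
  -- A single constant dominates the coefficients of the nonlinearity and of the test element, and
  -- those of the relations that recover p and w.
  set c : ℝ≥0∞ := c₀ + 1 + ‖l‖ₑ + ‖2 * τ‖ₑ + ‖τ⁻¹‖ₑ + ‖ε‖ₑ with hc
  have hct : c < ⊤ := by
    rw [hc]
    simp only [ENNReal.add_lt_top]
    exact ⟨⟨⟨⟨⟨hc₀, ENNReal.one_lt_top⟩, enorm_lt_top⟩, enorm_lt_top⟩, enorm_lt_top⟩, enorm_lt_top⟩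
  have k0 : c₀ ≤ c := by rw [hc]; simp only [add_assoc]; exact le_self_add
  have k1 : 1 ≤ c := by rw [hc]; simp only [add_assoc]; exact le_add_left le_self_add
  have k2 : ‖l‖ₑ ≤ c := by
    rw [hc]; simp only [add_assoc]; exact le_add_left (le_add_left le_self_add)
  have k3 : ‖2 * τ‖ₑ ≤ c := by
    rw [hc]; simp only [add_assoc]
    exact le_add_left (le_add_left (le_add_left le_self_add))
  have k4 : ‖τ⁻¹‖ₑ ≤ c := by
    rw [hc]; simp only [add_assoc]
    exact le_add_left (le_add_left (le_add_left (le_add_left le_self_add)))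
  have k5 : ‖ε‖ₑ ≤ c := by rw [hc]; exact le_add_self
  clear_value c
  set q : ℝ≥0∞ := 2 ^ (2 * k + 1) with hq
  have hqt : q < ⊤ := ENNReal.pow_lt_top (by norm_num)
  clear_value q
  set B : ℝ≥0∞ := nonlinConst n k c * q ^ (1 / 2 : ℝ) * q with hB
  have hBt : B < ⊤ := ENNReal.mul_lt_top (ENNReal.mul_lt_top (nonlinConst_lt_top hn hk hct)
    (ENNReal.rpow_lt_top_of_nonneg (by norm_num) hqt.ne)) hqt
  refine ⟨ENNReal.ofReal C₁ * (1 + B), ENNReal.mul_lt_top ENNReal.ofReal_lt_top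
    (ENNReal.add_lt_top.2 ⟨ENNReal.one_lt_top, hBt⟩), ?_⟩
  intro g h T P V W Nh E hT hP hK hS hEt hE hN t ht
  have hh := hK.integrable_deriv
  have hh0 := hK.deriv_nonneg
  set D : ℝ → ℝ≥0∞ := fun r => freqDiss (eS k) τ h P V W r with hD
  have hDm : AEMeasurable D (volume.restrict (Icc 0 T)) := aemeasurable_freqDiss hh hh0 hP hS
  have hDE : ∀ r ∈ Icc 0 T, D r ≤ E := fun r hr =>
    (freqDiss_le_freqEnergy (eS k) τ h P V W r).trans (hE r hr)
  -- The forcing bound is finite on [0, T] because the dissipation is at most the energy, hence at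
  -- most `E`; it may therefore be converted to a real function.
  set X : ℝ → ℝ≥0∞ := fun r => B * E ^ (1 / 2 : ℝ) * D r with hX
  have hEh : E ^ (1 / 2 : ℝ) < ⊤ := ENNReal.rpow_lt_top_of_nonneg (by norm_num) hEt.ne
  have hXt : ∀ r ∈ Icc 0 T, X r < ⊤ := fun r hr =>
    ENNReal.mul_lt_top (ENNReal.mul_lt_top hBt hEh) ((hDE r hr).trans_lt hEt)
  have hXint : ∫⁻ r in Icc 0 T, X r = B * (E ^ (1 / 2 : ℝ) * ∫⁻ r in Icc 0 T, D r) := by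
    rw [hX, lintegral_const_mul'' _ hDm, mul_assoc]
  have hDfin : ∫⁻ r in Icc 0 T, D r < ⊤ := by
    calc ∫⁻ r in Icc 0 T, D r ≤ ∫⁻ _ in Icc 0 T, E := setLIntegral_mono' measurableSet_Icc hDE
      _ < ⊤ := by
        rw [setLIntegral_const]
        exact ENNReal.mul_lt_top hEt (by simp)
  have hφ : IntegrableOn (fun r => (X r).toReal) (Icc 0 T) := by
    refine integrable_toReal_of_lintegral_ne_top (hDm.const_mul _) ?_
    rw [hXint]
    exact (ENNReal.mul_lt_top hBt (ENNReal.mul_lt_top hEh hDfin)).ne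
  have hφe : ∀ r ∈ Icc 0 T, ENNReal.ofReal (X r).toReal = X r := fun r hr =>
    ENNReal.ofReal_toReal (hXt r hr).ne
  have hstep : ∀ N, freqEnergy (cutS k N) τ h P V W t +
      ∫⁻ r in Icc 0 t, freqDiss (cutS k N) τ h P V W r ≤ ENNReal.ofReal C₁ * (1 + B) *
        (freqEnergy (eS k) τ h P V W 0 + E ^ (1 / 2 : ℝ) * ∫⁻ r in Icc 0 T, D r) := by
    intro N
    have h1 := hmain (CL2 n) (aMult n N).opR g h T _ _ _ _ (fun r => (X r).toReal) (hS N) hK hφ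
      (fun _ => ENNReal.toReal_nonneg) (fun r hr => by
        rw [← ENNReal.ofReal_le_iff_le_toReal (hXt r hr).ne]
        refine (ofReal_inner_testElement_le hn N hτ k1 k2 k3 k4 k5 (hE r hr) ?_).trans
          (le_of_eq ?_)
        · filter_upwards [hN r hr] with ξ hξ
          exact hξ.trans (mul_le_mul' k0 le_rfl)
        · rw [← hq, ENNReal.mul_rpow_of_nonneg _ _ (by norm_num), hX, hB]
          simp only [hD]
          ring) t ht
    have hcont := (hS N).continuousOn_linDiss hh
    have hsub : Icc 0 t ⊆ Icc 0 T := Icc_subset_Icc_right ht.2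
    have hint : IntegrableOn (linDiss (aMult n N).opR τ h (fun r => (sMult n k N).opR (P r))
        (fun r => (sMult n k N).opR (V r)) (fun r => (sMult n k N).opR (W r))) (Icc 0 t) :=
      (hcont.mono hsub).integrableOn_Icc
    have hd0 : ∀ r, 0 ≤ linDiss (aMult n N).opR τ h (fun r => (sMult n k N).opR (P r))
        (fun r => (sMult n k N).opR (V r)) (fun r => (sMult n k N).opR (W r)) r := fun r =>
      linDiss_nonneg hh0 r
    have h2 := ENNReal.ofReal_le_ofReal h1
    have hI0 : 0 ≤ ∫ r in (0 : ℝ)..t, linDiss (aMult n N).opR τ h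
        (fun r => (sMult n k N).opR (P r)) (fun r => (sMult n k N).opR (V r))
        (fun r => (sMult n k N).opR (W r)) r :=
      intervalIntegral.integral_nonneg ht.1 fun r _ => hd0 r
    have hφ0 : 0 ≤ ∫ r in (0 : ℝ)..t, (X r).toReal :=
      intervalIntegral.integral_nonneg ht.1 fun r _ => ENNReal.toReal_nonneg
    have hE0 : ∀ r, 0 ≤ linEnergy (aMult n N).opR τ h (fun r => (sMult n k N).opR (P r))
        (fun r => (sMult n k N).opR (V r)) (fun r => (sMult n k N).opR (W r)) r := fun r => by
      have q1 := histSq_nonneg (p := fun r => (sMult n k N).opR (P r)) hh0 r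
      have q2 := histSq_nonneg (p := fun r => (aMult n N).opR ((sMult n k N).opR (P r))) hh0 r
      unfold linEnergy
      positivity
    rw [ENNReal.ofReal_add (hE0 t) hI0, ENNReal.ofReal_mul hC₁.le,
      ENNReal.ofReal_add (hE0 0) hφ0, ofReal_linEnergy hh hh0 hP ht.1,
      ofReal_linEnergy hh hh0 hP le_rfl, ofReal_intervalIntegral_eq ht.1 hint fun r _ => hd0 r,
      ofReal_intervalIntegral_eq ht.1 (hφ.mono_set hsub) fun r _ => ENNReal.toReal_nonneg] at h2
    rw [setLIntegral_congr_fun measurableSet_Icc fun r hr => ofReal_linDiss hh hh0 hP hr.1,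
      setLIntegral_congr_fun measurableSet_Icc fun r hr => hφe r (hsub hr)] at h2
    refine h2.trans ?_
    rw [mul_assoc]
    refine mul_le_mul' le_rfl ?_
    calc freqEnergy (cutS k N) τ h P V W 0 + ∫⁻ r in Icc 0 t, X r
        ≤ freqEnergy (eS k) τ h P V W 0 + ∫⁻ r in Icc 0 T, X r :=
          add_le_add (freqEnergy_mono (cutS_le k N) τ h P V W 0)
            (lintegral_mono_set hsub)
      _ = freqEnergy (eS k) τ h P V W 0 + B * (E ^ (1 / 2 : ℝ) * ∫⁻ r in Icc 0 T, D r) := by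
          rw [hXint]
      _ ≤ freqEnergy (eS k) τ h P V W 0 + B * (E ^ (1 / 2 : ℝ) * ∫⁻ r in Icc 0 T, D r) +
          (B * freqEnergy (eS k) τ h P V W 0 + E ^ (1 / 2 : ℝ) * ∫⁻ r in Icc 0 T, D r) :=
          le_self_add
      _ = _ := by ring
  exact le_of_tendsto' ((tendsto_freqEnergy hh hP t).add
    (tendsto_lintegral_freqDiss hh hh0 hP hS ht)) hstep

/-! ### Energy and dissipation of a solution on the Fourier side -/

section Sums

variable {K : ℕ} {f : Rn n → ℝ} {σ G : Rn n → ℂ}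

/-- The sum over κ goes inside the Plancherel integral and becomes the weight `eS K`; the j extra
derivatives are absorbed into `G`. -/
theorem sum_gradSq_eq {j : ℕ} (h : ∀ κ ≤ K, HasSymbol (κ + j) f σ) (hσ : Measurable σ)
    (hG : ∀ᵐ ξ, ‖G ξ‖ₑ = eA ξ ^ j * ‖σ ξ‖ₑ) :
    ∑ κ ∈ Finset.range (K + 1), gradSq (κ + j) f = wsq (eS K) G := by
  have h1 : ∀ κ ∈ Finset.range (K + 1), gradSq (κ + j) f =
      ∫⁻ ξ, eA ξ ^ (2 * (κ + j)) * ‖σ ξ‖ₑ ^ 2 := fun κ hκ =>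
    (h κ (Nat.lt_succ_iff.1 (Finset.mem_range.1 hκ))).gradSq_eq
  rw [Finset.sum_congr rfl h1, ← lintegral_finsetSum _ fun κ _ => by fun_prop]
  refine lintegral_congr_ae ?_
  filter_upwards [hG] with ξ hξ
  rw [hξ, eS, Finset.sum_mul]
  refine Finset.sum_congr rfl fun κ _ => ?_
  ring

theorem sum_lapGradSq_eq (h : ∀ κ ≤ K, HasSymbol (κ + 2) f σ) (hσ : Measurable σ)
    (hG : ∀ᵐ ξ, ‖G ξ‖ₑ = eA ξ ^ 2 * ‖σ ξ‖ₑ) :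
    ∑ κ ∈ Finset.range (K + 1), lapGradSq κ f = wsq (eS K) G := by
  rw [← sum_gradSq_eq h hσ hG]
  refine Finset.sum_congr rfl fun κ hκ => ?_
  have h1 := h κ (Nat.lt_succ_iff.1 (Finset.mem_range.1 hκ))
  rw [h1.lapGradSq_eq, h1.gradSq_eq]
  rfl

end Sums

theorem HasSymbol.congr_symbol {κ : ℕ} {f : Rn n → ℝ} {σ σ' : Rn n → ℂ} (h : HasSymbol κ f σ)
    (hσ : σ =ᵐ[volume] σ') : HasSymbol κ f σ' := fun α => by
  obtain ⟨d, hd, he⟩ := h α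
  refine ⟨d, hd, ?_⟩
  filter_upwards [he, hσ] with ξ h1 h2
  rw [h1, h2]

/-- The projection of `ℝ` onto `[0, T]`. -/
def clamp (T t : ℝ) : ℝ := max 0 (min t T)

theorem clamp_mem {T : ℝ} (hT : 0 ≤ T) (t : ℝ) : clamp T t ∈ Icc 0 T :=
  ⟨le_max_left _ _, max_le hT (min_le_right _ _)⟩

theorem clamp_of_mem {T t : ℝ} (ht : t ∈ Icc 0 T) : clamp T t = t := by
  rw [clamp, min_eq_left ht.2, max_eq_right ht.1]

/-- The abstract history and the linear system use curves continuous on all of ℝ. Freezing a curve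
outside [0, T] provides this without affecting the values that enter. -/
theorem continuous_comp_clamp {X : Type*} [TopologicalSpace X] {T : ℝ} (hT : 0 ≤ T) {f : ℝ → X}
    (hf : ContinuousOn f (Icc 0 T)) : Continuous fun t => f (clamp T t) :=
  hf.comp_continuous (by unfold clamp; fun_prop) (clamp_mem hT)

theorem hist_clamp {X : Type*} [NormedAddCommGroup X] {T : ℝ} (f : ℝ → X) {t s : ℝ}
    (ht : t ∈ Icc 0 T) (hs : 0 < s) :
    hist (fun r => f (clamp T r)) t s = if s ≤ t then f t - f (t - s) else f t := by
  unfold hist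
  simp only [clamp_of_mem ht]
  split_ifs with h
  · rw [clamp_of_mem ⟨by linarith, by linarith [ht.2]⟩]
  · rfl

/-- The Fourier transform of `(-Δ)^{1/2} ψ` along a solution. -/
def curveP (T : ℝ) (Ψ : ℝ → State n) (t : ℝ) : CL2 n := gradFt (Ψ (clamp T t)).psi

/-- The Fourier transform of `v` along a solution. -/
def curveV (T : ℝ) (Ψ : ℝ → State n) (t : ℝ) : CL2 n := ft n (Ψ (clamp T t)).v

/-- The Fourier transform of `w` along a solution. -/
def curveW (T : ℝ) (Ψ : ℝ → State n) (t : ℝ) : CL2 n := ft n (Ψ (clamp T t)).w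

namespace IsSolution

variable {m : ℕ} {τ b c k : ℝ} {g : ℝ → ℝ} {T : ℝ} {Ψ : ℝ → State n}

theorem continuousOn_v (hS : IsSolution m τ b c k g T Ψ) :
    ContinuousOn (fun t => (Ψ t).v) (Icc 0 T) := by
  have h := hS.cont_v.2 0 le_rfl (Nat.zero_le m) Fin.elim0
  simpa only [weakDeriv_zero_eq] using h

theorem continuousOn_w (hS : IsSolution m τ b c k g T Ψ) :
    ContinuousOn (fun t => (Ψ t).w) (Icc 0 T) := by
  have h := hS.cont_w.2 0 le_rfl (Nat.zero_le _) Fin.elim0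
  simpa only [weakDeriv_zero_eq] using h

theorem continuousOn_gradFt (hS : IsSolution m τ b c k g T Ψ) (hm : 3 ≤ m) :
    ContinuousOn (fun t => gradFt (Ψ t).psi) (Icc 0 T) := by
  unfold gradFt
  refine continuousOn_finsetSum _ fun j _ => ?_
  exact ((rieszMult j).op.continuous.comp (ft n).continuous).comp_continuousOn
    (hS.cont_psi.2 1 le_rfl (by omega) fun _ => j)

theorem continuousOn_lap (hS : IsSolution m τ b c k g T Ψ) (hm : 3 ≤ m) :
    ContinuousOn (fun t => lap (Ψ t).psi) (Icc 0 T) := by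
  unfold lap lapDeriv
  exact continuousOn_finsetSum _ fun j _ => hS.cont_psi.2 2 (by norm_num) (by omega) _

theorem continuous_curveP (hS : IsSolution m τ b c k g T Ψ) (hm : 3 ≤ m) (hT : 0 ≤ T) :
    Continuous (curveP T Ψ) := continuous_comp_clamp hT (hS.continuousOn_gradFt hm)

theorem continuous_curveV (hS : IsSolution m τ b c k g T Ψ) (hT : 0 ≤ T) :
    Continuous (curveV T Ψ) :=
  (ft n).continuous.comp (continuous_comp_clamp hT hS.continuousOn_v)

theorem continuous_curveW (hS : IsSolution m τ b c k g T Ψ) (hT : 0 ≤ T) :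
    Continuous (curveW T Ψ) :=
  (ft n).continuous.comp (continuous_comp_clamp hT hS.continuousOn_w)

section Symbols

variable {t : ℝ} {κ : ℕ}

theorem hasSymbol_psi (hS : IsSolution m τ b c k g T Ψ) (hm : 3 ≤ m) (ht : t ∈ Icc 0 T)
    (hκ : κ + 1 ≤ m) : HasSymbol (κ + 1) (Ψ t).psi fun ξ => curveP T Ψ t ξ / (afun ξ : ℂ) := by
  have h := (hS.cont_psi.1 t ht).hasSymbol_grad (by omega) κ hκ
  simpa only [curveP, clamp_of_mem ht] using h

theorem hasSymbol_v (hS : IsSolution m τ b c k g T Ψ) (ht : t ∈ Icc 0 T) (hκ : κ ≤ m) :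
    HasSymbol κ (Ψ t).v (curveV T Ψ t) := by
  have h := (hS.cont_v.1 t ht).hasSymbol_L2 κ hκ
  simpa only [curveV, clamp_of_mem ht] using h

theorem hasSymbol_w (hS : IsSolution m τ b c k g T Ψ) (ht : t ∈ Icc 0 T) (hκ : κ ≤ m - 1) :
    HasSymbol κ (Ψ t).w (curveW T Ψ t) := by
  have h := (hS.cont_w.1 t ht).hasSymbol_L2 κ hκ
  simpa only [curveW, clamp_of_mem ht] using h

theorem hasSymbol_psiV (hS : IsSolution m τ b c k g T Ψ) (hm : 3 ≤ m) (ht : t ∈ Icc 0 T)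
    (hκ : κ + 1 ≤ m) : HasSymbol (κ + 1) ((Ψ t).psiV τ)
      fun ξ => curveP T Ψ t ξ / (afun ξ : ℂ) + τ * curveV T Ψ t ξ :=
  (hS.hasSymbol_psi hm ht hκ).add_const_mul (hS.hasSymbol_v ht hκ) τ

theorem hasSymbol_vW (hS : IsSolution m τ b c k g T Ψ) (ht : t ∈ Icc 0 T) (hκ : κ ≤ m - 1) :
    HasSymbol κ ((Ψ t).vW τ) (freqVW τ (curveV T Ψ t) (curveW T Ψ t)) :=
  (hS.hasSymbol_v ht (by omega)).add_const_mul (hS.hasSymbol_w ht hκ) τ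

theorem eta_ae (hS : IsSolution m τ b c k g T Ψ) (ht : t ∈ Icc 0 T) :
    ∀ᵐ s ∂(volume.restrict (Ioi (0 : ℝ))), 0 < s ∧ (Ψ t).eta s =ᵐ[volume]
      fun x => if s ≤ t then (Ψ t).psi x + (-1) * (Ψ (t - s)).psi x else (Ψ t).psi x := by
  filter_upwards [hS.eq_eta t ht, ae_restrict_mem measurableSet_Ioi] with s hs hs0
  refine ⟨hs0, ?_⟩
  filter_upwards [hs] with x hx
  rw [hx]
  split_ifs <;> ring

/-- Along characteristics η is a difference of two values of ψ, or ψ(t) itself. Its symbol is hence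
the history of `curveP` divided by 2π|ξ|, with one null set of s for all orders. -/
theorem hasSymbol_eta (hS : IsSolution m τ b c k g T Ψ) (hm : 3 ≤ m) (ht : t ∈ Icc 0 T) :
    ∀ᵐ s ∂(volume.restrict (Ioi (0 : ℝ))), ∀ κ, κ + 1 ≤ m → HasSymbol (κ + 1) ((Ψ t).eta s)
      fun ξ => (hist (curveP T Ψ) t s : CL2 n) ξ / (afun ξ : ℂ) := by
  filter_upwards [hS.eta_ae ht] with s hs κ hκ
  obtain ⟨hs0, hs⟩ := hs
  unfold hist
  by_cases hst : s ≤ t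
  · simp only [if_pos hst] at hs ⊢
    have hts : t - s ∈ Icc 0 T := ⟨by linarith, by linarith [ht.2]⟩
    refine HasSymbol.congr_ae (HasSymbol.congr_symbol ((hS.hasSymbol_psi hm ht hκ).add_const_mul
      (hS.hasSymbol_psi hm hts hκ) (-1)) ?_) hs.symm
    filter_upwards [Lp.coeFn_sub (curveP T Ψ t) (curveP T Ψ (t - s))] with ξ hξ
    rw [hξ, Pi.sub_apply]
    push_cast
    ring
  · simp only [if_neg hst] at hs ⊢
    exact (hS.hasSymbol_psi hm ht hκ).congr_ae hs.symm

/-- This supplies measurability in s of the seminorms of η and identifies Δη in the memory integral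
of the equation. -/
theorem weakDeriv_eta (hS : IsSolution m τ b c k g T Ψ) (ht : t ∈ Icc 0 T) :
    ∀ᵐ s ∂(volume.restrict (Ioi (0 : ℝ))), ∀ κ, 1 ≤ κ → κ ≤ m → ∀ α : Fin κ → Fin n,
      weakDeriv α ((Ψ t).eta s) = hist (fun r => weakDeriv α (Ψ (clamp T r)).psi) t s := by
  filter_upwards [hS.eta_ae ht] with s hs κ h1 hκ α
  obtain ⟨hs0, hs⟩ := hs
  rw [hist_clamp (fun r => weakDeriv α (Ψ r).psi) ht hs0]
  have hd : ∀ r ∈ Icc 0 T, HasWeakDeriv α (Ψ r).psi (weakDeriv α (Ψ r).psi) := fun r hr =>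
    weakDeriv_spec (hS.cont_psi.1 r hr κ h1 hκ α)
  by_cases hst : s ≤ t
  · simp only [if_pos hst] at hs ⊢
    have hts : t - s ∈ Icc 0 T := ⟨by linarith, by linarith [ht.2]⟩
    have h := (((hd t ht).add_const_mul (hd _ hts) (-1)).congr_ae hs.symm).weakDeriv_eq
    rw [h, neg_one_smul]
    exact (sub_eq_add_neg _ _).symm
  · simp only [if_neg hst] at hs ⊢
    exact ((hd t ht).congr_ae hs.symm).weakDeriv_eq

theorem lap_eta (hS : IsSolution m τ b c k g T Ψ) (hm : 3 ≤ m) (ht : t ∈ Icc 0 T) :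
    ∀ᵐ s ∂(volume.restrict (Ioi (0 : ℝ))),
      lap ((Ψ t).eta s) = hist (fun r => lap (Ψ (clamp T r)).psi) t s := by
  filter_upwards [hS.weakDeriv_eta ht] with s hs
  have h2 : ∀ j : Fin n, weakDeriv (Fin.cons j (Fin.cons j Fin.elim0) : Fin 2 → Fin n)
      ((Ψ t).eta s) = _ := fun j => hs 2 (by norm_num) (by omega) _
  unfold lap lapDeriv
  rw [Finset.sum_congr rfl fun j _ => h2 j]
  unfold hist
  split_ifs
  · rw [Finset.sum_sub_distrib]
  · rfl

theorem aemeasurable_gradSq_eta (hS : IsSolution m τ b c k g T Ψ) (hT : 0 ≤ T) (ht : t ∈ Icc 0 T)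
    (h1 : 1 ≤ κ) (hκ : κ ≤ m) :
    AEMeasurable (fun s => gradSq κ ((Ψ t).eta s)) (volume.restrict (Ioi (0 : ℝ))) := by
  unfold gradSq
  refine Finset.aemeasurable_fun_sum _ fun α _ => ?_
  have hm : Measurable fun s =>
      ‖hist (fun r => weakDeriv α (Ψ (clamp T r)).psi) t s‖ₑ ^ 2 :=
    ((stronglyMeasurable_hist (continuous_comp_clamp hT (hS.cont_psi.2 κ h1 hκ α))
      t).enorm).pow_const 2
  refine hm.aemeasurable.congr ?_
  filter_upwards [hS.weakDeriv_eta ht] with s hs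
  rw [hs κ h1 hκ α]

end Symbols

end IsSolution

theorem ae_afun_ne_zero (hn : 3 ≤ n) : ∀ᵐ ξ : Rn n, (afun ξ : ℂ) ≠ 0 := by
  filter_upwards [ae_eA_ne_zero hn] with ξ hξ h
  have h0 : afun ξ = 0 := by exact_mod_cast h
  exact hξ (by simp [eA, h0])

theorem HasSymbol.lapGradSq_eq_gradSq {κ : ℕ} {f : Rn n → ℝ} {σ : Rn n → ℂ}
    (h : HasSymbol (κ + 2) f σ) : lapGradSq κ f = gradSq (κ + 2) f := by
  rw [h.lapGradSq_eq, h.gradSq_eq]; rfl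

theorem measurable_div_afun {G : Rn n → ℂ} (hG : Measurable G) :
    Measurable fun ξ => G ξ / (afun ξ : ℂ) := by fun_prop

theorem enorm_eq_eA_mul_div {G : Rn n → ℂ} (hn : 3 ≤ n) :
    ∀ᵐ ξ, ‖G ξ‖ₑ = eA ξ ^ 1 * ‖G ξ / (afun ξ : ℂ)‖ₑ := by
  filter_upwards [ae_afun_ne_zero hn] with ξ hξ
  rw [pow_one, ← enorm_afun, ← enorm_mul, mul_div_cancel₀ _ hξ]

theorem enorm_mulA_eq_eA_mul_div {G : Rn n → ℂ} (hn : 3 ≤ n) :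
    ∀ᵐ ξ, ‖mulA G ξ‖ₑ = eA ξ ^ 2 * ‖G ξ / (afun ξ : ℂ)‖ₑ := by
  filter_upwards [enorm_eq_eA_mul_div (G := G) hn] with ξ hξ
  rw [enorm_mulA, hξ]; ring

/-- The symbol of ψ + τv has the same shape as that of ψ, with p + τAv in the place of p. -/
theorem freqPV_div (hn : 3 ≤ n) (τ : ℝ) (P V : Rn n → ℂ) :
    (fun ξ => P ξ / (afun ξ : ℂ) + τ * V ξ) =ᵐ[volume] fun ξ => freqPV τ P V ξ / (afun ξ : ℂ) := by
  filter_upwards [ae_afun_ne_zero hn] with ξ hξ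
  simp only [freqPV]
  field_simp

namespace IsSolution

variable {m : ℕ} {τ b c k : ℝ} {g : ℝ → ℝ} {T : ℝ} {Ψ : ℝ → State n} {t : ℝ}

theorem hasSymbol_psiV' (hS : IsSolution m τ b c k g T Ψ) (hn : 3 ≤ n) (hm : 3 ≤ m)
    (ht : t ∈ Icc 0 T) {κ : ℕ} (hκ : κ + 1 ≤ m) : HasSymbol (κ + 1) ((Ψ t).psiV τ)
      fun ξ => freqPV τ (curveP T Ψ t) (curveV T Ψ t) ξ / (afun ξ : ℂ) :=
  (hS.hasSymbol_psiV hm ht hκ).congr_symbol (freqPV_div hn τ _ _)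

theorem sum_gradSq_psi (hS : IsSolution m τ b c k g T Ψ) (hn : 3 ≤ n) (hm : 3 ≤ m)
    (ht : t ∈ Icc 0 T) : ∑ κ ∈ Finset.range (m - 2 + 1), gradSq (κ + 1) (Ψ t).psi =
      wsq (eS (m - 2)) (curveP T Ψ t) :=
  sum_gradSq_eq (fun κ hκ => hS.hasSymbol_psi hm ht (by omega))
    (measurable_div_afun (measurable_CL2 _)) (enorm_eq_eA_mul_div hn)

theorem sum_gradSq_psi' (hS : IsSolution m τ b c k g T Ψ) (hn : 3 ≤ n) (hm : 3 ≤ m)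
    (ht : t ∈ Icc 0 T) : ∑ κ ∈ Finset.range (m - 2 + 1), gradSq (κ + 2) (Ψ t).psi =
      wsq (eS (m - 2)) (mulA (curveP T Ψ t)) :=
  sum_gradSq_eq (fun κ hκ => hS.hasSymbol_psi hm ht (κ := κ + 1) (by omega))
    (measurable_div_afun (measurable_CL2 _)) (enorm_mulA_eq_eA_mul_div hn)

theorem sum_gradSq_psiV (hS : IsSolution m τ b c k g T Ψ) (hn : 3 ≤ n) (hm : 3 ≤ m)
    (ht : t ∈ Icc 0 T) : ∑ κ ∈ Finset.range (m - 2 + 1), gradSq (κ + 1) ((Ψ t).psiV τ) =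
      wsq (eS (m - 2)) (freqPV τ (curveP T Ψ t) (curveV T Ψ t)) :=
  sum_gradSq_eq (fun κ hκ => hS.hasSymbol_psiV' hn hm ht (by omega))
    (measurable_div_afun (measurable_freqPV τ (measurable_CL2 _) (measurable_CL2 _)))
    (enorm_eq_eA_mul_div hn)

theorem sum_lapGradSq_psiV (hS : IsSolution m τ b c k g T Ψ) (hn : 3 ≤ n) (hm : 3 ≤ m)
    (ht : t ∈ Icc 0 T) : ∑ κ ∈ Finset.range (m - 2 + 1), lapGradSq κ ((Ψ t).psiV τ) =
      wsq (eS (m - 2)) (mulA (freqPV τ (curveP T Ψ t) (curveV T Ψ t))) :=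
  sum_lapGradSq_eq (fun κ hκ => hS.hasSymbol_psiV' hn hm ht (κ := κ + 1) (by omega))
    (measurable_div_afun (measurable_freqPV τ (measurable_CL2 _) (measurable_CL2 _)))
    (enorm_mulA_eq_eA_mul_div hn)

theorem sum_gradSq_v (hS : IsSolution m τ b c k g T Ψ) (ht : t ∈ Icc 0 T) (hm : 3 ≤ m) :
    ∑ κ ∈ Finset.range (m - 2 + 1), gradSq (κ + 1) (Ψ t).v =
      wsq (eS (m - 2)) (mulA (curveV T Ψ t)) :=
  sum_gradSq_eq (fun κ hκ => hS.hasSymbol_v ht (by omega)) (measurable_CL2 _)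
    (Filter.Eventually.of_forall fun ξ => by rw [enorm_mulA, pow_one])

theorem sum_lapGradSq_v (hS : IsSolution m τ b c k g T Ψ) (ht : t ∈ Icc 0 T) (hm : 3 ≤ m) :
    ∑ κ ∈ Finset.range (m - 2 + 1), lapGradSq κ (Ψ t).v =
      wsq (eS (m - 2)) (mulA (mulA (curveV T Ψ t))) :=
  sum_lapGradSq_eq (fun κ hκ => hS.hasSymbol_v ht (by omega)) (measurable_CL2 _)
    (Filter.Eventually.of_forall fun ξ => by rw [enorm_mulA, enorm_mulA, sq, mul_assoc])

theorem sum_gradSq_w (hS : IsSolution m τ b c k g T Ψ) (ht : t ∈ Icc 0 T) (hm : 3 ≤ m) :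
    ∑ κ ∈ Finset.range (m - 2 + 1), gradSq κ (Ψ t).w = wsq (eS (m - 2)) (curveW T Ψ t) :=
  sum_gradSq_eq (j := 0) (fun κ hκ => hS.hasSymbol_w ht (by omega)) (measurable_CL2 _)
    (Filter.Eventually.of_forall fun ξ => by rw [pow_zero, one_mul])

theorem sum_gradSq_vW (hS : IsSolution m τ b c k g T Ψ) (ht : t ∈ Icc 0 T) (hm : 3 ≤ m) :
    ∑ κ ∈ Finset.range (m - 2 + 1), gradSq κ ((Ψ t).vW τ) =
      wsq (eS (m - 2)) (freqVW τ (curveV T Ψ t) (curveW T Ψ t)) :=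
  sum_gradSq_eq (j := 0) (fun κ hκ => hS.hasSymbol_vW ht (by omega))
    (measurable_freqVW τ (measurable_CL2 _) (measurable_CL2 _))
    (Filter.Eventually.of_forall fun ξ => by rw [pow_zero, one_mul])

theorem sum_gradSq_vW' (hS : IsSolution m τ b c k g T Ψ) (ht : t ∈ Icc 0 T) (hm : 3 ≤ m) :
    ∑ κ ∈ Finset.range (m - 2 + 1), gradSq (κ + 1) ((Ψ t).vW τ) =
      wsq (eS (m - 2)) (mulA (freqVW τ (curveV T Ψ t) (curveW T Ψ t))) :=
  sum_gradSq_eq (fun κ hκ => hS.hasSymbol_vW ht (by omega))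
    (measurable_freqVW τ (measurable_CL2 _) (measurable_CL2 _))
    (Filter.Eventually.of_forall fun ξ => by rw [enorm_mulA, pow_one])

theorem sum_histGradSq (hS : IsSolution m τ b c k g T Ψ) (hn : 3 ≤ n) (hm : 3 ≤ m) (hT : 0 ≤ T)
    (hg : IntegrableOn (fun s => -deriv g s) (Ioi 0)) (ht : t ∈ Icc 0 T) :
    ∑ κ ∈ Finset.range (m - 2 + 1), histGradSq g (κ + 1) (Ψ t).eta =
      freqHist (eS (m - 2)) (fun s => -deriv g s)
        (fun s => (hist (curveP T Ψ) t s : CL2 n)) := by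
  unfold histGradSq
  rw [← lintegral_finsetSum' _ fun κ hκ => ?_]
  · refine lintegral_congr_ae ?_
    filter_upwards [hS.hasSymbol_eta hm ht] with s hs
    rw [← Finset.mul_sum]
    congr 1
    exact sum_gradSq_eq (fun κ hκ => hs κ (by omega)) (measurable_div_afun (measurable_CL2 _))
      (enorm_eq_eA_mul_div hn)
  · have hκ' := Finset.mem_range.1 hκ
    exact hg.aestronglyMeasurable.aemeasurable.ennreal_ofReal.mul
      (hS.aemeasurable_gradSq_eta hT ht (by omega) (by omega))

theorem sum_histLapGradSq (hS : IsSolution m τ b c k g T Ψ) (hn : 3 ≤ n) (hm : 3 ≤ m) (hT : 0 ≤ T)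
    (hg : IntegrableOn (fun s => -deriv g s) (Ioi 0)) (ht : t ∈ Icc 0 T) :
    ∑ κ ∈ Finset.range (m - 2 + 1), histLapGradSq g κ (Ψ t).eta =
      freqHist (eS (m - 2)) (fun s => -deriv g s)
        (fun s => mulA (hist (curveP T Ψ) t s : CL2 n)) := by
  unfold histLapGradSq
  rw [← lintegral_finsetSum' _ fun κ hκ => ?_]
  · refine lintegral_congr_ae ?_
    filter_upwards [hS.hasSymbol_eta hm ht] with s hs
    rw [← Finset.mul_sum]
    congr 1
    exact sum_lapGradSq_eq (fun κ hκ => hs (κ + 1) (by omega))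
      (measurable_div_afun (measurable_CL2 _)) (enorm_mulA_eq_eA_mul_div hn)
  · have hκ' := Finset.mem_range.1 hκ
    refine hg.aestronglyMeasurable.aemeasurable.ennreal_ofReal.mul
      ((hS.aemeasurable_gradSq_eta hT ht (κ := κ + 2) (by omega) (by omega)).congr ?_)
    filter_upwards [hS.hasSymbol_eta hm ht] with s hs
    exact (HasSymbol.lapGradSq_eq_gradSq (hs (κ + 1) (by omega))).symm

/-- An identity, not only an equivalence of norms: each of the nine terms is matched with its
weighted integral. -/
theorem sum_energy_eq (hS : IsSolution m τ b c k g T Ψ) (hn : 3 ≤ n) (hm : 3 ≤ m) (hT : 0 ≤ T)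
    (hg : IntegrableOn (fun s => -deriv g s) (Ioi 0)) (ht : t ∈ Icc 0 T) :
    ∑ κ ∈ Finset.range (m - 2 + 1), energy τ g κ (Ψ t) = freqEnergy (eS (m - 2)) τ
      (fun s => -deriv g s) (curveP T Ψ) (curveV T Ψ) (curveW T Ψ) t := by
  unfold energy freqEnergy
  simp only [Finset.sum_add_distrib]
  rw [hS.sum_gradSq_psiV hn hm ht, hS.sum_gradSq_vW ht hm, hS.sum_gradSq_v ht hm,
    hS.sum_histGradSq hn hm hT hg ht, hS.sum_gradSq_w ht hm, hS.sum_lapGradSq_psiV hn hm ht,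
    hS.sum_gradSq_vW' ht hm, hS.sum_lapGradSq_v ht hm, hS.sum_histLapGradSq hn hm hT hg ht]

theorem sum_dissipation_eq (hS : IsSolution m τ b c k g T Ψ) (hn : 3 ≤ n) (hm : 3 ≤ m)
    (hT : 0 ≤ T) (hg : IntegrableOn (fun s => -deriv g s) (Ioi 0)) (ht : t ∈ Icc 0 T) :
    ∑ κ ∈ Finset.range (m - 2 + 1), dissipation τ g κ (Ψ t) = freqDiss (eS (m - 2)) τ
      (fun s => -deriv g s) (curveP T Ψ) (curveV T Ψ) (curveW T Ψ) t := by
  unfold dissipation freqDiss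
  simp only [Finset.sum_add_distrib]
  rw [hS.sum_gradSq_v ht hm, hS.sum_histGradSq hn hm hT hg ht, hS.sum_lapGradSq_psiV hn hm ht,
    hS.sum_gradSq_vW' ht hm, hS.sum_lapGradSq_v ht hm, hS.sum_histLapGradSq hn hm hT hg ht,
    hS.sum_gradSq_w ht hm]

end IsSolution

/-! ### Finiteness -/

theorem ContDerivs.exists_gradSq_le {T : ℝ} {p q : ℕ} {u : ℝ → Rn n → ℝ}
    (h : ContDerivs T p q u) {κ : ℕ} (h1 : p ≤ κ) (h2 : κ ≤ q) :
    ∃ B : ℝ≥0∞, B < ⊤ ∧ ∀ t ∈ Icc 0 T, gradSq κ (u t) ≤ B := by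
  have hα : ∀ α : Fin κ → Fin n, ∃ B : ℝ, ∀ t ∈ Icc 0 T, ‖weakDeriv α (u t)‖ ≤ B := fun α =>
    isCompact_Icc.exists_bound_of_continuousOn (h.2 κ h1 h2 α)
  choose B hB using hα
  refine ⟨∑ α, ENNReal.ofReal (B α) ^ 2, ?_, fun t ht => ?_⟩
  · exact ENNReal.sum_lt_top.2 fun α _ => ENNReal.pow_lt_top ENNReal.ofReal_lt_top
  · refine Finset.sum_le_sum fun α _ => pow_le_pow_left' ?_ 2
    rw [← ofReal_norm]
    exact ENNReal.ofReal_le_ofReal (hB α t ht)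

theorem ContDerivs.exists_sum_gradSq_le {T : ℝ} {p q : ℕ} {u : ℝ → Rn n → ℝ}
    (h : ContDerivs T p q u) {K j : ℕ} (h1 : p ≤ j) (h2 : K + j ≤ q) :
    ∃ B : ℝ≥0∞, B < ⊤ ∧ ∀ t ∈ Icc 0 T, ∑ κ ∈ Finset.range (K + 1), gradSq (κ + j) (u t) ≤ B := by
  have hκ : ∀ κ : Fin (K + 1), ∃ B : ℝ≥0∞, B < ⊤ ∧ ∀ t ∈ Icc 0 T, gradSq (κ + j) (u t) ≤ B :=
    fun κ => h.exists_gradSq_le (by omega) (by omega)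
  choose B hBt hB using hκ
  refine ⟨∑ κ, B κ, ENNReal.sum_lt_top.2 fun κ _ => hBt κ, fun t ht => ?_⟩
  rw [Finset.sum_range]
  exact Finset.sum_le_sum fun κ _ => hB κ t ht

theorem wsq_add_le (ρ : Rn n → ℝ≥0∞) (hρ : Measurable ρ) {F G : Rn n → ℂ} (hF : Measurable F)
    (c : ℂ) {X Y : ℝ≥0∞} (hX : wsq ρ F ≤ X) (hY : wsq ρ G ≤ Y) :
    wsq ρ (fun ξ => F ξ + c * G ξ) ≤ 4 * (X + ‖c‖ₑ ^ 2 * Y) := by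
  calc wsq ρ (fun ξ => F ξ + c * G ξ)
      ≤ ∫⁻ ξ, 4 * (ρ ξ * ‖F ξ‖ₑ ^ 2 + ‖c‖ₑ ^ 2 * (ρ ξ * ‖G ξ‖ₑ ^ 2)) := by
        refine lintegral_mono fun ξ => ?_
        calc ρ ξ * ‖F ξ + c * G ξ‖ₑ ^ 2 ≤ ρ ξ * (2 ^ 2 * (‖F ξ‖ₑ ^ 2 + ‖c * G ξ‖ₑ ^ 2)) := by
              gcongr
              exact (pow_le_pow_left' (enorm_add_le _ _) 2).trans (add_pow_le_two_pow_mul _ _ 2)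
          _ = _ := by rw [enorm_mul]; ring
    _ = 4 * (wsq ρ F + ‖c‖ₑ ^ 2 * wsq ρ G) := by
        rw [lintegral_const_mul' _ _ (by norm_num), lintegral_add_left (by fun_prop),
          lintegral_const_mul' _ _ (ENNReal.pow_ne_top enorm_ne_top)]
        rfl
    _ ≤ _ := by gcongr

theorem freqHist_le {ρ : Rn n → ℝ≥0∞} {h : ℝ → ℝ} {η : ℝ → Rn n → ℂ} {X : ℝ≥0∞}
    (hX : ∀ s > 0, wsq ρ (η s) ≤ X) (hXt : X ≠ ⊤) :
    freqHist ρ h η ≤ (∫⁻ s in Ioi (0 : ℝ), ENNReal.ofReal (h s)) * X := by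
  rw [← lintegral_mul_const' _ _ hXt]
  exact setLIntegral_mono' measurableSet_Ioi fun s hs => mul_le_mul' le_rfl (hX s hs)

namespace IsSolution

variable {m : ℕ} {τ b c k : ℝ} {g : ℝ → ℝ} {T : ℝ} {Ψ : ℝ → State n} {t : ℝ}

/-- Continuity on the compact interval bounds every seminorm. With κ up to m - 2, the orders reach m
for ψ and v and m - 1 for w, exactly the assumed regularity. -/
theorem exists_wsq_le (hS : IsSolution m τ b c k g T Ψ) (hn : 3 ≤ n) (hm : 3 ≤ m) :
    ∃ B : ℝ≥0∞, B < ⊤ ∧ ∀ t ∈ Icc 0 T, wsq (eS (m - 2)) (curveP T Ψ t) ≤ B ∧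
      wsq (eS (m - 2)) (mulA (curveP T Ψ t)) ≤ B ∧ wsq (eS (m - 2)) (curveV T Ψ t) ≤ B ∧
      wsq (eS (m - 2)) (mulA (curveV T Ψ t)) ≤ B ∧
      wsq (eS (m - 2)) (mulA (mulA (curveV T Ψ t))) ≤ B ∧
      wsq (eS (m - 2)) (curveW T Ψ t) ≤ B ∧ wsq (eS (m - 2)) (mulA (curveW T Ψ t)) ≤ B := by
  obtain ⟨b1, t1, h1⟩ := hS.cont_psi.exists_sum_gradSq_le (K := m - 2) (j := 1) le_rfl (by omega)
  obtain ⟨b2, t2, h2⟩ := hS.cont_psi.exists_sum_gradSq_le (K := m - 2) (j := 2) (by omega)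
    (by omega)
  obtain ⟨b3, t3, h3⟩ := hS.cont_v.exists_sum_gradSq_le (K := m - 2) (j := 0) le_rfl (by omega)
  obtain ⟨b4, t4, h4⟩ := hS.cont_v.exists_sum_gradSq_le (K := m - 2) (j := 1) (by omega) (by omega)
  obtain ⟨b5, t5, h5⟩ := hS.cont_v.exists_sum_gradSq_le (K := m - 2) (j := 2) (by omega) (by omega)
  obtain ⟨b6, t6, h6⟩ := hS.cont_w.exists_sum_gradSq_le (K := m - 2) (j := 0) le_rfl (by omega)
  obtain ⟨b7, t7, h7⟩ := hS.cont_w.exists_sum_gradSq_le (K := m - 2) (j := 1) (by omega) (by omega)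
  refine ⟨max b1 (max b2 (max b3 (max b4 (max b5 (max b6 b7))))), by simp [*], fun t ht => ?_⟩
  have e3 : ∑ κ ∈ Finset.range (m - 2 + 1), gradSq (κ + 0) (Ψ t).v =
      wsq (eS (m - 2)) (curveV T Ψ t) :=
    sum_gradSq_eq (fun κ hκ => hS.hasSymbol_v ht (by omega)) (measurable_CL2 _)
      (Filter.Eventually.of_forall fun ξ => by rw [pow_zero, one_mul])
  have e5 : ∑ κ ∈ Finset.range (m - 2 + 1), gradSq (κ + 2) (Ψ t).v =
      wsq (eS (m - 2)) (mulA (mulA (curveV T Ψ t))) :=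
    sum_gradSq_eq (fun κ hκ => hS.hasSymbol_v ht (by omega)) (measurable_CL2 _)
      (Filter.Eventually.of_forall fun ξ => by rw [enorm_mulA, enorm_mulA, sq, mul_assoc])
  have e7 : ∑ κ ∈ Finset.range (m - 2 + 1), gradSq (κ + 1) (Ψ t).w =
      wsq (eS (m - 2)) (mulA (curveW T Ψ t)) :=
    sum_gradSq_eq (fun κ hκ => hS.hasSymbol_w ht (by omega)) (measurable_CL2 _)
      (Filter.Eventually.of_forall fun ξ => by rw [enorm_mulA, pow_one])
  have a1 := h1 t ht
  have a2 := h2 t ht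
  have a3 := h3 t ht
  have a4 := h4 t ht
  have a5 := h5 t ht
  have a6 := h6 t ht
  have a7 := h7 t ht
  rw [hS.sum_gradSq_psi hn hm ht] at a1
  rw [hS.sum_gradSq_psi' hn hm ht] at a2
  rw [e3] at a3
  rw [hS.sum_gradSq_v ht hm] at a4
  rw [e5] at a5
  rw [show ∑ κ ∈ Finset.range (m - 2 + 1), gradSq (κ + 0) (Ψ t).w = _ from
    hS.sum_gradSq_w ht hm] at a6
  rw [e7] at a7
  simp only [le_max_iff]
  tauto

/-- A qualitative bound, dependent on the solution. It only serves to make the uniform energy bound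
in the main estimate finite. -/
theorem exists_freqEnergy_le (hS : IsSolution m τ b c k g T Ψ) (hn : 3 ≤ n) (hm : 3 ≤ m)
    {h : ℝ → ℝ} (hh : IntegrableOn h (Ioi 0)) :
    ∃ E : ℝ≥0∞, E < ⊤ ∧ ∀ t ∈ Icc 0 T,
      freqEnergy (eS (m - 2)) τ h (curveP T Ψ) (curveV T Ψ) (curveW T Ψ) t ≤ E := by
  obtain ⟨B, hB, hb⟩ := hS.exists_wsq_le hn hm
  set ρ : Rn n → ℝ≥0∞ := eS (m - 2) with hρ
  have mρ : Measurable ρ := measurable_eS _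
  clear_value ρ
  have hH : ∫⁻ s in Ioi (0 : ℝ), ENNReal.ofReal (h s) < ⊤ := hh.lintegral_lt_top
  set H := ∫⁻ s in Ioi (0 : ℝ), ENNReal.ofReal (h s) with hHdef
  have hY : ∀ c : ℂ, 4 * (B + ‖c‖ₑ ^ 2 * B) < ⊤ := fun c =>
    ENNReal.mul_lt_top (by simp) (ENNReal.add_lt_top.2
      ⟨hB, ENNReal.mul_lt_top (ENNReal.pow_lt_top enorm_lt_top) hB⟩)
  set Y := 4 * (B + ‖(τ : ℂ)‖ₑ ^ 2 * B) with hYdef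
  set Z := 4 * (B + ‖(-1 : ℂ)‖ₑ ^ 2 * B) with hZdef
  have hYt : Y < ⊤ := hY _
  have hZt : Z < ⊤ := hY _
  have hist_le : ∀ t ∈ Icc 0 T, ∀ s > 0, wsq ρ (hist (curveP T Ψ) t s : CL2 n) ≤ Z ∧
      wsq ρ (mulA (hist (curveP T Ψ) t s : CL2 n)) ≤ Z := by
    intro t ht s hs
    unfold hist
    split_ifs with hst
    · have hts : t - s ∈ Icc 0 T := ⟨by linarith, by linarith [ht.2]⟩
      have e : (curveP T Ψ t - curveP T Ψ (t - s) : CL2 n) =ᵐ[volume]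
          fun ξ => curveP T Ψ t ξ + (-1) * curveP T Ψ (t - s) ξ := by
        filter_upwards [Lp.coeFn_sub (curveP T Ψ t) (curveP T Ψ (t - s))] with ξ hξ
        rw [hξ, Pi.sub_apply]; ring
      have e' : mulA (curveP T Ψ t - curveP T Ψ (t - s) : CL2 n) =ᵐ[volume]
          fun ξ => mulA (curveP T Ψ t) ξ + (-1) * mulA (curveP T Ψ (t - s)) ξ := by
        filter_upwards [e] with ξ hξ
        simp only [mulA, hξ]; ring
      rw [wsq_congr e, wsq_congr e']
      exact ⟨wsq_add_le ρ mρ (measurable_CL2 _) _ (hb t ht).1 (hb _ hts).1,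
        wsq_add_le ρ mρ (measurable_mulA (measurable_CL2 _)) _ (hb t ht).2.1 (hb _ hts).2.1⟩
    · have hBZ : B ≤ Z := by
        rw [hZdef]
        calc B ≤ B + ‖(-1 : ℂ)‖ₑ ^ 2 * B := le_self_add
          _ ≤ _ := le_mul_of_one_le_left' (by norm_num)
      exact ⟨(hb t ht).1.trans hBZ, (hb t ht).2.1.trans hBZ⟩
  refine ⟨Y + Y + B + H * Z + B + Y + Y + B + H * Z, ?_, fun t ht => ?_⟩
  · have := ENNReal.mul_lt_top hH hZt
    simp only [ENNReal.add_lt_top]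
    tauto
  · obtain ⟨b1, b2, b3, b4, b5, b6, b7⟩ := hb t ht
    have mP := measurable_CL2 (curveP T Ψ t)
    have mV := measurable_CL2 (curveV T Ψ t)
    have e1 : wsq ρ (freqPV τ (curveP T Ψ t) (curveV T Ψ t)) ≤ Y :=
      wsq_add_le ρ mρ mP τ b1 b4
    have e2 : wsq ρ (freqVW τ (curveV T Ψ t) (curveW T Ψ t)) ≤ Y := wsq_add_le ρ mρ mV τ b3 b6
    have e3 : wsq ρ (mulA (freqPV τ (curveP T Ψ t) (curveV T Ψ t))) ≤ Y := by
      refine le_trans (le_of_eq ?_) (wsq_add_le ρ mρ (measurable_mulA mP) τ b2 b5)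
      congr 1; ext ξ; simp only [mulA, freqPV]; ring
    have e4 : wsq ρ (mulA (freqVW τ (curveV T Ψ t) (curveW T Ψ t))) ≤ Y := by
      refine le_trans (le_of_eq ?_) (wsq_add_le ρ mρ (measurable_mulA mV) τ b4 b7)
      congr 1; ext ξ; simp only [mulA, freqVW]; ring
    have e5 := freqHist_le (h := h) (fun s hs => (hist_le t ht s hs).1) hZt.ne
    have e6 := freqHist_le (h := h) (fun s hs => (hist_le t ht s hs).2) hZt.ne
    unfold freqEnergy
    gcongr

end IsSolution

/-! ### The nonlinearity and the truncated system of a solution -/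

theorem enorm_sym_one_le (α : Fin 1 → Fin n) (ξ : Rn n) : ‖sym α ξ‖ₑ ≤ eA ξ := by
  refine le_of_sq_le_sq ?_
  rw [show eA ξ ^ 2 = eA ξ ^ (2 * 1) by norm_num, ← sum_enorm_sym_sq 1 ξ]
  exact Finset.single_le_sum (f := fun α : Fin 1 → Fin n => ‖sym α ξ‖ₑ ^ 2) (fun _ _ => zero_le)
    (Finset.mem_univ α)

theorem HasSymbol.enorm_ft_weakPartial_le {f : Rn n → ℝ} {σ : Rn n → ℂ} (h : HasSymbol 1 f σ)
    (j : Fin n) : ∀ᵐ ξ, ‖ft n (weakPartial j f) ξ‖ₑ ≤ eA ξ * ‖σ ξ‖ₑ := by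
  filter_upwards [h.ft_weakDeriv fun _ => j] with ξ hξ
  rw [weakPartial, hξ, enorm_mul]
  exact mul_le_mul' (enorm_sym_one_le _ ξ) le_rfl

theorem conv_mono_ae {F F' G G' : Rn n → ℝ≥0∞} (hF : ∀ᵐ ξ, F ξ ≤ F' ξ) (hG : ∀ᵐ ξ, G ξ ≤ G' ξ)
    (ξ : Rn n) : conv F G ξ ≤ conv F' G' ξ := by
  refine lintegral_mono_ae ?_
  filter_upwards [hG, (measurePreserving_const_sub ξ).quasiMeasurePreserving.ae hF] with η h1 h2
  exact mul_le_mul' h2 h1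

/-- Only the difference f - f' is in L² and has a transform. Its gradient is that of `V`, and the
Riesz sum of 2πiξ_j yields 2π|ξ|. This turns ψ(t) = ψ(0) + ∫v into p(t) = p(0) + A∫v. -/
theorem gradFt_eq_add {f f' : Rn n → ℝ} {V : L2 n}
    (h : ∀ j : Fin n, HasWeakDeriv (fun _ : Fin 1 => j) f (weakPartial j f))
    (h' : ∀ j : Fin n, HasWeakDeriv (fun _ : Fin 1 => j) f' (weakPartial j f'))
    (hV : ∀ᵐ x, f x = f' x + V x) :
    ∀ᵐ ξ, gradFt f ξ = gradFt f' ξ + afun ξ * ft n V ξ := by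
  have hVd : ∀ j : Fin n, ∀ᵐ ξ, ft n (weakPartial j f) ξ =
      ft n (weakPartial j f') ξ + 2 * Real.pi * Complex.I * (ξ j : ℂ) * ft n V ξ := fun j => by
    have h1 : HasWeakDeriv (fun _ : Fin 1 => j) V (weakPartial j f + (-1 : ℝ) • weakPartial j f') :=
      ((h j).add_const_mul (h' j) (-1)).congr_ae (by
        filter_upwards [hV] with x hx
        rw [hx]; ring)
    have h2 := h1.ft_eq
    rw [map_add, map_smul] at h2
    filter_upwards [h2, Lp.coeFn_add (ft n (weakPartial j f)) ((-1 : ℝ) • ft n (weakPartial j f')),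
      Lp.coeFn_smul (-1 : ℝ) (ft n (weakPartial j f'))] with ξ a1 a2 a3
    rw [a2, Pi.add_apply, a3, Pi.smul_apply, Complex.real_smul] at a1
    push_cast at a1
    linear_combination a1
  filter_upwards [coeFn_gradFt f, coeFn_gradFt f', ae_all_iff.2 hVd] with ξ h1 h2 h3
  rw [h1, h2]
  simp only [h3, mul_add, Finset.sum_add_distrib]
  congr 1
  have e : ∀ j : Fin n, -Complex.I * ((ξ j / ‖ξ‖ : ℝ) : ℂ) *
      (2 * Real.pi * Complex.I * (ξ j : ℂ) * ft n V ξ) =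
      ((2 * Real.pi / ‖ξ‖ * ξ j ^ 2 : ℝ) : ℂ) * ft n V ξ := fun j => by
    push_cast
    linear_combination (-(2 * Real.pi * (ξ j : ℂ) ^ 2 / ‖ξ‖ * ft n V ξ)) * Complex.I_sq
  simp only [e]
  rw [← Finset.sum_mul, ← Complex.ofReal_sum, ← Finset.mul_sum, sum_sq_coord]
  congr 2
  unfold afun
  rcases eq_or_ne ‖ξ‖ 0 with h0 | h0
  · simp [h0]
  · field_simp

namespace IsSolution

variable {m : ℕ} {τ b c k : ℝ} {g : ℝ → ℝ} {T : ℝ} {Ψ : ℝ → State n} {t : ℝ}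

theorem exists_nonlinearity (hS : IsSolution m τ b c k g T Ψ) (hm : 3 ≤ m) :
    ∃ Nf : ℝ → L2 n, ∀ t ∈ Icc 0 T,
      (∀ᵐ x, Nf t x = 2 * (k * (Ψ t).v x * (Ψ t).w x
          + ∑ j : Fin n, weakPartial j (Ψ t).psi x * weakPartial j (Ψ t).v x)) ∧
      ∃ wt : L2 n, HasDerivWithinAt (fun r => (Ψ r).w) wt (Icc 0 T) t ∧
        τ • wt = -(Ψ t).w + cgSq c g • lap (Ψ t).psi + b • lap (Ψ t).v
          + histInt g (fun r => lap (Ψ (clamp T r)).psi) t + Nf t := by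
  have key : ∀ t : ℝ, ∃ Nt : L2 n, t ∈ Icc 0 T →
      (∀ᵐ x, Nt x = 2 * (k * (Ψ t).v x * (Ψ t).w x
          + ∑ j : Fin n, weakPartial j (Ψ t).psi x * weakPartial j (Ψ t).v x)) ∧
      ∃ wt : L2 n, HasDerivWithinAt (fun r => (Ψ r).w) wt (Icc 0 T) t ∧
        τ • wt = -(Ψ t).w + cgSq c g • lap (Ψ t).psi + b • lap (Ψ t).v
          + histInt g (fun r => lap (Ψ (clamp T r)).psi) t + Nt := by
    intro t
    by_cases ht : t ∈ Icc 0 T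
    swap
    · exact ⟨0, fun h => absurd h ht⟩
    obtain ⟨wt, hwt, heq⟩ := hS.eq_w t ht
    have hI : (∫ s in Ioi (0 : ℝ), g s • lap ((Ψ t).eta s) : L2 n) =
        histInt g (fun r => lap (Ψ (clamp T r)).psi) t := by
      refine integral_congr_ae ?_
      filter_upwards [hS.lap_eta hm ht] with s hs
      rw [hs]
    rw [hI] at heq
    set I : L2 n := histInt g (fun r => lap (Ψ (clamp T r)).psi) t with hIdef
    clear_value I
    -- The nonlinearity is taken to be the residual of the linear equation, which makes its
    -- membership in L² automatic.
    refine ⟨τ • wt - (-(Ψ t).w + cgSq c g • lap (Ψ t).psi + b • lap (Ψ t).v + I),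
      fun _ => ⟨?_, wt, hwt, by abel⟩⟩
    filter_upwards [heq, Lp.coeFn_sub (τ • wt)
      (-(Ψ t).w + cgSq c g • lap (Ψ t).psi + b • lap (Ψ t).v + I), Lp.coeFn_smul τ wt,
      Lp.coeFn_add (-(Ψ t).w + cgSq c g • lap (Ψ t).psi + b • lap (Ψ t).v) I,
      Lp.coeFn_add (-(Ψ t).w + cgSq c g • lap (Ψ t).psi) (b • lap (Ψ t).v),
      Lp.coeFn_add (-(Ψ t).w) (cgSq c g • lap (Ψ t).psi), Lp.coeFn_neg (Ψ t).w,
      Lp.coeFn_smul (cgSq c g) (lap (Ψ t).psi), Lp.coeFn_smul b (lap (Ψ t).v)]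
      with x h0 h1 h2 h3 h4 h5 h6 h7 h8
    rw [h1, Pi.sub_apply, h2, h3, Pi.add_apply, h4, Pi.add_apply, h5, Pi.add_apply, h6, h7, h8]
    simp only [Pi.smul_apply, Pi.neg_apply, smul_eq_mul]
    rw [h0]; ring
  choose Nf hNf using key
  exact ⟨Nf, hNf⟩

theorem enorm_nonlinearity_le (hS : IsSolution m τ b c k g T Ψ) (hn : 3 ≤ n) (hm : 3 ≤ m)
    (ht : t ∈ Icc 0 T) {Nt : L2 n}
    (hN : ∀ᵐ x, Nt x = 2 * (k * (Ψ t).v x * (Ψ t).w x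
      + ∑ j : Fin n, weakPartial j (Ψ t).psi x * weakPartial j (Ψ t).v x)) :
    ∀ᵐ ξ, ‖ft n Nt ξ‖ₑ ≤ (‖2 * k‖ₑ + n * ‖(2 : ℝ)‖ₑ) *
      (conv (fun η => ‖curveV T Ψ t η‖ₑ) (fun η => ‖curveW T Ψ t η‖ₑ) ξ +
        conv (fun η => ‖curveP T Ψ t η‖ₑ) (fun η => eA η * ‖curveV T Ψ t η‖ₑ) ξ) := by
  -- The index `none` stands for the product vw, and `some j` for the j-th term of ∇ψ · ∇v.
  have h1 := enorm_ft_le_sum (Finset.univ : Finset (Option (Fin n)))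
    (fun i => i.elim (2 * k) fun _ => 2)
    (fun i => i.elim (Ψ t).v fun j => weakPartial j (Ψ t).psi)
    (fun i => i.elim (Ψ t).w fun j => weakPartial j (Ψ t).v) Nt (by
      filter_upwards [hN] with x hx
      rw [hx, Fintype.sum_option]
      simp only [Option.elim]
      rw [← Finset.mul_sum]; ring)
  have hP : ∀ j : Fin n, ∀ᵐ ξ, ‖ft n (weakPartial j (Ψ t).psi) ξ‖ₑ ≤ ‖curveP T Ψ t ξ‖ₑ := fun j => by
    filter_upwards [(hS.hasSymbol_psi hm ht (κ := 0) (by omega)).enorm_ft_weakPartial_le j,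
      enorm_eq_eA_mul_div (G := curveP T Ψ t) hn] with ξ a1 a2
    rw [a2, pow_one]; exact a1
  have hV : ∀ j : Fin n, ∀ᵐ ξ, ‖ft n (weakPartial j (Ψ t).v) ξ‖ₑ ≤ eA ξ * ‖curveV T Ψ t ξ‖ₑ :=
    fun j => (hS.hasSymbol_v ht (by omega)).enorm_ft_weakPartial_le j
  filter_upwards [h1] with ξ hξ
  refine hξ.trans ?_
  rw [Fintype.sum_option]
  simp only [Option.elim]
  set X := conv (fun η => ‖curveV T Ψ t η‖ₑ) (fun η => ‖curveW T Ψ t η‖ₑ) ξ with hX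
  set Y := conv (fun η => ‖curveP T Ψ t η‖ₑ) (fun η => eA η * ‖curveV T Ψ t η‖ₑ) ξ with hY
  have e1 : ∫⁻ η, ‖ft n (Ψ t).v (ξ - η)‖ₑ * ‖ft n (Ψ t).w η‖ₑ = X := by
    rw [hX, curveV, curveW, clamp_of_mem ht]; rfl
  have e2 : ∀ j : Fin n, ∫⁻ η, ‖ft n (weakPartial j (Ψ t).psi) (ξ - η)‖ₑ *
      ‖ft n (weakPartial j (Ψ t).v) η‖ₑ ≤ Y := fun j => conv_mono_ae (hP j) (hV j) ξ
  rw [e1]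
  calc ‖2 * k‖ₑ * X + ∑ j : Fin n, ‖(2 : ℝ)‖ₑ * ∫⁻ η, ‖ft n (weakPartial j (Ψ t).psi) (ξ - η)‖ₑ *
      ‖ft n (weakPartial j (Ψ t).v) η‖ₑ ≤ ‖2 * k‖ₑ * X + ∑ _j : Fin n, ‖(2 : ℝ)‖ₑ * Y := by
        gcongr with j
        exact e2 j
    _ = ‖2 * k‖ₑ * X + n * ‖(2 : ℝ)‖ₑ * Y := by simp [mul_assoc]
    _ ≤ ‖2 * k‖ₑ * X + n * ‖(2 : ℝ)‖ₑ * Y + (‖2 * k‖ₑ * Y + n * ‖(2 : ℝ)‖ₑ * X) := le_self_add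
    _ = _ := by ring

section Linear

variable {N K : ℕ}

theorem cut_ft_lap_psi (hS : IsSolution m τ b c k g T Ψ) (hn : 3 ≤ n) (hm : 3 ≤ m)
    (ht : t ∈ Icc 0 T) : (sMult n K N).opR (ft n (lap (Ψ t).psi)) =
      -(aMult n N).opR ((sMult n K N).opR (curveP T Ψ t)) := by
  refine Lp.ext ?_
  filter_upwards [(sMult n K N).coeFn_opR (ft n (lap (Ψ t).psi)),
    (hS.hasSymbol_psi hm ht (κ := 1) (by omega)).ft_lap, ae_afun_ne_zero hn,
    Lp.coeFn_neg ((aMult n N).opR ((sMult n K N).opR (curveP T Ψ t))),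
    aMult_eq_sMult_mul ((sMult n K N).coeFn_opR (curveP T Ψ t))] with ξ h1 h2 h3 h4 h5
  rw [h1, h2, h4, Pi.neg_apply, h5]
  field_simp

theorem cut_ft_lap_v (hS : IsSolution m τ b c k g T Ψ) (hm : 3 ≤ m)
    (ht : t ∈ Icc 0 T) : (sMult n K N).opR (ft n (lap (Ψ t).v)) =
      -(aMult n N).opR ((aMult n N).opR ((sMult n K N).opR (curveV T Ψ t))) := by
  refine Lp.ext ?_
  filter_upwards [(sMult n K N).coeFn_opR (ft n (lap (Ψ t).v)),
    (hS.hasSymbol_v ht (κ := 2) (by omega)).ft_lap,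
    Lp.coeFn_neg ((aMult n N).opR ((aMult n N).opR ((sMult n K N).opR (curveV T Ψ t)))),
    aMult_eq_sMult_mul (aMult_eq_sMult_mul ((sMult n K N).coeFn_opR (curveV T Ψ t)))]
    with ξ h1 h2 h4 h5
  rw [h1, h2, h4, Pi.neg_apply, h5]
  ring

theorem cut_curveP_eq (hS : IsSolution m τ b c k g T Ψ) (hm : 3 ≤ m) (ht : t ∈ Icc 0 T) :
    (sMult n K N).opR (curveP T Ψ t) = (sMult n K N).opR (curveP T Ψ 0) +
      (aMult n N).opR ((sMult n K N).opR (ft n (∫ r in (0 : ℝ)..t, (Ψ r).v))) := by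
  have h0 : (0 : ℝ) ∈ Icc 0 T := ⟨le_rfl, ht.1.trans ht.2⟩
  have hd : ∀ r ∈ Icc 0 T, ∀ j : Fin n,
      HasWeakDeriv (fun _ : Fin 1 => j) (Ψ r).psi (weakPartial j (Ψ r).psi) := fun r hr j =>
    weakDeriv_spec (hS.cont_psi.1 r hr 1 le_rfl (by omega) _)
  have hg := gradFt_eq_add (hd t ht) (hd 0 h0) (hS.eq_psi t ht)
  set V0 : L2 n := ∫ r in (0 : ℝ)..t, (Ψ r).v with hV0
  clear_value V0
  refine Lp.ext ?_
  filter_upwards [hg, (sMult n K N).coeFn_opR (curveP T Ψ t),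
    (sMult n K N).coeFn_opR (curveP T Ψ 0),
    aMult_eq_sMult_mul ((sMult n K N).coeFn_opR (ft n V0)),
    Lp.coeFn_add ((sMult n K N).opR (curveP T Ψ 0))
      ((aMult n N).opR ((sMult n K N).opR (ft n V0)))] with ξ a1 a2 a3 a4 a5
  rw [a5, Pi.add_apply, a2, a3, a4, curveP, curveP, clamp_of_mem ht, clamp_of_mem h0, a1]
  ring

/-- Transform followed by truncation is a bounded operator on L². It commutes with time derivatives
and with the memory integral, and it turns Δψ and Δv into -Ap and -A²v with the bounded, cut-off A.
-/
theorem isLinearSolution_cut (hS : IsSolution m τ b c k g T Ψ) (hn : 3 ≤ n) (hm : 3 ≤ m)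
    (hT : 0 ≤ T) (hg : IntegrableOn g (Ioi 0)) {Nf : ℝ → L2 n}
    (hN : ∀ t ∈ Icc 0 T, ∃ wt : L2 n, HasDerivWithinAt (fun r => (Ψ r).w) wt (Icc 0 T) t ∧
        τ • wt = -(Ψ t).w + cgSq c g • lap (Ψ t).psi + b • lap (Ψ t).v
          + histInt g (fun r => lap (Ψ (clamp T r)).psi) t + Nf t) :
    IsLinearSolution (aMult n N).opR τ (cgSq c g) (b - τ * c ^ 2) (∫ s in Ioi (0 : ℝ), g s) g T
      (fun r => (sMult n K N).opR (curveP T Ψ r)) (fun r => (sMult n K N).opR (curveV T Ψ r))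
      (fun r => (sMult n K N).opR (curveW T Ψ r))
      (fun r => (sMult n K N).opR (ft n (Nf r))) := by
  set L : L2 n →L[ℝ] CL2 n := (sMult n K N).opR.comp (ft n) with hL
  have hLa : ∀ f, (sMult n K N).opR (ft n f) = L f := fun f => rfl
  have hcP : Continuous fun r => (sMult n K N).opR (curveP T Ψ r) :=
    (sMult n K N).opR.continuous.comp (hS.continuous_curveP hm hT)
  refine ⟨inner_aMult N, hcP, (sMult n K N).opR.continuous.comp (hS.continuous_curveV hT),
    (sMult n K N).opR.continuous.comp (hS.continuous_curveW hT), fun t ht => ?_, fun t ht => ?_,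
    fun t ht => ?_⟩
  · have h1 := ((aMult n N).opR.comp L).hasFDerivAt.comp_hasDerivWithinAt t
      (hasDerivWithinAt_primitive hS.continuousOn_v ht)
    have h2 := h1.const_add ((sMult n K N).opR (curveP T Ψ 0))
    have h3 : (sMult n K N).opR (curveV T Ψ t) = L (Ψ t).v := by
      rw [curveV, clamp_of_mem ht]; rfl
    rw [h3]
    exact h2.congr (fun r hr => hS.cut_curveP_eq hm hr) (hS.cut_curveP_eq hm ht)
  · have h1 := L.hasFDerivAt.comp_hasDerivWithinAt t (hS.eq_v t ht)
    have h3 : (sMult n K N).opR (curveW T Ψ t) = L (Ψ t).w := by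
      rw [curveW, clamp_of_mem ht]; rfl
    have h4 : ∀ r ∈ Icc 0 T, (sMult n K N).opR (curveV T Ψ r) = L (Ψ r).v := fun r hr => by
      rw [curveV, clamp_of_mem hr]; rfl
    rw [h3]
    exact h1.congr h4 (h4 t ht)
  · obtain ⟨wt, hwt, heq⟩ := hN t ht
    have h1 := L.hasFDerivAt.comp_hasDerivWithinAt t hwt
    have h4 : ∀ r ∈ Icc 0 T, (sMult n K N).opR (curveW T Ψ r) = L (Ψ r).w := fun r hr => by
      rw [curveW, clamp_of_mem hr]; rfl
    refine ⟨L wt, h1.congr h4 (h4 t ht), ?_⟩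
    have hlapc : Continuous fun r => lap (Ψ (clamp T r)).psi :=
      continuous_comp_clamp hT (hS.continuousOn_lap hm)
    have hh : L (histInt g (fun r => lap (Ψ (clamp T r)).psi) t) =
        -(aMult n N).opR (histInt g (fun r => (sMult n K N).opR (curveP T Ψ r)) t) := by
      have e1 : L (histInt g (fun r => lap (Ψ (clamp T r)).psi) t) =
          histInt g (fun r => L (lap (Ψ (clamp T r)).psi)) t := by
        unfold histInt
        rw [← L.integral_comp_comm (integrableOn_smul_hist hg hlapc ht.1)]
        refine integral_congr_ae (Filter.Eventually.of_forall fun s => ?_)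
        simp only [map_smul]
        unfold hist
        split_ifs <;> simp
      have e2 : (fun r => L (lap (Ψ (clamp T r)).psi)) =
          fun r => (-(aMult n N).opR) ((sMult n K N).opR (curveP T Ψ r)) := by
        ext1 r
        rw [← hLa, hS.cut_ft_lap_psi hn hm (clamp_mem hT r), curveP, curveP,
          clamp_of_mem (clamp_mem hT r)]
        rfl
      rw [e1, e2, histInt_map _ hg hcP ht.1]
      rfl
    have h5 := congrArg L heq
    simp only [map_add, map_smul, map_neg] at h5
    rw [hh, ← hLa (lap (Ψ t).psi), hS.cut_ft_lap_psi hn hm ht, ← hLa (lap (Ψ t).v),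
      hS.cut_ft_lap_v hm ht, ← h4 t ht, ← hLa (Nf t)] at h5
    rw [h5]
    -- With β = b - τc², M = ∫g and a = c_g², the abstract coefficient β + τM + τa is the
    -- diffusivity b.
    have e3 : b - τ * c ^ 2 + τ * (∫ s in Ioi (0 : ℝ), g s) + τ * cgSq c g = b := by
      unfold cgSq; ring
    rw [e3]
    module

end Linear

end IsSolution

/-! ### Conclusion -/

theorem IsSolution.mono {m : ℕ} {τ b c k : ℝ} {g : ℝ → ℝ} {T t : ℝ} {Ψ : ℝ → State n}
    (hS : IsSolution m τ b c k g T Ψ) (ht : t ≤ T) : IsSolution m τ b c k g t Ψ := by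
  have hsub : Icc 0 t ⊆ Icc 0 T := Icc_subset_Icc_right ht
  have hc : ∀ {p q : ℕ} {u : ℝ → Rn n → ℝ}, ContDerivs T p q u → ContDerivs t p q u :=
    fun h => ⟨fun r hr => h.1 r (hsub hr), fun κ h1 h2 α => (h.2 κ h1 h2 α).mono hsub⟩
  refine ⟨hc hS.cont_psi, hc hS.cont_v, hc hS.cont_w, fun r hr => hS.eq_psi r (hsub hr),
    fun r hr => (hS.eq_v r (hsub hr)).mono hsub, fun r hr => ?_,
    fun r hr => hS.eq_eta r (hsub hr)⟩
  obtain ⟨wt, h1, h2⟩ := hS.eq_w r (hsub hr)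
  exact ⟨wt, h1.mono hsub, h2⟩

/-- The energy estimate on the whole interval of existence. -/
theorem exists_energyNorm_estimate {m : ℕ} (hn : 3 ≤ n) (hm : 3 ≤ m) (hnm : n < 2 * (m - 2 + 1))
    {τ b c : ℝ} (k : ℝ) {g : ℝ → ℝ} (hτ : 0 < τ) (hg : IsMemoryKernel c g) (hb : τ * c ^ 2 < b) :
    ∃ C : ℝ≥0∞, C < ⊤ ∧ ∀ (T : ℝ) (Ψ : ℝ → State n), 0 ≤ T → IsSolution m τ b c k g T Ψ →
      energyNormSq τ g (m - 2) Ψ T < ⊤ ∧ dissNormSq τ g (m - 2) Ψ T < ⊤ ∧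
      energyNormSq τ g (m - 2) Ψ T + dissNormSq τ g (m - 2) Ψ T ≤
        C * (energyNormSq τ g (m - 2) Ψ 0
          + energyNorm τ g (m - 2) Ψ T * dissNormSq τ g (m - 2) Ψ T) := by
  obtain ⟨ζ, hζ, hK⟩ := hg.exists_isHistKernel
  have ha : 0 < cgSq c g := sub_pos.2 hg.integral_lt
  obtain ⟨C, hC, hmain⟩ := exists_freqEnergy_estimate hn (k := m - 2) hnm hτ ha (sub_pos.2 hb)
    hg.integral_pos hζ (c₀ := ‖2 * k‖ₑ + n * ‖(2 : ℝ)‖ₑ)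
    (ENNReal.add_lt_top.2 ⟨enorm_lt_top, ENNReal.mul_lt_top (ENNReal.natCast_lt_top n)
      enorm_lt_top⟩)
  -- The supremum of the energy and the integrated dissipation are bounded separately by the same
  -- quantity, hence the factor 2.
  refine ⟨2 * C, ENNReal.mul_lt_top (by simp) hC, fun T Ψ hT hS => ?_⟩
  have hgd : IntegrableOn (fun s => -deriv g s) (Ioi 0) := hK.integrable_deriv
  have hE : ∀ t ∈ Icc 0 T, freqEnergy (eS (m - 2)) τ (fun s => -deriv g s) (curveP T Ψ)
      (curveV T Ψ) (curveW T Ψ) t ≤ energyNormSq τ g (m - 2) Ψ T := fun t ht => by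
    rw [← hS.sum_energy_eq hn hm hT hgd ht]
    exact le_iSup₂ (f := fun σ _ => ∑ κ ∈ Finset.range (m - 2 + 1), energy τ g κ (Ψ σ)) t ht
  have hEt : energyNormSq τ g (m - 2) Ψ T < ⊤ := by
    obtain ⟨E, hEt, hEb⟩ := hS.exists_freqEnergy_le hn hm hgd
    refine lt_of_le_of_lt (iSup₂_le fun t ht => ?_) hEt
    rw [hS.sum_energy_eq hn hm hT hgd ht]
    exact hEb t ht
  have hD : dissNormSq τ g (m - 2) Ψ T = ∫⁻ r in Icc 0 T, freqDiss (eS (m - 2)) τ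
      (fun s => -deriv g s) (curveP T Ψ) (curveV T Ψ) (curveW T Ψ) r :=
    setLIntegral_congr_fun measurableSet_Icc fun r hr => hS.sum_dissipation_eq hn hm hT hgd hr
  have hDt : dissNormSq τ g (m - 2) Ψ T < ⊤ := by
    rw [hD]
    calc _ ≤ ∫⁻ _ in Icc 0 T, energyNormSq τ g (m - 2) Ψ T :=
          setLIntegral_mono' measurableSet_Icc fun r hr =>
            (freqDiss_le_freqEnergy _ _ _ _ _ _ r).trans (hE r hr)
      _ < ⊤ := by
          rw [setLIntegral_const]
          exact ENNReal.mul_lt_top hEt (by simp)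
  refine ⟨hEt, hDt, ?_⟩
  obtain ⟨Nf, hNf⟩ := hS.exists_nonlinearity hm
  have key := hmain g (fun s => -deriv g s) T (curveP T Ψ) (curveV T Ψ) (curveW T Ψ)
    (fun r => ft n (Nf r)) _ hT (hS.continuous_curveP hm hT) hK
    (fun N => hS.isLinearSolution_cut hn hm hT hg.integrable fun t ht => (hNf t ht).2) hEt hE
    (fun t ht => hS.enorm_nonlinearity_le hn hm ht (hNf t ht).1)
  have h0 : freqEnergy (eS (m - 2)) τ (fun s => -deriv g s) (curveP T Ψ) (curveV T Ψ)
      (curveW T Ψ) 0 ≤ energyNormSq τ g (m - 2) Ψ 0 := by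
    rw [← hS.sum_energy_eq hn hm hT hgd ⟨le_rfl, hT⟩]
    exact le_iSup₂ (f := fun σ _ => ∑ κ ∈ Finset.range (m - 2 + 1), energy τ g κ (Ψ σ)) 0
      ⟨le_rfl, le_rfl⟩
  set R := energyNormSq τ g (m - 2) Ψ 0
    + energyNorm τ g (m - 2) Ψ T * dissNormSq τ g (m - 2) Ψ T with hR
  have key' : ∀ t ∈ Icc 0 T, freqEnergy (eS (m - 2)) τ (fun s => -deriv g s) (curveP T Ψ)
      (curveV T Ψ) (curveW T Ψ) t + ∫⁻ r in Icc 0 t, freqDiss (eS (m - 2)) τ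
      (fun s => -deriv g s) (curveP T Ψ) (curveV T Ψ) (curveW T Ψ) r ≤ C * R := fun t ht => by
    refine (key t ht).trans (mul_le_mul' le_rfl ?_)
    rw [hR, hD]
    exact add_le_add h0 le_rfl
  have e1 : energyNormSq τ g (m - 2) Ψ T ≤ C * R := by
    refine iSup₂_le fun t ht => ?_
    rw [hS.sum_energy_eq hn hm hT hgd ht]
    exact le_self_add.trans (key' t ht)
  have e2 : dissNormSq τ g (m - 2) Ψ T ≤ C * R := by
    rw [hD]
    exact le_add_self.trans (key' T ⟨hT, le_rfl⟩)
  calc _ ≤ C * R + C * R := add_le_add e1 e2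
    _ = 2 * C * R := by ring

end JMGT

end

theorem mainTheorem4 (n m : ℕ) (hn : 3 ≤ n) (hm : (n : ℝ) / 2 + 1 < (m : ℝ))
    (τ b c k : ℝ) (g : ℝ → ℝ) (hτ : 0 < τ) (hg : JMGT.IsMemoryKernel c g)
    (hb : τ * c ^ 2 < b) (hcg : τ * JMGT.cgSq c g < τ * c ^ 2) :
    ∃ C : ℝ≥0, 0 < C ∧
      ∀ (T : ℝ) (Ψ : ℝ → JMGT.State n), 0 ≤ T → JMGT.IsSolution m τ b c k g T Ψ →
        ∀ t ∈ Icc 0 T,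
          JMGT.energyNormSq τ g (m - 2) Ψ t < ⊤ ∧ JMGT.dissNormSq τ g (m - 2) Ψ t < ⊤ ∧
          JMGT.energyNormSq τ g (m - 2) Ψ t + JMGT.dissNormSq τ g (m - 2) Ψ t ≤
            C * (JMGT.energyNormSq τ g (m - 2) Ψ 0
              + JMGT.energyNorm τ g (m - 2) Ψ t * JMGT.dissNormSq τ g (m - 2) Ψ t) := by
  -- In integers this yields m ≥ 3 and n < 2(m - 1), the second being the integrability threshold
  -- for the weight of order m - 1.
  have h2 : n + 2 < 2 * m := by
    have : (n : ℝ) + 2 < 2 * m := by linarith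
    exact_mod_cast this
  obtain ⟨C, hC, hmain⟩ := JMGT.exists_energyNorm_estimate (m := m) hn (by omega) (by omega)
    k hτ hg hb
  refine ⟨C.toNNReal + 1, by positivity, fun T Ψ _ hS t ht => ?_⟩
  -- The estimate at time t is the one for the solution restricted to [0, t], so the constant
  -- depends on neither t nor T.
  obtain ⟨h3, h4, h5⟩ := hmain t Ψ ht.1 (hS.mono ht.2)
  refine ⟨h3, h4, h5.trans (mul_le_mul' ?_ le_rfl)⟩
  rw [ENNReal.coe_add, ENNReal.coe_toNNReal hC.ne]
  exact le_self_add
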